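/- **Conventions.** Let $G$ be an abelian group. $\mathcal N(G)$ is the set of finite $Z\subset G$ with $Z=-Z$ and $0\in Z$. For $Z,W\in\mathcal N(G)$ the pair $(Z,W)$ is *$\tau$-closed* if there are $Z^-,Z^+\in\mathcal N(G)$ with $Z^-+W\subset Z$, $Z+W\subset Z^+$ and $|Z^+|\le(1+\tau)|Z^-|$. For $X,Y\subset G$ put $\mathcal C(X;Y)=\min\{|T|:T\subset G,\ X\subset T+Y\}$ (possibly $\infty$), and $$\mathcal C^\flat(X;Y)=\min\{\mathcal C(W;Z)\},$$ the minimum being over all abelian groups $H$, homomorphisms $\phi:\langle X\rangle\to H$ and sets $W,Z\subset H$ with $X\subset\phi^{-1}(W)$ and $\phi^{-1}(Z-Z)\subset Y$. A *system* on $G$ is a sequence $B=(B_i)_{i\ge0}$ of subsets of $G$ with $B_i=-B_i$, $0\in B_i$ and $B_{i+1}+B_{i+1}\subset B_i$ for all $i$; its dimension is $\dim B=\sup_{i\ge0}\log_2\mathcal C^\flat(B_i;B_{i+1})$, and $\mathcal C^\flat(S;B)$ means $\mathcal C^\flat(S;B_0)$. $\mathcal S(G)$ is the set of systems on $G$. For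 a finite non-empty $Z\subset G$, $m_Z$ is the uniform probability measure on $Z$; $n\cdot X=\{nx:x\in X\}$; $\|\mu\|=\sum_{x}|\mu(\{x\})|$ is the total variation norm; and $f\ast\mu(x)=\int f(x-y)\,d\mu(y)$. All probability spaces are discrete with finitely supported probability measure. $(\Omega',\mathbb P')$ *extends* $(\Omega,\mathbb P)$ if there is a map $\phi:\Omega'\to\Omega$ with $\mathbb P'(\phi^{-1}(E))=\mathbb P(E)$ for all $E\subset\Omega$; random variables on $\Omega$ are then regarded as random variables on $\Omega'$ by composition with $\phi$. **Statement.** There is an absolute constant $C>0$ such that the following holds. Let $G$ be an abelian group with no $2$-torsion and let $A,S\subset G$. Let $(\Omega,\mathbb P)$ be a probability space supporting a $G$-valued random variable $z$, an $\mathcal N(G)$-valued random variable $Z$ and an $\mathcal S(G)$-valued random variable $T$ such that for all $\omega\in\Omega$ $$\dim T(\omega)\le d,\qquad \mathcal C^\flat(S;T(\omega))\le D,\qquad (Z(\omega),T(\omega)_0)\text{ is }\tau\text{-closed},$$ where $\tau>0$, $d\ge1$ is real and $D\in[0,\infty]$. Let $\delta\in(0,1]$, and let $k,r\ge1$ be integers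 with $dk\ge2$. Then either $\tau^{-1}\le(\delta^{-1}r)^{C}$, or there is a probability space $(\Omega',\mathbb P')$ extending $(\Omega,\mathbb P)$, supporting a $G$-valued random variable $z'$ and an $\mathcal N(G)$-valued random variable $Z'$ with $$\|\mathbb E'm_{z'+Z'}-\mathbb E\,m_{z+Z}\|\le\delta,$$ and a further extension $(\Omega'',\mathbb P'')$ of $(\Omega',\mathbb P')$, supporting a $G$-valued random variable $z''$ and $\mathcal N(G)$-valued random variables $Z_1,\dots,Z_k$, such that: 1. $\|\mathbb E''m_{2^sz''+Z_i}-\mathbb E'm_{2^s\cdot(z'+Z')}\|\le\delta$ for all $1\le i\le k$ and $0\le s\le r$; 2. ($U_1$-uniformity) $\mathbb E''\,|m_{2^sz''+Z_i}(A)-m_{2^s\cdot(z'+Z')}(A)|^2\le\delta$ for all $1\le i\le k$ and $0\le s\le r$; 3. ($U_2$-uniformity) $$\mathbb E''\left\|1_{A\cap(2^sz''+Z_i)}\ast(1_A\,dm_{2^sz''+Z_j})-m_{2^s\cdot(z'+Z')}(A)^2\right\|^2_{L_2(m_{2^{s+1}z''+Z_i})}\le\delta$$ for all $1\le i<j\le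 k$ and $0\le s\le r$; 4. for all $\omega''\in\Omega''$, $(Z_i(\omega''),Z_{i+1}(\omega''))$ is $\delta$-closed for all $1\le i<k$, and $$\mathcal C^\flat(S;Z_k(\omega''))\le D\exp\left((dkr\delta^{-1})^{C}\right).$$ -/

import Mathlib

open scoped Pointwise ENNReal

universe u v

noncomputable section

/-- `𝒩(G)`: the finite symmetric neighbourhoods of the identity. -/
def Nbhd (G : Type u) [AddCommGroup G] : Set (Set G) :=
  {S | S.Finite ∧ -S = S ∧ (0 : G) ∈ S}

/-- `(Z, W)` is a `τ`-closed pair (of members of `𝒩(G)`). -/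
def TauClosed {G : Type u} [AddCommGroup G] (τ : ℝ) (Z W : Set G) : Prop :=
  Z ∈ Nbhd G ∧ W ∈ Nbhd G ∧ ∃ Zm ∈ Nbhd G, ∃ Zp ∈ Nbhd G,
    Zm + W ⊆ Z ∧ Z + W ⊆ Zp ∧ (Zp.ncard : ℝ) ≤ (1 + τ) * (Zm.ncard : ℝ)

/-- The covering number `𝒞(X;Y) = min {|T| : X ⊆ T + Y}`, equal to `∞` if there is no finite
such `T`. -/
def coverNum {G : Type u} [AddCommGroup G] (X Y : Set G) : ℕ∞ :=
  sInf {n | ∃ T : Set G, X ⊆ T + Y ∧ n = T.encard}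

/-- `𝒞^♭(X;Y)`: the minimum of `𝒞(W;Z)` over abelian groups `H`, homomorphisms
`φ : ⟨X⟩ → H` and sets `W, Z ⊆ H` with `X ⊆ φ⁻¹(W)` and `φ⁻¹(Z - Z) ⊆ Y`.
(The preimages are subsets of `⟨X⟩`, regarded here as subsets of `G`.) -/
def coverFlat {G : Type u} [AddCommGroup G] (X Y : Set G) : ℕ∞ :=
  sInf {n | ∃ (H : Type u) (_ : AddCommGroup H) (φ : AddSubgroup.closure X →+ H) (W Z : Set H),
    X ⊆ (fun x : AddSubgroup.closure X => (x : G)) '' (φ ⁻¹' W) ∧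
    (fun x : AddSubgroup.closure X => (x : G)) '' (φ ⁻¹' (Z - Z)) ⊆ Y ∧
    n = coverNum W Z}

/-- `𝒮(G)`: the systems on `G`. -/
structure GSystem (G : Type u) [AddCommGroup G] where
  set : ℕ → Set G
  neg_set : ∀ i, -set i = set i
  zero_mem : ∀ i, (0 : G) ∈ set i
  add_subset : ∀ i, set (i + 1) + set (i + 1) ⊆ set i

/-- `dim B = sup_i log₂ 𝒞^♭(B_i; B_{i+1})`, with values in the extended reals. -/
def GSystem.dim {G : Type u} [AddCommGroup G] (B : GSystem G) : EReal :=
  ⨆ i : ℕ, ENNReal.log (coverFlat (B.set i) (B.set (i + 1)) : ℝ≥0∞) / ((Real.log 2 : ℝ) : EReal)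

/-- Expectation over a (finitely supported) probability space. -/
def expect {Ω : Type v} (P : PMF Ω) (f : Ω → ℝ) : ℝ :=
  ∑' ω, (P ω).toReal * f ω

/-- The uniform probability measure `m_S` on a finite non-empty set `S`, as a mass function. -/
def unif {G : Type u} (S : Set G) : G → ℝ :=
  S.indicator (fun _ => (S.ncard : ℝ)⁻¹)

/-- `m_S(A)`. -/
def dens {G : Type u} (S A : Set G) : ℝ :=
  ((A ∩ S).ncard : ℝ) / (S.ncard : ℝ)

/-- The measure `𝔼 m_S` for a random finite non-empty set `S`, as a mass function. -/
def meanUnif {Ω : Type v} {G : Type u} (P : PMF Ω) (S : Ω → Set G) : G → ℝ :=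
  fun x => expect P (fun ω => unif (S ω) x)

/-- The total variation norm `‖μ‖ = ∑_x |μ({x})|` of a finitely supported measure, given by its
mass function. -/
def tvNorm {G : Type u} (μ : G → ℝ) : ℝ :=
  ∑' x, |μ x|

/-- Convolution `f ∗ μ (x) = ∫ f(x - y) dμ(y)` of a function with a finitely supported measure. -/
def convMeas {G : Type u} [AddCommGroup G] (f μ : G → ℝ) : G → ℝ :=
  fun x => ∑' y, f (x - y) * μ y

/-- The squared norm `‖f‖²` in `L₂(m_S)`. -/
def l2Sq {G : Type u} (S : Set G) (f : G → ℝ) : ℝ :=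
  ∑' x, (f x) ^ 2 * unif S x

/-- The dilate `n · X = {n x : x ∈ X}` (not the iterated sumset). -/
def dilate {G : Type u} [AddCommGroup G] (n : ℕ) (X : Set G) : Set G :=
  (fun x => n • x) '' X

/-- `(Ω', P')` is an extension of `(Ω, P)` through `φ`. -/
def IsExtension {Ω' Ω : Type v} (P' : PMF Ω') (P : PMF Ω) (φ : Ω' → Ω) : Prop :=
  ∀ E : Set Ω, P'.toOuterMeasure (φ ⁻¹' E) = P.toOuterMeasure E

end

/-! The proof is an energy increment. Its Fourier analysis is local, on finite subsets of an
arbitrary abelian group, and one refinement serves all the dilations by `2 ^ s`, `s ≤ r`, at once.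

A node of the iteration is a translate `z + Z` with a system `U` such that `Z` is almost invariant
under `U.set 0`. Pigeonholing inside `U.dilInter r` gives a chain of regular sets `W i`. Every
element of `W i` has the form `2 ^ s • u` with `u ∈ U.set 0`, for each `s ≤ r`, so the sets `2 ^ s •
(z + w) + W i`, `w ∈ Z`, average to `2 ^ s • (z + Z)` and the approximation property is automatic.
If uniformity fails, either the densities on these sets vary, or the balanced function has a large
local correlation. In the latter case `exists_character_of_conv_large` gives, for each such `w`, a
character on whose Bohr neighbourhoods the averages are large in `L²`. Either way, cutting `z + Z`
into pieces `z + w + ι v + B w`, where `ι` divides by a power of `2` and `B w` is a regular subset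
of a Bohr neighbourhood, raises the mean of `∑ s ≤ r` of the squared densities by `κ ^ 3 / 1024`
(`exists_increment`). This energy is at most `r + 1`, so after `J` rounds the pieces not known to be
uniform have mass `O((r + 1) / (κ ^ 3 J))` (`exists_leaves`). On those pieces the defects are still
at most `1 / 2`.

Covering numbers are handled by `Cov`: colourings whose classes have differences in a given set.
These pass through intersections, compositions and homomorphic images. A round adds to the exponents
only amounts polynomial in the parameters, and there are polynomially many rounds (`param_bound`).
Absence of `2`-torsion makes iterated intersections of dilates collapse (`dilInter_dilInter`) and
makes dilation preserve cardinality, so that Ruzsa's covering lemma controls the first system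
(`ctrl_shift`).

Finally `Ω'` selects a leaf, `Ω''` a uniform point `w` of its set, and `z'' = z' + w`. If `δ > 1 /
2` no round is run and the trivial bound `1 / 2` suffices. This case must be separate: at `δ = r =
1` only `τ < 1` is known, and making `Z` regular may use up the whole error `δ`. -/

open scoped BigOperators ComplexConjugate

/-! ### Closed pairs -/

lemma finset_mem_Nbhd_iff {G : Type u} [AddCommGroup G] {Z : Finset G} :
    (Z : Set G) ∈ Nbhd G ↔ (∀ x ∈ Z, -x ∈ Z) ∧ (0 : G) ∈ Z := by
  simp only [Nbhd, Set.mem_ofPred_eq, Finset.mem_coe]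
  constructor
  · rintro ⟨-, h, h0⟩
    refine ⟨fun x hx => ?_, h0⟩
    have : -x ∈ -(Z : Set G) := by simpa using hx
    rw [h] at this
    exact this
  · rintro ⟨h, h0⟩
    refine ⟨Z.finite_toSet, ?_, h0⟩
    ext x
    constructor
    · intro hx
      have := h _ (Set.mem_neg.1 hx)
      simpa using this
    · intro hx
      exact h _ hx

lemma Nbhd.neg_mem {G : Type u} [AddCommGroup G] {Z : Set G} (hZ : Z ∈ Nbhd G) {x : G}
    (hx : x ∈ Z) : -x ∈ Z := by
  have : -x ∈ -Z := by simpa using hx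
  rwa [hZ.2.1] at this

/-- Both `Z` and its translate contain `Zm` and lie in `Zp`, so their symmetric difference has at
most `|Zp| - |Zm| ≤ τ |Zm|` elements. -/
lemma TauClosed.norm_sum_sub_le {G : Type u} [AddCommGroup G] {E : Type*} [NormedAddCommGroup E]
    {τ : ℝ} {Z : Finset G} {W : Set G} (h : TauClosed τ (Z : Set G) W) (hτ : 0 ≤ τ) {w : G}
    (hw : w ∈ W) {f : G → E} (hf : ∀ x, ‖f x‖ ≤ 1) :
    ‖∑ x ∈ Z, f (x + w) - ∑ x ∈ Z, f x‖ ≤ τ * Z.card := by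
  classical
  obtain ⟨hZ, hW, Zm, hZm, Zp, hZp, hm, hp, hc⟩ := h
  set Y : Finset G := Z.image (· + w) with hY
  have e1 : ∑ x ∈ Z, f (x + w) = ∑ y ∈ Y, f y := by
    rw [hY, Finset.sum_image (fun a _ b _ hab => by simpa using hab)]
  have e2 : ∑ y ∈ Y, f y - ∑ x ∈ Z, f x = ∑ y ∈ Y \ Z, f y - ∑ x ∈ Z \ Y, f x := by
    rw [Finset.sum_sdiff_sub_sum_sdiff]
  have b1 : ∀ s : Finset G, ‖∑ y ∈ s, f y‖ ≤ s.card := fun s => by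
    refine (norm_sum_le _ _).trans ?_
    refine (Finset.sum_le_sum fun x _ => hf x).trans ?_
    simp
  have mZ : Zm ⊆ (Z : Set G) := fun x hx => hm ⟨x, hx, 0, hW.2.2, by simp⟩
  have mY : Zm ⊆ (Y : Set G) := fun x hx => by
    have : x + -w ∈ (Z : Set G) := hm ⟨x, hx, -w, Nbhd.neg_mem hW hw, rfl⟩
    simp only [hY, Finset.coe_image, Set.mem_image]
    exact ⟨x + -w, this, by abel⟩
  have pU : ((Y ∪ Z : Finset G) : Set G) ⊆ Zp := by
    intro x hx
    simp only [Finset.coe_union, Set.mem_union] at hx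
    rcases hx with hx | hx
    · simp only [hY, Finset.coe_image, Set.mem_image] at hx
      obtain ⟨a, ha, rfl⟩ := hx
      exact hp ⟨a, ha, w, hw, rfl⟩
    · exact hp ⟨x, hx, 0, hW.2.2, by simp⟩
  have c1 : ((Y ∪ Z).card : ℝ) ≤ Zp.ncard := by
    have := Set.ncard_le_ncard pU hZp.1
    rw [Set.ncard_coe_finset] at this
    exact_mod_cast this
  have c2 : (Zm.ncard : ℝ) ≤ (Y ∩ Z).card := by
    have : Zm ⊆ ((Y ∩ Z : Finset G) : Set G) := by
      rw [Finset.coe_inter]; exact Set.subset_inter mY mZ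
    have := Set.ncard_le_ncard this (Finset.finite_toSet _)
    rw [Set.ncard_coe_finset] at this
    exact_mod_cast this
  have c3 : (Zm.ncard : ℝ) ≤ Z.card := by
    have := Set.ncard_le_ncard mZ (Finset.finite_toSet _)
    rw [Set.ncard_coe_finset] at this
    exact_mod_cast this
  have c4 : ((Y \ Z).card : ℝ) + (Y ∩ Z).card = Y.card := by
    exact_mod_cast Finset.card_sdiff_add_card_inter Y Z
  have c5 : ((Z \ Y).card : ℝ) + (Y ∩ Z).card = Z.card := by
    rw [Finset.inter_comm]; exact_mod_cast Finset.card_sdiff_add_card_inter Z Y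
  have c6 : ((Y ∪ Z).card : ℝ) + (Y ∩ Z).card = Y.card + Z.card := by
    exact_mod_cast Finset.card_union_add_card_inter Y Z
  rw [e1, e2]
  refine (norm_sub_le _ _).trans ((add_le_add (b1 _) (b1 _)).trans ?_)
  have : τ * (Zm.ncard : ℝ) ≤ τ * Z.card := mul_le_mul_of_nonneg_left c3 hτ
  nlinarith

lemma TauClosed.nonempty {G : Type u} [AddCommGroup G] {τ : ℝ} {Z : Finset G} {W : Set G}
    (h : TauClosed τ (Z : Set G) W) : Z.Nonempty :=
  ⟨0, (finset_mem_Nbhd_iff.1 h.1).2⟩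

lemma TauClosed.abs_expect_sub_le {G : Type u} [AddCommGroup G]
    {τ : ℝ} {Z : Finset G} {W : Set G} (h : TauClosed τ (Z : Set G) W) (hτ : 0 ≤ τ) {w : G}
    (hw : w ∈ W) {f : G → ℝ} (hf : ∀ x, |f x| ≤ 1) :
    |(𝔼 x ∈ Z, f (x + w)) - 𝔼 x ∈ Z, f x| ≤ τ := by
  have hc : (0 : ℝ) < Z.card := by exact_mod_cast h.nonempty.card_pos
  rw [Finset.expect_eq_sum_div_card, Finset.expect_eq_sum_div_card, ← sub_div, abs_div,
    abs_of_pos hc, div_le_iff₀ hc]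
  exact h.norm_sum_sub_le (E := ℝ) hτ hw hf

lemma TauClosed.norm_expect_sub_le {G : Type u} [AddCommGroup G]
    {τ : ℝ} {Z : Finset G} {W : Set G} (h : TauClosed τ (Z : Set G) W) (hτ : 0 ≤ τ) {w : G}
    (hw : w ∈ W) {f : G → ℂ} (hf : ∀ x, ‖f x‖ ≤ 1) :
    ‖(𝔼 x ∈ Z, f (x + w)) - 𝔼 x ∈ Z, f x‖ ≤ τ := by
  have hc : (0 : ℝ) < Z.card := by exact_mod_cast h.nonempty.card_pos
  rw [Finset.expect_eq_sum_div_card, Finset.expect_eq_sum_div_card, ← sub_div, norm_div,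
    Complex.norm_natCast, div_le_iff₀ hc]
  exact h.norm_sum_sub_le hτ hw hf

lemma TauClosed.mono {G : Type u} [AddCommGroup G] {τ τ' : ℝ} {Z W W' : Set G}
    (h : TauClosed τ Z W) (hτ : τ ≤ τ') (hW' : W' ∈ Nbhd G) (hW : W' ⊆ W) : TauClosed τ' Z W' := by
  obtain ⟨hZ, -, Zm, hZm, Zp, hZp, hm, hp, hc⟩ := h
  refine ⟨hZ, hW', Zm, hZm, Zp, hZp, (Set.add_subset_add_left hW).trans hm,
    (Set.add_subset_add_left hW).trans hp, hc.trans ?_⟩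
  exact mul_le_mul_of_nonneg_right (by linarith) (by positivity)

/-! ### Regular sets by the pigeonhole principle -/

/-- The `l`-fold thickening `X + W + ⋯ + W`. -/
def thicken {G : Type u} [AddCommGroup G] (X W : Set G) : ℕ → Set G
  | 0 => X
  | l + 1 => thicken X W l + W

lemma thicken_mem_Nbhd {G : Type u} [AddCommGroup G] {X W : Set G} (hX : X ∈ Nbhd G)
    (hW : W ∈ Nbhd G) (l : ℕ) : thicken X W l ∈ Nbhd G := by
  induction l with
  | zero => exact hX
  | succ l ih =>
    refine ⟨ih.1.add hW.1, ?_, ⟨0, ih.2.2, 0, hW.2.2, by simp⟩⟩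
    change -(thicken X W l + W) = thicken X W l + W
    rw [neg_add, ih.2.1, hW.2.1]

lemma thicken_mono {G : Type u} [AddCommGroup G] {X W : Set G}
    (hW : W ∈ Nbhd G) : Monotone (thicken X W) :=
  monotone_nat_of_le_succ fun _ x hx => ⟨x, hx, 0, hW.2.2, by simp⟩

/-- If no odd thickening were regular, each double step would multiply the size by more than `1 +
η`, and after `L` of them it would exceed `(1 + η) ^ L ≥ 2 ^ F` times that of `X`. -/
lemma exists_tauClosed_thicken {G : Type u} [AddCommGroup G] {X W Y : Set G} (hX : X ∈ Nbhd G)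
    (hW : W ∈ Nbhd G) (hY : Y.Finite) {L : ℕ} (hL : thicken X W (2 * L) ⊆ Y) {F η : ℝ}
    (hη : 0 < η) (hη1 : η ≤ 1) (hF : F ≤ η * L) (hL0 : 0 < L)
    (hc : (Y.ncard : ℝ) ≤ 2 ^ F * X.ncard) :
    ∃ Z : Set G, X ⊆ Z ∧ Z ⊆ Y ∧ TauClosed η Z W := by
  by_contra hcon
  push Not at hcon
  have hpos : (0 : ℝ) < X.ncard := by
    have := (Set.ncard_pos hX.1).2 ⟨0, hX.2.2⟩
    exact_mod_cast this
  have key : ∀ l, l < L → (1 + η) * (thicken X W (2 * l)).ncard <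
      ((thicken X W (2 * (l + 1))).ncard : ℝ) := by
    intro l hl
    by_contra hle
    push Not at hle
    refine hcon (thicken X W (2 * l + 1)) ?_ ?_ ?_
    · exact thicken_mono hW (Nat.zero_le _)
    · exact (thicken_mono hW (by omega)).trans hL
    · exact ⟨thicken_mem_Nbhd hX hW _, hW, _, thicken_mem_Nbhd hX hW (2 * l), _,
        thicken_mem_Nbhd hX hW (2 * (l + 1)), subset_rfl, subset_rfl, hle⟩
  have key2 : ∀ l, l ≤ L → (1 + η) ^ l * X.ncard ≤ ((thicken X W (2 * l)).ncard : ℝ) := by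
    intro l
    induction l with
    | zero => intro _; simp [thicken]
    | succ l ih =>
      intro hl
      refine le_trans ?_ (key l (by omega)).le
      have := ih (by omega)
      rw [pow_succ']
      nlinarith
  have h1 := key (L - 1) (by omega)
  have h2 := key2 (L - 1) (by omega)
  rw [Nat.sub_add_cancel hL0] at h1
  have h3 : ((thicken X W (2 * L)).ncard : ℝ) ≤ Y.ncard := by
    exact_mod_cast Set.ncard_le_ncard hL hY
  have h4 : (2 : ℝ) ^ F ≤ (1 + η) ^ L := by
    -- Bernoulli's inequality for an exponent in `[0, 1]`.
    have h5 : (2 : ℝ) ^ η ≤ 1 + η := by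
      have := rpow_one_add_le_one_add_mul_self (s := 1) (by norm_num) hη.le hη1
      norm_num at this
      linarith
    calc (2 : ℝ) ^ F ≤ 2 ^ (η * L) := Real.rpow_le_rpow_of_exponent_le (by norm_num) hF
      _ = (2 ^ η) ^ L := by rw [Real.rpow_mul (by norm_num), Real.rpow_natCast]
      _ ≤ _ := pow_le_pow_left₀ (by positivity) h5 _
  have h6 : (1 + η) ^ L * X.ncard ≤ (1 + η) * (thicken X W (2 * (L - 1))).ncard := by
    conv_lhs => rw [← Nat.sub_add_cancel hL0, pow_succ']
    rw [mul_assoc]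
    exact mul_le_mul_of_nonneg_left h2 (by linarith)
  have h7 : (2 : ℝ) ^ F * X.ncard ≤ (1 + η) ^ L * X.ncard :=
    mul_le_mul_of_nonneg_right h4 hpos.le
  linarith

/-! ### Characters -/

/-- The inclusion `ℚ/ℤ → ℝ/ℤ`. -/
noncomputable def ratCircleHom : AddCircle (1 : ℚ) →+ AddCircle (1 : ℝ) :=
  QuotientAddGroup.map _ _ (Rat.castHom ℝ).toAddMonoidHom (by
    rw [AddSubgroup.zmultiples_le]
    simp [AddSubgroup.mem_comap])

lemma ratCircleHom_injective : Function.Injective ratCircleHom := by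
  rw [injective_iff_map_eq_zero]
  intro x
  induction x using QuotientAddGroup.induction_on with
  | H q =>
    intro h
    have h' : ((q : ℝ) : AddCircle (1 : ℝ)) = 0 := h
    rw [AddCircle.coe_eq_zero_iff] at h'
    obtain ⟨n, hn⟩ := h'
    have : (q : ℝ) = (n : ℝ) := by rw [← hn]; simp
    have hq : q = n := by exact_mod_cast this
    change ((q : ℚ) : AddCircle (1 : ℚ)) = 0
    rw [AddCircle.coe_eq_zero_iff]
    exact ⟨n, by simp [hq]⟩

lemma exists_nsmul_eq_zero_ratCircle (x : AddCircle (1 : ℚ)) : ∃ n : ℕ, 0 < n ∧ n • x = 0 := by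
  induction x using QuotientAddGroup.induction_on with
  | H q =>
    refine ⟨q.den, q.pos, ?_⟩
    change ((q.den • q : ℚ) : AddCircle (1 : ℚ)) = 0
    rw [AddCircle.coe_eq_zero_iff]
    exact ⟨q.num, by simp [Rat.den_mul_eq_num]⟩

/-- A `ℚ/ℤ`-valued character as a circle-valued additive character. -/
noncomputable def addCharOfRat {G : Type u} [AddCommGroup G] (χ : G →+ AddCircle (1 : ℚ)) :
    AddChar G Circle where
  toFun x := (ratCircleHom (χ x)).toCircle
  map_zero_eq_one' := by simp
  map_add_eq_mul' x y := by simp [AddCircle.toCircle_add]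

/-- Characters into `ℚ/ℤ` separate points, and since `ℚ/ℤ` is torsion all their values are roots of
unity. -/
lemma exists_addChar {G : Type u} [AddCommGroup G] (e : G) :
    ∃ ψ : AddChar G Circle, (e ≠ 0 → ψ e ≠ 1) ∧ ∀ u, ∃ n : ℕ, 0 < n ∧ (ψ u) ^ n = 1 := by
  have : ∃ χ : G →+ AddCircle (1 : ℚ), e ≠ 0 → χ e ≠ 0 := by
    by_cases he : e = 0
    · exact ⟨0, fun h => absurd he h⟩
    · obtain ⟨c, hc⟩ := CharacterModule.exists_character_apply_ne_zero_of_ne_zero he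
      exact ⟨c, fun _ => hc⟩
  obtain ⟨χ, hχ⟩ := this
  refine ⟨addCharOfRat χ, fun he h => hχ he ?_, fun u => ?_⟩
  · have h1 : (ratCircleHom (χ e)).toCircle = (0 : AddCircle (1 : ℝ)).toCircle := by
      rw [AddCircle.toCircle_zero]; exact h
    have h2 := AddCircle.injective_toCircle one_ne_zero h1
    exact ratCircleHom_injective (h2.trans (map_zero _).symm)
  · obtain ⟨n, hn, h⟩ := exists_nsmul_eq_zero_ratCircle (χ u)
    refine ⟨n, hn, ?_⟩
    rw [← AddChar.map_nsmul_eq_pow]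
    change (ratCircleHom (χ (n • u))).toCircle = 1
    rw [map_nsmul, h, map_zero, AddCircle.toCircle_zero]

/-- This replaces duality for finite groups. With `N` a common period of the values on `E`, take all
products of powers `ψ e ^ a e`, `a e < N`. The sum over exponents factorises, and the factor `e = u`
is a full geometric series of a nontrivial `N`-th root of unity. -/
lemma exists_orthogonal_characters {G : Type u} [AddCommGroup G] (E : Finset G) :
    ∃ (ι : Type u) (_ : Fintype ι) (_ : Nonempty ι) (γ : ι → AddChar G Circle),
      ∀ u ∈ E, u ≠ 0 → ∑ i, (γ i u : ℂ) = 0 := by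
  classical
  choose ψ hψ hfin using fun e : G => exists_addChar e
  choose n hn hpow using hfin
  set N : ℕ := ∏ e ∈ E, ∏ u ∈ E, n e u with hN
  have hNpos : 0 < N := Finset.prod_pos fun e _ => Finset.prod_pos fun u _ => hn e u
  have hpowN : ∀ e ∈ E, ∀ u ∈ E, (ψ e u) ^ N = 1 := by
    intro e he u hu
    have : n e u ∣ N := (Finset.dvd_prod_of_mem (fun u => n e u) hu).trans
      (Finset.dvd_prod_of_mem (fun e => ∏ u ∈ E, n e u) he)
    obtain ⟨m, hm⟩ := this
    rw [hm, pow_mul, hpow, one_pow]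
  have : Nonempty (Fin N) := ⟨⟨0, hNpos⟩⟩
  refine ⟨E → Fin N, inferInstance, inferInstance, fun a => ∏ e : E, (ψ e) ^ (a e : ℕ), ?_⟩
  intro u hu hu0
  have h1 : ∀ a : E → Fin N, (((∏ e : E, (ψ e) ^ (a e : ℕ)) u : Circle) : ℂ)
      = ∏ e : E, ((ψ e u : ℂ)) ^ (a e : ℕ) := by
    intro a
    rw [AddChar.prod_apply]
    refine (map_prod Circle.coeHom _ _).trans (Finset.prod_congr rfl fun e _ => ?_)
    simp only [AddChar.pow_apply, map_pow]
    rfl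
  simp_rw [h1]
  have h2 := Finset.prod_univ_sum (fun _ : E => (Finset.univ : Finset (Fin N)))
    (fun (e : E) (j : Fin N) => ((ψ e u : ℂ)) ^ (j : ℕ))
  rw [Fintype.piFinset_univ] at h2
  rw [← h2]
  refine Finset.prod_eq_zero (Finset.mem_univ ⟨u, hu⟩) ?_
  rw [Fin.sum_univ_eq_sum_range (fun j => ((ψ u u : ℂ)) ^ j) N]
  have hne : (ψ u u : ℂ) ≠ 1 := by
    intro h
    exact hψ u hu0 (by ext; simpa using h)
  rw [geom_sum_eq hne]
  have := hpowN u hu u hu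
  have h3 : (ψ u u : ℂ) ^ N = 1 := by
    rw [← Circle.coe_pow, this, Circle.coe_one]
  rw [h3, sub_self, zero_div]

/-! ### A local Fourier argument -/

/-- Parseval's identity. Orthogonality is needed only at differences of points of `T`, so a finite
family of characters is enough. -/
lemma sum_norm_sq_hat {G : Type u} [AddCommGroup G] {ι : Type*} [Fintype ι]
    {γ : ι → AddChar G Circle} {T : Finset G}
    (hγ : ∀ t ∈ T, ∀ t' ∈ T, t ≠ t' → ∑ i, (γ i (t - t') : ℂ) = 0) (F : G → ℝ) :
    ∑ i, ‖∑ t ∈ T, (F t : ℂ) * γ i t‖ ^ 2 = Fintype.card ι * ∑ t ∈ T, F t ^ 2 := by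
  classical
  have h1 : ∀ i, ((‖∑ t ∈ T, (F t : ℂ) * γ i t‖ ^ 2 : ℝ) : ℂ)
      = ∑ t ∈ T, ∑ t' ∈ T, (F t : ℂ) * F t' * γ i (t - t') := by
    intro i
    rw [Complex.ofReal_pow, ← Complex.mul_conj', map_sum, Finset.sum_mul_sum]
    refine Finset.sum_congr rfl fun t _ => Finset.sum_congr rfl fun t' _ => ?_
    rw [AddChar.map_sub_eq_div, map_mul, Complex.conj_ofReal, Circle.coe_div,
      div_eq_mul_inv, ← Circle.coe_inv, Circle.coe_inv_eq_conj]
    ring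
  have h2 : ((∑ i, ‖∑ t ∈ T, (F t : ℂ) * γ i t‖ ^ 2 : ℝ) : ℂ)
      = ((Fintype.card ι * ∑ t ∈ T, F t ^ 2 : ℝ) : ℂ) := by
    rw [Complex.ofReal_sum, Finset.sum_congr rfl fun i _ => h1 i, Finset.sum_comm]
    push_cast
    rw [Finset.mul_sum]
    refine Finset.sum_congr rfl fun t ht => ?_
    rw [Finset.sum_comm, Finset.sum_eq_single_of_mem t ht]
    · simp [pow_two]
    · intro t' ht' hne
      rw [← Finset.mul_sum, hγ t ht t' ht' hne.symm, mul_zero]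
  exact_mod_cast h2

/-- Since `T` contains `X + B`, the sum over `T` is complete for every shift by `v ∈ B`. -/
lemma hat_conv {G : Type u} [AddCommGroup G] (γ : AddChar G Circle) {X B T : Finset G}
    (hT : ∀ x ∈ X, ∀ v ∈ B, x + v ∈ T) {f : G → ℝ} (hf : ∀ x, x ∉ X → f x = 0) (h : G → ℝ) :
    ∑ t ∈ T, ((𝔼 v ∈ B, f (t - v) * h v : ℝ) : ℂ) * γ t
      = (𝔼 v ∈ B, (h v : ℂ) * γ v) * ∑ x ∈ X, (f x : ℂ) * γ x := by
  classical
  have h1 : ∀ v ∈ B, ∑ t ∈ T, (f (t - v) : ℂ) * γ (t - v) = ∑ x ∈ X, (f x : ℂ) * γ x := by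
    intro v hv
    have e1 : ∑ t ∈ X.image (· + v), (f (t - v) : ℂ) * γ (t - v) = ∑ x ∈ X, (f x : ℂ) * γ x := by
      rw [Finset.sum_image fun a _ b _ hab => by simpa using hab]
      exact Finset.sum_congr rfl fun x _ => by rw [add_sub_cancel_right]
    rw [← e1]
    symm
    refine Finset.sum_subset ?_ ?_
    · intro y hy
      obtain ⟨x, hx, rfl⟩ := Finset.mem_image.1 hy
      exact hT x hx v hv
    · intro t _ ht
      rw [hf (t - v), Complex.ofReal_zero, zero_mul]
      intro hx
      exact ht (Finset.mem_image.2 ⟨t - v, hx, by abel⟩)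
  simp only [Finset.expect_eq_sum_div_card]
  rw [div_mul_eq_mul_div, Finset.sum_mul]
  push_cast
  simp_rw [div_mul_eq_mul_div]
  rw [← Finset.sum_div]
  congr 1
  simp_rw [Finset.sum_mul]
  rw [Finset.sum_comm]
  refine Finset.sum_congr rfl fun v hv => ?_
  rw [← h1 v hv, Finset.mul_sum]
  refine Finset.sum_congr rfl fun t _ => ?_
  have : (γ t : ℂ) = γ v * γ (t - v) := by
    rw [← Circle.coe_mul, ← AddChar.map_add_eq_mul]
    congr 2
    abel
  rw [this]
  ring

lemma sum_sq_conv {G : Type u} [AddCommGroup G] {ι : Type*} [Fintype ι] [Nonempty ι]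
    {γ : ι → AddChar G Circle} {X B T : Finset G}
    (hγ : ∀ t ∈ T, ∀ t' ∈ T, t ≠ t' → ∑ i, (γ i (t - t') : ℂ) = 0)
    (hT : ∀ x ∈ X, ∀ v ∈ B, x + v ∈ T) {f : G → ℝ} (hf : ∀ x, x ∉ X → f x = 0) (h : G → ℝ) :
    (∑ t ∈ T, (𝔼 v ∈ B, f (t - v) * h v) ^ 2) / X.card
      = ∑ i, ‖∑ x ∈ X, (f x : ℂ) * γ i x‖ ^ 2 / (Fintype.card ι * X.card) *
          ‖𝔼 v ∈ B, (h v : ℂ) * γ i v‖ ^ 2 := by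
  have hc : (0 : ℝ) < Fintype.card ι := by exact_mod_cast Fintype.card_pos
  have := sum_norm_sq_hat hγ (fun t => 𝔼 v ∈ B, f (t - v) * h v)
  simp_rw [hat_conv _ hT hf h, norm_mul, mul_pow] at this
  rw [eq_comm, mul_comm, ← eq_div_iff hc.ne'] at this
  rw [this, div_div, Finset.sum_div]
  refine Finset.sum_congr rfl fun i _ => ?_
  ring

/-- If the convolution of `f` with the restriction of `h` to `Y` is large in `L²`, then the averages
of `f` over the Bohr neighbourhoods of some character are large in `L²`. -/
lemma exists_character_of_conv_large {G : Type u} [AddCommGroup G] {X Y T : Finset G} {M : Set G}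
    {η N : ℝ} (hη : 0 ≤ η) (hYM : TauClosed η (Y : Set G) M) (hX : X.Nonempty)
    (hT : ∀ x ∈ X, ∀ v ∈ Y, x + v ∈ T) (hTM : ∀ x ∈ X, ∀ v ∈ M, x + v ∈ T)
    {f h : G → ℝ} (hf : ∀ x, x ∉ X → f x = 0) (hf1 : ∀ x, |f x| ≤ 1) (hh : ∀ x, |h x| ≤ 1)
    (hN : (∑ t ∈ T, (𝔼 v ∈ Y, f (t - v) * h v) ^ 2) / X.card = N) (hN0 : 0 < N)
    (hηN : 8 * η ≤ N ^ 2) :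
    ∃ γ₀ : AddChar G Circle, ∀ B : Finset G, B.Nonempty → (B : Set G) ⊆ M →
      (∀ v ∈ B, ‖(γ₀ v : ℂ) - 1‖ ≤ 1 / 4) →
      N ^ 2 / 8 ≤ (∑ t ∈ T, (𝔼 v ∈ B, f (t - v)) ^ 2) / X.card := by
  classical
  obtain ⟨ι, _, _, γ, hγ'⟩ := exists_orthogonal_characters (T - T)
  have hγ : ∀ t ∈ T, ∀ t' ∈ T, t ≠ t' → ∑ i, (γ i (t - t') : ℂ) = 0 := fun t ht t' ht' hne =>
    hγ' _ (Finset.sub_mem_sub ht ht') (sub_ne_zero.2 hne)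
  have hXT : X ⊆ T := fun x hx => by simpa using hTM x hx 0 hYM.2.1.2.2
  have hcι : (0 : ℝ) < Fintype.card ι := by exact_mod_cast Fintype.card_pos
  have hcX : (0 : ℝ) < X.card := by exact_mod_cast hX.card_pos
  have hY := hYM.nonempty
  -- The normalised energy spectrum of `f`. By Parseval its total mass is at most `1`.
  set μ : ι → ℝ := fun i => ‖∑ x ∈ X, (f x : ℂ) * γ i x‖ ^ 2 / (Fintype.card ι * X.card) with hμ
  have hμ0 : ∀ i, 0 ≤ μ i := fun i => by positivity
  have hμ1 : ∑ i, μ i ≤ 1 := by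
    rw [hμ, ← Finset.sum_div, sum_norm_sq_hat
      (fun t ht t' ht' hne => hγ t (hXT ht) t' (hXT ht') hne) f, div_le_one (by positivity)]
    refine mul_le_mul_of_nonneg_left ?_ hcι.le
    have : ∑ t ∈ X, f t ^ 2 ≤ ∑ t ∈ X, (1 : ℝ) := Finset.sum_le_sum fun x _ => by
      rw [sq_le_one_iff_abs_le_one]; exact hf1 x
    simpa using this
  set H : ι → ℂ := fun i => 𝔼 v ∈ Y, (h v : ℂ) * γ i v with hH
  have hγn : ∀ i v, ‖(γ i v : ℂ)‖ = 1 := fun i v => Circle.norm_coe _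
  have hnE : ∀ (B : Finset G) (F : G → ℂ), B.Nonempty → (∀ x, ‖F x‖ ≤ 1) →
      ‖𝔼 v ∈ B, F v‖ ≤ 1 := by
    intro B F hB hF
    have hc : (0 : ℝ) < B.card := by exact_mod_cast hB.card_pos
    rw [Finset.expect_eq_sum_div_card, norm_div, Complex.norm_natCast, div_le_one hc]
    refine (norm_sum_le _ _).trans ((Finset.sum_le_sum fun x _ => hF x).trans (by simp))
  have hH1 : ∀ i, ‖H i‖ ≤ 1 := fun i => hnE Y _ hY fun v => by
    rw [norm_mul, hγn, mul_one, Complex.norm_real]; exact hh v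
  have hNeq : N = ∑ i, μ i * ‖H i‖ ^ 2 := by rw [← hN, sum_sq_conv hγ hT hf h]
  set c : ι → ι → ℝ := fun l i => ‖𝔼 v ∈ Y, (γ i v : ℂ) * conj (γ l v : ℂ)‖ with hc
  set P : G → ℂ := fun v => ∑ i, (μ i : ℂ) * conj (H i) * γ i v with hP
  -- Duality: `N` is the pairing of `h` with the trigonometric polynomial `P`, so `h` can be
  -- discarded and Cauchy–Schwarz applied to `P` alone.
  have hN1 : N ≤ 𝔼 v ∈ Y, ‖P v‖ := by
    have e1 : (N : ℂ) = 𝔼 v ∈ Y, (h v : ℂ) * P v := by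
      rw [hNeq]
      simp only [hP, Finset.mul_sum]
      rw [Finset.expect_sum_comm, Complex.ofReal_sum]
      refine Finset.sum_congr rfl fun i _ => ?_
      have e3 : ((μ i * ‖H i‖ ^ 2 : ℝ) : ℂ) = (μ i : ℂ) * conj (H i) * H i := by
        rw [Complex.ofReal_mul, Complex.ofReal_pow, ← Complex.mul_conj']
        ring
      rw [e3]
      refine (Finset.mul_expect _ _ _).trans ?_
      refine Finset.expect_congr rfl fun v _ => ?_
      ring
    have e2 : N = ‖(N : ℂ)‖ := by rw [Complex.norm_real, Real.norm_eq_abs, abs_of_pos hN0]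
    rw [e2, e1, Finset.expect_eq_sum_div_card, Finset.expect_eq_sum_div_card, norm_div,
      Complex.norm_natCast]
    refine div_le_div_of_nonneg_right ?_ (Nat.cast_nonneg _)
    refine (norm_sum_le _ _).trans (Finset.sum_le_sum fun v _ => ?_)
    rw [norm_mul, Complex.norm_real]
    exact mul_le_of_le_one_left (norm_nonneg _) (hh v)
  have hN2 : N ^ 2 ≤ 𝔼 v ∈ Y, ‖P v‖ ^ 2 := by
    have h1 := Finset.expect_mul_sq_le_sq_mul_sq Y (fun v => ‖P v‖) (fun _ => (1 : ℝ))
    have h2 : 𝔼 v ∈ Y, (1 : ℝ) ^ 2 = 1 := by rw [Finset.expect_const hY, one_pow]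
    rw [h2] at h1
    simp only [mul_one] at h1
    exact (pow_le_pow_left₀ hN0.le hN1 2).trans h1
  have hN3 : 𝔼 v ∈ Y, ‖P v‖ ^ 2 ≤ ∑ l, μ l * ∑ i, μ i * c l i := by
    have e1 : ((𝔼 v ∈ Y, ‖P v‖ ^ 2 : ℝ) : ℂ) = ∑ l, ∑ i, (μ l : ℂ) * μ i * H l * conj (H i) *
        𝔼 v ∈ Y, (γ i v : ℂ) * conj (γ l v : ℂ) := by
      have e3 : ∀ v, ((‖P v‖ ^ 2 : ℝ) : ℂ) = ∑ l, ∑ i, (μ l : ℂ) * μ i * H l * conj (H i) *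
          ((γ i v : ℂ) * conj (γ l v : ℂ)) := by
        intro v
        rw [Complex.ofReal_pow, ← Complex.mul_conj', hP, map_sum, Finset.sum_mul_sum,
          Finset.sum_comm]
        refine Finset.sum_congr rfl fun l _ => Finset.sum_congr rfl fun i _ => ?_
        simp only [map_mul, Complex.conj_conj, Complex.conj_ofReal]
        ring
      rw [Finset.expect_eq_sum_div_card, Complex.ofReal_div, Complex.ofReal_sum,
        Complex.ofReal_natCast, ← Finset.expect_eq_sum_div_card,
        Finset.expect_congr rfl fun v _ => e3 v, Finset.expect_sum_comm]
      refine Finset.sum_congr rfl fun l _ => ?_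
      rw [Finset.expect_sum_comm]
      exact Finset.sum_congr rfl fun i _ => (Finset.mul_expect _ _ _).symm
    have e2 : (𝔼 v ∈ Y, ‖P v‖ ^ 2) = ‖((𝔼 v ∈ Y, ‖P v‖ ^ 2 : ℝ) : ℂ)‖ := by
      rw [Complex.norm_real, Real.norm_eq_abs, abs_of_nonneg]
      exact Finset.expect_nonneg fun _ _ => by positivity
    rw [e2, e1]
    refine (norm_sum_le _ _).trans (Finset.sum_le_sum fun l _ => ?_)
    rw [Finset.mul_sum]
    refine (norm_sum_le _ _).trans (Finset.sum_le_sum fun i _ => ?_)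
    simp only [norm_mul, Complex.norm_real, RCLike.norm_conj, Real.norm_eq_abs,
      abs_of_nonneg (hμ0 _)]
    have : ‖H l‖ * ‖H i‖ ≤ 1 := mul_le_one₀ (hH1 l) (norm_nonneg _) (hH1 i)
    calc μ l * μ i * ‖H l‖ * ‖H i‖ * c l i = (‖H l‖ * ‖H i‖) * (μ l * (μ i * c l i)) := by ring
      _ ≤ 1 * (μ l * (μ i * c l i)) := mul_le_mul_of_nonneg_right this
          (mul_nonneg (hμ0 _) (mul_nonneg (hμ0 _) (norm_nonneg _)))
      _ = _ := one_mul _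
  -- The `μ`-weighted sum over `l` is at least `N ^ 2` and `μ` has mass at most `1`, so a single `γ
  -- l` correlates on `Y` with much of the spectrum.
  obtain ⟨l, -, hl⟩ := Finset.exists_max_image Finset.univ (fun l => ∑ i, μ i * c l i)
    Finset.univ_nonempty
  have hS : N ^ 2 ≤ ∑ i, μ i * c l i := by
    have h0 : 0 ≤ ∑ i, μ i * c l i := Finset.sum_nonneg fun i _ =>
      mul_nonneg (hμ0 i) (norm_nonneg _)
    calc N ^ 2 ≤ ∑ l, μ l * ∑ i, μ i * c l i := hN2.trans hN3
      _ ≤ ∑ l', μ l' * ∑ i, μ i * c l i := Finset.sum_le_sum fun l' _ =>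
          mul_le_mul_of_nonneg_left (hl l' (Finset.mem_univ _)) (hμ0 _)
      _ = (∑ l', μ l') * ∑ i, μ i * c l i := by rw [Finset.sum_mul]
      _ ≤ 1 * ∑ i, μ i * c l i := mul_le_mul_of_nonneg_right hμ1 h0
      _ = _ := one_mul _
  refine ⟨γ l, fun B hB hBM hBγ => ?_⟩
  have hfin := sum_sq_conv hγ (fun x hx v hv => hTM x hx v (hBM hv)) hf (fun _ => (1 : ℝ))
  simp only [mul_one, Complex.ofReal_one, one_mul] at hfin
  rw [hfin]
  have hcB : (0 : ℝ) < B.card := by exact_mod_cast hB.card_pos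
  -- For `c l i < N ^ 2 / 2` the left side is negative. Otherwise `γ i` is close to `γ l` on `M`,
  -- hence close to `1` on `B`, and its mean over `B` is at least `1 / 2` in modulus.
  have key : ∀ i, (c l i - N ^ 2 / 2) / 4 ≤ ‖𝔼 v ∈ B, (γ i v : ℂ)‖ ^ 2 := by
    intro i
    by_cases hci : c l i < N ^ 2 / 2
    · have : 0 ≤ ‖𝔼 v ∈ B, (γ i v : ℂ)‖ ^ 2 := by positivity
      linarith
    push Not at hci
    have hc1 : c l i ≤ 1 := hnE Y _ hY fun v => by
      rw [norm_mul, RCLike.norm_conj, hγn, hγn, mul_one]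
    -- Translation by `m` multiplies the mean of `γ i * conj (γ l)` over `Y` by the value at `m`,
    -- yet changes it by at most `η`. The mean has modulus at least `N ^ 2 / 2 ≥ 4 * η`, so the
    -- value is within `1 / 4` of `1`.
    have hclose : ∀ m ∈ M, ‖(γ i m : ℂ) - γ l m‖ ≤ 1 / 4 := by
      intro m hm
      have h1 := hYM.norm_expect_sub_le hη hm (f := fun v => (γ i v : ℂ) * conj (γ l v : ℂ))
        (fun v => by rw [norm_mul, RCLike.norm_conj, hγn, hγn, mul_one])
      have h2 : (𝔼 x ∈ Y, (γ i (x + m) : ℂ) * conj (γ l (x + m) : ℂ)) =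
          ((γ i m : ℂ) * conj (γ l m : ℂ)) * 𝔼 x ∈ Y, (γ i x : ℂ) * conj (γ l x : ℂ) := by
        rw [Finset.mul_expect]
        refine Finset.expect_congr rfl fun x _ => ?_
        rw [AddChar.map_add_eq_mul, AddChar.map_add_eq_mul, Circle.coe_mul, Circle.coe_mul,
          map_mul]
        ring
      rw [h2, ← sub_one_mul, norm_mul] at h1
      have h3 : ‖(γ i m : ℂ) * conj (γ l m : ℂ) - 1‖ = ‖(γ i m : ℂ) - γ l m‖ := by
        have h4 : (γ l m : ℂ) * conj (γ l m : ℂ) = 1 := by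
          rw [Complex.mul_conj', hγn]; norm_num
        rw [← h4, ← sub_mul, norm_mul, RCLike.norm_conj, hγn, mul_one]
      rw [h3] at h1
      have h5 : ‖(γ i m : ℂ) - γ l m‖ * (N ^ 2 / 2) ≤ η :=
        (mul_le_mul_of_nonneg_left hci (norm_nonneg _)).trans h1
      have h6 : 0 < N ^ 2 := by positivity
      nlinarith [norm_nonneg ((γ i m : ℂ) - γ l m)]
    have hhalf : ‖(𝔼 v ∈ B, (γ i v : ℂ)) - 1‖ ≤ 1 / 2 := by
      have : (𝔼 v ∈ B, (γ i v : ℂ)) - 1 = 𝔼 v ∈ B, ((γ i v : ℂ) - 1) := by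
        rw [Finset.expect_sub_distrib, Finset.expect_const hB]
      rw [this, Finset.expect_eq_sum_div_card, norm_div, Complex.norm_natCast, div_le_iff₀ hcB]
      refine (norm_sum_le _ _).trans ((Finset.sum_le_sum fun v hv => ?_).trans
        (b := ∑ v ∈ B, (1 / 2 : ℝ)) (by simp; linarith))
      have := norm_add_le ((γ i v : ℂ) - γ l v) ((γ l v : ℂ) - 1)
      rw [sub_add_sub_cancel] at this
      linarith [hclose v (hBM hv), hBγ v hv]
    have h7 : (1 / 2 : ℝ) ≤ ‖𝔼 v ∈ B, (γ i v : ℂ)‖ := by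
      have := norm_sub_norm_le (1 : ℂ) (1 - 𝔼 v ∈ B, (γ i v : ℂ))
      rw [sub_sub_cancel, norm_one, norm_sub_rev] at this
      linarith
    have : 0 ≤ N ^ 2 := by positivity
    nlinarith
  calc N ^ 2 / 8 ≤ (∑ i, μ i * c l i - N ^ 2 / 2 * ∑ i, μ i) / 4 := by
        have : N ^ 2 / 2 * ∑ i, μ i ≤ N ^ 2 / 2 * 1 :=
          mul_le_mul_of_nonneg_left hμ1 (by positivity)
        linarith
    _ = ∑ i, μ i * ((c l i - N ^ 2 / 2) / 4) := by
        rw [Finset.mul_sum, ← Finset.sum_sub_distrib, Finset.sum_div]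
        refine Finset.sum_congr rfl fun i _ => by ring
    _ ≤ _ := Finset.sum_le_sum fun i _ => mul_le_mul_of_nonneg_left (key i) (hμ0 i)

/-! ### Covering by sets with prescribed differences -/

/-- `X` is a union of at most `B` sets whose difference sets lie in `Y`. -/
def Cov {G : Type u} [AddCommGroup G] (B : ℝ) (X Y : Set G) : Prop :=
  ∃ (ι : Type) (_ : Fintype ι) (c : X → ι), (Fintype.card ι : ℝ) ≤ B ∧
    ∀ x y : X, c x = c y → (x : G) - y ∈ Y

namespace Cov

variable {G : Type u} [AddCommGroup G] {B B' : ℝ} {X X' Y Y' : Set G}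

lemma mono (h : Cov B X Y) (hB : B ≤ B') (hX : X' ⊆ X) (hY : Y ⊆ Y') : Cov B' X' Y' := by
  obtain ⟨ι, hι, c, hc, hcY⟩ := h
  exact ⟨ι, hι, fun x => c ⟨x, hX x.2⟩, hc.trans hB, fun x y hxy => hY (hcY _ _ hxy)⟩

lemma inter (h : Cov B X Y) (h' : Cov B' X Y') : Cov (B * B') X (Y ∩ Y') := by
  obtain ⟨ι, hι, c, hc, hcY⟩ := h
  obtain ⟨κ, hκ, e, he, heY⟩ := h'
  refine ⟨ι × κ, inferInstance, fun x => (c x, e x), ?_, fun x y hxy => ?_⟩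
  · rw [Fintype.card_prod, Nat.cast_mul]
    exact mul_le_mul hc he (Nat.cast_nonneg _) ((Nat.cast_nonneg _).trans hc)
  · exact ⟨hcY _ _ (congrArg Prod.fst hxy), heY _ _ (congrArg Prod.snd hxy)⟩

/-- Subtracting a fixed representative moves each class into `Y`, where the second colouring
applies. -/
lemma trans {Z : Set G} (h : Cov B X Y) (h' : Cov B' Y Z) : Cov (B * B') X Z := by
  classical
  obtain ⟨ι, hι, c, hc, hcY⟩ := h
  obtain ⟨κ, hκ, e, he, heY⟩ := h'
  have hb : ∃ b : X → X, (∀ x, c (b x) = c x) ∧ ∀ x y, c x = c y → b x = b y := by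
    refine ⟨fun x => Classical.choose (⟨x, rfl⟩ : ∃ y : X, c y = c x), fun x =>
      Classical.choose_spec (⟨x, rfl⟩ : ∃ y : X, c y = c x), fun x y hxy => ?_⟩
    simp only [hxy]
  obtain ⟨b, hb1, hb2⟩ := hb
  refine ⟨ι × κ, inferInstance,
    fun x => (c x, e ⟨(x : G) - b x, hcY x (b x) (hb1 x).symm⟩), ?_, fun x y hxy => ?_⟩
  · rw [Fintype.card_prod, Nat.cast_mul]
    exact mul_le_mul hc he (Nat.cast_nonneg _) ((Nat.cast_nonneg _).trans hc)
  · have h1 : c x = c y := congrArg Prod.fst hxy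
    have h2 := heY _ _ (congrArg Prod.snd hxy)
    simpa [hb2 x y h1] using h2

lemma image (h : Cov B X Y) (φ : G →+ G) : Cov B (φ '' X) (φ '' Y) := by
  obtain ⟨ι, hι, c, hc, hcY⟩ := h
  choose p hp hpe using fun x : φ '' X => x.2
  refine ⟨ι, hι, fun x => c ⟨p x, hp x⟩, hc, fun x y hxy => ?_⟩
  exact ⟨p x - p y, hcY _ _ hxy, by rw [map_sub, hpe, hpe]⟩

lemma dilate (h : Cov B X Y) (n : ℕ) : Cov B (dilate n X) (dilate n Y) :=
  h.image (nsmulAddMonoidHom n)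

lemma forall_le {m : ℕ} {Y : ℕ → Set G} (h : ∀ t ≤ m, Cov B X (Y t)) :
    Cov (B ^ (m + 1)) X {x | ∀ t ≤ m, x ∈ Y t} := by
  induction m with
  | zero =>
    refine (h 0 le_rfl).mono (by simp) subset_rfl ?_
    intro x hx t ht
    rw [Nat.le_zero.1 ht]
    exact hx
  | succ m ih =>
    have h1 := (ih fun t ht => h t (by omega)).inter (h (m + 1) le_rfl)
    refine h1.mono (by rw [pow_succ _ (m + 1)]) subset_rfl ?_
    rintro x ⟨hx, hx'⟩ t ht
    rcases Nat.le_succ_iff.1 ht with ht | rfl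
    · exact hx t ht
    · exact hx'

lemma ncard_le (h : Cov B X Y) (hX : X.Finite) (hY : Y.Finite) :
    (X.ncard : ℝ) ≤ B * Y.ncard := by
  classical
  obtain ⟨ι, hι, c, hc, hcY⟩ := h
  have : Fintype X := hX.fintype
  have h1 : (Finset.univ : Finset X).card ≤ Y.ncard * (Finset.univ : Finset ι).card := by
    refine Finset.card_le_mul_card_image_of_maps_to (f := c) (fun _ _ => Finset.mem_univ _) _ ?_
    intro i _
    by_cases hne : ((Finset.univ : Finset X).filter (fun x => c x = i)).Nonempty
    · obtain ⟨x₀, hx₀⟩ := hne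
      rw [← Set.ncard_coe_finset]
      refine Set.ncard_le_ncard_of_injOn (fun x : X => (x : G) - x₀) ?_ ?_ hY
      · intro x hx
        simp only [Finset.coe_filter, Finset.mem_univ, true_and, Set.mem_ofPred_eq,
          Finset.mem_filter] at hx hx₀
        exact hcY _ _ (hx.trans hx₀.symm)
      · intro x _ y _ hxy
        exact Subtype.ext (sub_left_injective hxy)
    · rw [Finset.not_nonempty_iff_eq_empty.1 hne]
      simp
  have h2 : X.ncard = (Finset.univ : Finset X).card := by
    rw [← Nat.card_coe_set_eq, Nat.card_eq_fintype_card, Finset.card_univ]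
  rw [h2]
  calc ((Finset.univ : Finset X).card : ℝ) ≤ Y.ncard * Fintype.card ι := by exact_mod_cast h1
    _ = Fintype.card ι * Y.ncard := mul_comm _ _
    _ ≤ _ := mul_le_mul_of_nonneg_right hc (Nat.cast_nonneg _)

lemma of_subset_add {T : Set G} (hT : T.Finite) (hTB : (T.ncard : ℝ) ≤ B) (h : X ⊆ T + Y)
    (hY : Y - Y ⊆ Y') : Cov B X Y' := by
  have : Fintype T := hT.fintype
  choose t ht y hy hty using fun x : X => h x.2
  let e := Fintype.equivFin T
  refine ⟨Fin (Fintype.card T), inferInstance, fun x => e ⟨t x, ht x⟩, ?_, fun x x' hxx => ?_⟩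
  · rwa [Fintype.card_fin, ← Nat.card_eq_fintype_card, Nat.card_coe_set_eq]
  · have h1 : t x = t x' := congrArg Subtype.val (e.injective hxx)
    have e1 := hty x
    have e2 := hty x'
    simp only at e1 e2
    refine hY ⟨y x, hy x, y x', hy x', ?_⟩
    simp only
    rw [← e1, ← e2, h1]
    abel

lemma of_ncard_add_le (hX : X.Finite) (hY : Y.Finite) (hY0 : Y.Nonempty)
    (h : ((X + Y).ncard : ℝ) ≤ B * Y.ncard) : Cov B X ((Y - Y) - (Y - Y)) := by
  obtain ⟨F, -, hF, hXF, hFfin⟩ := Set.ruzsa_covering_add hX hY hY0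
    (by simpa [Nat.card_coe_set_eq] using h)
  exact of_subset_add hFfin (by simpa [Nat.card_coe_set_eq] using hF) hXF subset_rfl

lemma exists_subset_add (h : Cov B X Y) :
    ∃ T : Set G, T.Finite ∧ (T.ncard : ℝ) ≤ B ∧ X ⊆ T + Y := by
  classical
  obtain ⟨ι, hι, c, hc, hcY⟩ := h
  have hb : ∃ b : X → X, (∀ x, c (b x) = c x) ∧ ∀ x y, c x = c y → b x = b y := by
    refine ⟨fun x => Classical.choose (⟨x, rfl⟩ : ∃ y : X, c y = c x), fun x =>
      Classical.choose_spec (⟨x, rfl⟩ : ∃ y : X, c y = c x), fun x y hxy => ?_⟩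
    simp only [hxy]
  obtain ⟨b, hb1, hb2⟩ := hb
  have hinj : Set.InjOn c (Set.range b) := by
    rintro _ ⟨x, rfl⟩ _ ⟨y, rfl⟩ hxy
    rw [hb1, hb1] at hxy
    exact hb2 x y hxy
  have hfin : (Set.range b).Finite := Set.Finite.of_finite_image (Set.toFinite _) hinj
  refine ⟨Subtype.val '' Set.range b, hfin.image _, ?_, ?_⟩
  · have h1 : (Subtype.val '' Set.range b : Set G).ncard ≤ (Set.range b).ncard :=
      Set.ncard_image_le hfin
    have h2 : (Set.range b).ncard ≤ (Set.univ : Set ι).ncard := by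
      rw [← hinj.ncard_image]
      exact Set.ncard_le_ncard (Set.subset_univ _)
    rw [Set.ncard_univ, Nat.card_eq_fintype_card] at h2
    exact (by exact_mod_cast h1.trans h2 : ((Subtype.val '' Set.range b : Set G).ncard : ℝ)
      ≤ Fintype.card ι).trans hc
  · intro x hx
    refine ⟨b ⟨x, hx⟩, ⟨_, ⟨_, rfl⟩, rfl⟩, x - b ⟨x, hx⟩, hcY ⟨x, hx⟩ _ (hb1 _).symm, ?_⟩
    simp

end Cov

/-- Points sent by `φ` into one translate of `Z` differ by an element of `φ⁻¹(Z - Z)`. Colouring by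
translates therefore pulls back from `H` to `G`. -/
lemma cov_of_coverFlat {G : Type u} [AddCommGroup G] {X Y : Set G} {N : ℕ}
    (h : coverFlat X Y ≤ N) : Cov N X Y := by
  -- An infimum in `ℕ∞` is attained once the set is non-empty; the empty set would give `⊤`.
  have h1 := csInf_mem (s := {n | ∃ (H : Type u) (_ : AddCommGroup H)
    (φ : AddSubgroup.closure X →+ H) (W Z : Set H),
    X ⊆ (fun x : AddSubgroup.closure X => (x : G)) '' (φ ⁻¹' W) ∧
    (fun x : AddSubgroup.closure X => (x : G)) '' (φ ⁻¹' (Z - Z)) ⊆ Y ∧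
    n = coverNum W Z}) (by
      by_contra hne
      rw [Set.not_nonempty_iff_eq_empty] at hne
      unfold coverFlat at h
      rw [hne, sInf_empty] at h
      exact absurd h (by simp))
  obtain ⟨H, _, φ, W, Z, hW, hZ, hn⟩ := h1
  have h2 : coverNum W Z ≤ N := by rw [← hn]; exact h
  have h3 := csInf_mem (s := {n : ℕ∞ | ∃ T : Set H, W ⊆ T + Z ∧ n = T.encard}) (by
      by_contra hne
      rw [Set.not_nonempty_iff_eq_empty] at hne
      unfold coverNum at h2
      rw [hne, sInf_empty] at h2
      exact absurd h2 (by simp))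
  obtain ⟨T, hT, hTn⟩ := h3
  have h4 : T.encard ≤ N := by rw [← hTn]; exact h2
  have hfin : T.Finite := Set.finite_of_encard_le_coe h4
  have h5 : Cov N W (Z - Z) := by
    refine Cov.of_subset_add hfin ?_ hT subset_rfl
    rw [← hfin.cast_ncard_eq] at h4
    exact_mod_cast h4
  obtain ⟨ι, hι, c, hc, hcY⟩ := h5
  choose p hp hpe using fun x : X => hW x.2
  refine ⟨ι, hι, fun x => c ⟨φ (p x), hp x⟩, hc, fun x y hxy => ?_⟩
  refine hZ ⟨p x - p y, ?_, ?_⟩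
  · have := hcY _ _ hxy
    simpa using this
  · have e1 := hpe x
    have e2 := hpe y
    simp only at e1 e2
    simp [e1, e2]

/-- The group itself, with the inclusion of the generated subgroup, is an admissible choice in the
definition of `coverFlat`. -/
lemma Cov.coverFlat_le {G : Type u} [AddCommGroup G] {B : ℝ} {X Y Y' : Set G} (h : Cov B X Y)
    (hY : Y - Y ⊆ Y') : (coverFlat X Y' : ℝ≥0∞) ≤ ENNReal.ofReal B := by
  obtain ⟨T, hT, hTB, hX⟩ := h.exists_subset_add
  have h1 : coverFlat X Y' ≤ coverNum X Y := by
    refine sInf_le ⟨G, inferInstance, (AddSubgroup.closure X).subtype, X, Y, ?_, ?_, rfl⟩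
    · intro x hx
      exact ⟨⟨x, AddSubgroup.subset_closure hx⟩, hx, rfl⟩
    · rintro _ ⟨x, hx, rfl⟩
      exact hY hx
  have h2 : coverNum X Y ≤ T.encard := sInf_le ⟨T, hX, rfl⟩
  have h3 : coverFlat X Y' ≤ (T.ncard : ℕ∞) := by rw [hT.cast_ncard_eq]; exact h1.trans h2
  calc (coverFlat X Y' : ℝ≥0∞) ≤ ((T.ncard : ℕ∞) : ℝ≥0∞) := by exact_mod_cast h3
    _ = ENNReal.ofReal T.ncard := by simp
    _ ≤ _ := ENNReal.ofReal_le_ofReal hTB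

lemma cov_of_dim_le {G : Type u} [AddCommGroup G] {T : GSystem G} {d : ℝ}
    (h : T.dim ≤ (d : EReal)) (i : ℕ) : Cov (2 ^ d) (T.set i) (T.set (i + 1)) := by
  have h1 : ENNReal.log (coverFlat (T.set i) (T.set (i + 1)) : ℝ≥0∞) /
      ((Real.log 2 : ℝ) : EReal) ≤ d := (le_iSup (fun i : ℕ =>
        ENNReal.log (coverFlat (T.set i) (T.set (i + 1)) : ℝ≥0∞) /
          ((Real.log 2 : ℝ) : EReal)) i).trans h
  have hlog : 0 < Real.log 2 := Real.log_pos (by norm_num)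
  rw [EReal.div_le_iff_le_mul (by exact_mod_cast hlog) (EReal.coe_ne_top _)] at h1
  have h2 : ((Real.log 2 : ℝ) : EReal) * d = ENNReal.log (ENNReal.ofReal (2 ^ d)) := by
    rw [ENNReal.log_ofReal_of_pos (by positivity), Real.log_rpow (by norm_num)]
    rw [← EReal.coe_mul, mul_comm]
  rw [h2, ENNReal.log_le_log_iff] at h1
  have hne : coverFlat (T.set i) (T.set (i + 1)) ≠ ⊤ := by
    intro htop
    rw [htop] at h1
    simp at h1
  obtain ⟨N, hN⟩ := ENat.ne_top_iff_exists.1 hne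
  refine (cov_of_coverFlat (N := N) hN.ge).mono ?_ subset_rfl subset_rfl
  rw [← hN] at h1
  have h3 : ENNReal.ofReal (N : ℝ) ≤ ENNReal.ofReal (2 ^ d) := by simpa using h1
  exact (ENNReal.ofReal_le_ofReal_iff (by positivity)).1 h3

/-! ### Systems -/

lemma thicken_succ {G : Type u} [AddCommGroup G] (X W : Set G) (l : ℕ) :
    thicken X W (l + 1) = thicken X W l + W := rfl

namespace GSystem

variable {G : Type u} [AddCommGroup G]

lemma neg_mem (U : GSystem G) {i : ℕ} {x : G} (hx : x ∈ U.set i) : -x ∈ U.set i := by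
  have : -x ∈ -U.set i := by simpa using hx
  rwa [U.neg_set] at this

lemma add_mem (U : GSystem G) {i : ℕ} {x y : G} (hx : x ∈ U.set (i + 1))
    (hy : y ∈ U.set (i + 1)) : x + y ∈ U.set i := U.add_subset i ⟨x, hx, y, hy, rfl⟩

lemma sub_mem (U : GSystem G) {i : ℕ} {x y : G} (hx : x ∈ U.set (i + 1))
    (hy : y ∈ U.set (i + 1)) : x - y ∈ U.set i := by
  rw [sub_eq_add_neg]; exact U.add_mem hx (U.neg_mem hy)

lemma antitone (U : GSystem G) : Antitone U.set :=
  antitone_nat_of_succ_le fun i x hx => by simpa using U.add_mem hx (U.zero_mem (i + 1))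

lemma two_pow_nsmul_mem (U : GSystem G) {i : ℕ} (s : ℕ) {x : G} (hx : x ∈ U.set (i + s)) :
    2 ^ s • x ∈ U.set i := by
  induction s generalizing i with
  | zero => simpa using hx
  | succ s ih =>
    have h1 : 2 ^ s • x ∈ U.set (i + 1) := ih (by rwa [Nat.add_assoc, Nat.add_comm 1 s])
    rw [pow_succ, mul_smul, two_nsmul, smul_add]
    exact U.add_mem h1 h1

/-- A sum of at most `2 ^ (a + 1)` terms splits into two halves, each in `U.set (n + 1)` by
induction. -/
lemma thicken_zero_subset (U : GSystem G) (a n : ℕ) {l : ℕ} (hl : l ≤ 2 ^ a) :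
    thicken {0} (U.set (n + a)) l ⊆ U.set n := by
  induction a generalizing n l with
  | zero =>
    interval_cases l
    · simpa [thicken] using U.zero_mem n
    · simp [thicken]
  | succ a ih =>
    have hsplit : ∀ l₁ l₂ : ℕ, thicken {0} (U.set (n + (a + 1))) (l₁ + l₂) ⊆
        thicken {0} (U.set (n + (a + 1))) l₁ + thicken {0} (U.set (n + (a + 1))) l₂ := by
      intro l₁ l₂
      induction l₂ with
      | zero => simp [thicken]
      | succ l₂ ih₂ =>
        rw [← Nat.add_assoc l₁, thicken_succ, thicken_succ, ← add_assoc (_ : Set G)]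
        exact Set.add_subset_add_right ih₂
    have e : n + (a + 1) = n + 1 + a := by ring
    have h2 := hsplit (min l (2 ^ a)) (l - min l (2 ^ a))
    rw [Nat.add_sub_cancel' (min_le_left _ _)] at h2
    refine h2.trans ((Set.add_subset_add ?_ ?_).trans (U.add_subset n))
    · rw [e]; exact ih _ (min_le_right _ _)
    · rw [e]
      refine ih _ ?_
      rw [pow_succ] at hl
      omega

lemma _root_.thicken_subset_add (X W : Set G) (l : ℕ) : thicken X W l ⊆ X + thicken {0} W l := by
  induction l with
  | zero => simp [thicken]
  | succ l ih =>
    rw [thicken_succ, thicken_succ, ← add_assoc (_ : Set G)]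
    exact Set.add_subset_add_right ih

lemma thicken_subset (U : GSystem G) {n : ℕ} (a : ℕ) {X : Set G} {l : ℕ} (hl : l ≤ 2 ^ a)
    (hX : X ⊆ U.set (n + 1)) : thicken X (U.set (n + 1 + a)) l ⊆ U.set n :=
  (thicken_subset_add X _ l).trans
    ((Set.add_subset_add hX (U.thicken_zero_subset a (n + 1) hl)).trans (U.add_subset n))

lemma mem_Nbhd (U : GSystem G) {i : ℕ} (h : (U.set i).Finite) : U.set i ∈ Nbhd G :=
  ⟨h, U.neg_set i, U.zero_mem i⟩

lemma finite_of_finite (U : GSystem G) (h : (U.set 0).Finite) (i : ℕ) : (U.set i).Finite :=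
  h.subset (U.antitone (Nat.zero_le i))

/-- Regular sets between consecutive members of a system. -/
lemma exists_tauClosed (U : GSystem G) (hfin : (U.set 0).Finite) {F η : ℝ}
    (hη : 0 < η) (hη1 : η ≤ 1) (n : ℕ) (hcov : Cov (2 ^ F) (U.set n) (U.set (n + 1))) {q : ℕ}
    (hq : 4 * F / η ≤ 2 ^ q) (hq2 : 2 ≤ q) :
    ∃ Z : Finset G, U.set (n + 1) ⊆ Z ∧ (Z : Set G) ⊆ U.set n ∧
      TauClosed η (Z : Set G) (U.set (n + q)) := by
  -- With `q = a + 2`, one index is spent on the inner set `U.set (n + 1)` and one on the factor `2`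
  -- in `2 * L = 2 ^ (a + 1)`. The hypothesis on `q` becomes `F ≤ η * 2 ^ a`.
  obtain ⟨a, rfl⟩ := Nat.exists_eq_add_of_le hq2
  have hf := U.finite_of_finite hfin
  obtain ⟨Z, h1, h2, h3⟩ := exists_tauClosed_thicken (L := 2 ^ a) (F := F) (η := η)
    (X := U.set (n + 1)) (W := U.set (n + 1 + (a + 1))) (Y := U.set n)
    (U.mem_Nbhd (hf _)) (U.mem_Nbhd (hf _)) (hf _)
    (U.thicken_subset (a + 1) (by rw [pow_succ, mul_comm]) subset_rfl) hη hη1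
    (by
      rw [div_le_iff₀ hη, pow_add] at hq
      push_cast
      linarith) (by positivity) (hcov.ncard_le (hf _) (hf _))
  refine ⟨h3.1.1.toFinset, by simpa using h1, by simpa using h2, ?_⟩
  rw [show n + (2 + a) = n + 1 + (a + 1) by ring]
  simpa using h3

/-- The intersection of the dilates `2 ^ t · U`, `t ≤ m`, of a system. -/
def dilInter (m : ℕ) (U : GSystem G) : GSystem G where
  set i := {x | ∀ t ≤ m, x ∈ dilate (2 ^ t) (U.set i)}
  neg_set i := by
    ext x
    have key : ∀ x, (∀ t ≤ m, x ∈ dilate (2 ^ t) (U.set i)) →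
        ∀ t ≤ m, -x ∈ dilate (2 ^ t) (U.set i) := by
      intro x hx t ht
      obtain ⟨y, hy, rfl⟩ := hx t ht
      exact ⟨-y, U.neg_mem hy, by simp⟩
    exact ⟨fun h => by simpa using key _ h, fun h => key x h⟩
  zero_mem i t _ := ⟨0, U.zero_mem i, by simp⟩
  add_subset i := by
    rintro _ ⟨x, hx, y, hy, rfl⟩ t ht
    obtain ⟨a, ha, rfl⟩ := hx t ht
    obtain ⟨b, hb, rfl⟩ := hy t ht
    exact ⟨a + b, U.add_mem ha hb, by simp⟩

lemma mem_dilInter {m : ℕ} {U : GSystem G} {i : ℕ} {x : G} :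
    x ∈ (U.dilInter m).set i ↔ ∀ t ≤ m, ∃ y ∈ U.set i, 2 ^ t • y = x := Iff.rfl

lemma dilInter_subset (m : ℕ) (U : GSystem G) (i : ℕ) : (U.dilInter m).set i ⊆ U.set i := by
  intro x hx
  obtain ⟨y, hy, h⟩ := mem_dilInter.1 hx 0 (Nat.zero_le _)
  simpa [← h] using hy

/-- The intersection of two systems. -/
def inter (U V : GSystem G) : GSystem G where
  set i := U.set i ∩ V.set i
  neg_set i := by rw [Set.inter_neg, U.neg_set, V.neg_set]
  zero_mem i := ⟨U.zero_mem i, V.zero_mem i⟩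
  add_subset i := by
    rintro _ ⟨x, hx, y, hy, rfl⟩
    exact ⟨U.add_mem hx.1 hy.1, V.add_mem hx.2 hy.2⟩

/-- The shift of a system. -/
def shift (n : ℕ) (U : GSystem G) : GSystem G where
  set i := U.set (n + i)
  neg_set _ := U.neg_set _
  zero_mem _ := U.zero_mem _
  add_subset _ := U.add_subset _

/-- The Bohr neighbourhoods of a character. -/
def bohr (γ : AddChar G Circle) (p : ℕ) : GSystem G where
  set i := {x | ‖(γ x : ℂ) - 1‖ ≤ 1 / 2 ^ (p + i)}
  neg_set i := by
    have key : ∀ x, ‖(γ (-x) : ℂ) - 1‖ = ‖(γ x : ℂ) - 1‖ := by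
      intro x
      have h1 : (γ x : ℂ) * γ (-x) = 1 := by
        rw [← Circle.coe_mul, ← AddChar.map_add_eq_mul, add_neg_cancel, AddChar.map_zero_eq_one,
          Circle.coe_one]
      calc ‖(γ (-x) : ℂ) - 1‖ = ‖(γ x : ℂ)‖ * ‖(γ (-x) : ℂ) - 1‖ := by
            rw [Circle.norm_coe, one_mul]
        _ = ‖(γ x : ℂ) - 1‖ := by rw [← norm_mul, mul_sub, h1, mul_one, norm_sub_rev]
    ext x
    simp only [Set.mem_neg, Set.mem_ofPred_eq, key]
  zero_mem i := by simp
  add_subset i := by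
    rintro _ ⟨x, hx, y, hy, rfl⟩
    simp only [Set.mem_ofPred_eq] at hx hy ⊢
    have e : (γ (x + y) : ℂ) - 1 = γ x * ((γ y : ℂ) - 1) + ((γ x : ℂ) - 1) := by
      rw [AddChar.map_add_eq_mul, Circle.coe_mul]; ring
    rw [e]
    refine (norm_add_le _ _).trans ?_
    rw [norm_mul, Circle.norm_coe, one_mul]
    have : (1 : ℝ) / 2 ^ (p + i) = 1 / 2 ^ (p + (i + 1)) + 1 / 2 ^ (p + (i + 1)) := by
      rw [← Nat.add_assoc, pow_succ]; field_simp; norm_num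
    linarith

end GSystem

/-! ### Covering numbers of Bohr neighbourhoods and of intersections of dilates. -/

/-- Colour `x` by the grid cell of side `R / K` containing `γ x - 1`. Each coordinate takes at most
`2 * K + 1` values. -/
lemma cov_character {G : Type u} [AddCommGroup G] (γ : AddChar G Circle) {X : Set G} {R : ℝ}
    (hR : 0 < R) (hX : ∀ x ∈ X, ‖(γ x : ℂ) - 1‖ ≤ R) {K : ℕ} (hK : 0 < K) :
    Cov ((2 * K + 1) ^ 2) X {x | ‖(γ x : ℂ) - 1‖ ≤ 2 * R / K} := by
  have hK' : (0 : ℝ) < K := by exact_mod_cast hK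
  set s : ℝ := R / K with hs
  have hs0 : 0 < s := by positivity
  have hsR : R = K * s := by rw [hs]; field_simp
  have hmem : ∀ u : ℝ, |u| ≤ R → ⌊u / s⌋ ∈ Finset.Icc (-(K : ℤ)) K := by
    intro u hu
    obtain ⟨h1, h2⟩ := abs_le.1 hu
    rw [Finset.mem_Icc]
    constructor
    · rw [Int.le_floor, le_div_iff₀ hs0]; push_cast; linarith
    · have : ⌊u / s⌋ ≤ ⌊(K : ℝ)⌋ := by
        refine Int.floor_le_floor ?_
        rw [div_le_iff₀ hs0]; linarith
      simpa using this
  refine ⟨Finset.Icc (-(K : ℤ)) K × Finset.Icc (-(K : ℤ)) K, inferInstance,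
    fun x => (⟨⌊((γ x : ℂ) - 1).re / s⌋, hmem _ ((Complex.abs_re_le_norm _).trans (hX x x.2))⟩,
      ⟨⌊((γ x : ℂ) - 1).im / s⌋, hmem _ ((Complex.abs_im_le_norm _).trans (hX x x.2))⟩),
    ?_, fun x y hxy => ?_⟩
  · have : (K : ℤ) + 1 - (-(K : ℤ)) = ((2 * K + 1 : ℕ) : ℤ) := by push_cast; ring
    rw [Fintype.card_prod, Fintype.card_coe, Int.card_Icc, this, Int.toNat_natCast]
    push_cast
    rw [pow_two]
  · simp only [Prod.mk.injEq, Subtype.mk.injEq] at hxy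
    have hfl : ∀ u v : ℝ, ⌊u / s⌋ = ⌊v / s⌋ → |u - v| ≤ s := by
      intro u v huv
      have h1 := Int.abs_sub_lt_one_of_floor_eq_floor huv
      rw [← sub_div, abs_div, abs_of_pos hs0, div_lt_one hs0] at h1
      exact h1.le
    have h1 := hfl _ _ hxy.1
    have h2 := hfl _ _ hxy.2
    have h3 : ‖(γ x : ℂ) - γ y‖ ≤ 2 * s := by
      refine (Complex.norm_le_abs_re_add_abs_im _).trans ?_
      simp only [Complex.sub_re, Complex.sub_im, sub_sub_sub_cancel_right] at h1 h2 ⊢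
      linarith
    have h4 : ‖(γ (x - y : G) : ℂ) - 1‖ = ‖(γ x : ℂ) - γ y‖ := by
      have : (γ x : ℂ) = γ (x - y : G) * γ y := by
        rw [← Circle.coe_mul, ← AddChar.map_add_eq_mul, sub_add_cancel]
      rw [this, ← sub_one_mul, norm_mul, Circle.norm_coe, mul_one]
    simp only [Set.mem_ofPred_eq]
    rw [h4, mul_div_assoc]
    exact h3

namespace GSystem

variable {G : Type u} [AddCommGroup G]

/-- Every `x` satisfies `‖γ x - 1‖ ≤ 2`, so `X` may be arbitrary. -/
lemma bohr_cov_zero (γ : AddChar G Circle) (p : ℕ) (X : Set G) :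
    Cov (2 ^ (2 * (p : ℝ) + 8)) X ((bohr γ p).set 0) := by
  have h := cov_character γ (X := X) (R := 2) (by norm_num) (fun x _ => by
    refine (norm_sub_le _ _).trans ?_
    rw [Circle.norm_coe, norm_one]; norm_num) (K := 4 * 2 ^ p) (by positivity)
  refine h.mono ?_ subset_rfl ?_
  · have e : (2 : ℝ) ^ (2 * (p : ℝ) + 8) = (2 ^ p * 16) ^ 2 := by
      rw [show (2 * (p : ℝ) + 8) = ((2 * p + 8 : ℕ) : ℝ) by push_cast; ring, Real.rpow_natCast,
        pow_add, pow_mul']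
      ring
    rw [e]
    have h1 : (1 : ℝ) ≤ 2 ^ p := one_le_pow₀ (by norm_num)
    refine pow_le_pow_left₀ (by positivity) ?_ 2
    push_cast
    linarith
  · intro x hx
    simp only [bohr, Set.mem_ofPred_eq, Nat.add_zero] at hx ⊢
    refine hx.trans (le_of_eq ?_)
    push_cast
    field_simp
    norm_num

lemma bohr_cov_succ (γ : AddChar G Circle) (p i : ℕ) :
    Cov (2 ^ (7 : ℝ)) ((bohr γ p).set i) ((bohr γ p).set (i + 1)) := by
  have h := cov_character γ (X := (bohr γ p).set i) (R := 1 / 2 ^ (p + i)) (by positivity)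
    (fun x hx => hx) (K := 4) (by norm_num)
  refine h.mono (by norm_num) subset_rfl ?_
  intro x hx
  simp only [bohr, Set.mem_ofPred_eq] at hx ⊢
  refine hx.trans (le_of_eq ?_)
  rw [← Nat.add_assoc, pow_succ]
  push_cast
  field_simp
  norm_num

lemma cov_add (U : GSystem G) {F : ℝ} (h : ∀ i, Cov (2 ^ F) (U.set i) (U.set (i + 1))) (i n : ℕ)
    (hn : 1 ≤ n) : Cov (2 ^ (n * F)) (U.set i) (U.set (i + n)) := by
  induction n, hn using Nat.le_induction with
  | base => simpa using h i
  | succ n hn ih =>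
    refine (ih.trans (h (i + n))).mono (le_of_eq ?_) subset_rfl subset_rfl
    rw [← Real.rpow_add (by norm_num)]
    congr 1
    push_cast
    ring

lemma dilInter_cov (m : ℕ) (U V : GSystem G) {F : ℝ} {i j : ℕ}
    (h : Cov (2 ^ F) (U.set i) (V.set j)) :
    Cov (2 ^ (F * (m + 1))) ((U.dilInter m).set i) ((V.dilInter m).set j) := by
  have := Cov.forall_le (m := m) (X := (U.dilInter m).set i)
    (Y := fun t => dilate (2 ^ t) (V.set j)) (B := 2 ^ F) (fun t ht =>
      (h.dilate (2 ^ t)).mono le_rfl (fun x hx => hx t ht) subset_rfl)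
  refine this.mono (le_of_eq ?_) subset_rfl subset_rfl
  rw [Real.rpow_mul (by norm_num)]
  exact_mod_cast (Real.rpow_natCast ((2 : ℝ) ^ F) (m + 1)).symm

end GSystem

lemma two_pow_nsmul_injective {G : Type u} [AddCommGroup G] (h2 : ∀ x : G, 2 • x = 0 → x = 0)
    (s : ℕ) : Function.Injective (fun x : G => 2 ^ s • x) := by
  have key : ∀ s : ℕ, ∀ x : G, 2 ^ s • x = 0 → x = 0 := by
    intro s
    induction s with
    | zero => intro x hx; simpa using hx
    | succ s ih =>
      intro x hx
      rw [pow_succ, mul_smul] at hx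
      exact h2 x (ih _ hx)
  intro x y hxy
  rw [← sub_eq_zero]
  refine key s _ ?_
  rw [smul_sub, sub_eq_zero]
  exact hxy

/-! ### Iterated dilates, refinement of systems and control of their covering numbers. -/

namespace GSystem

variable {G : Type u} [AddCommGroup G]

/-- Division by `2 ^ t` is unique when there is no `2`-torsion, so a preimage under `2 ^ (t + s)` is
one under `2 ^ s` of the preimage under `2 ^ t`. -/
lemma dilInter_dilInter (h2 : ∀ x : G, 2 • x = 0 → x = 0) (m r : ℕ) (U : GSystem G) (i : ℕ) :
    ((U.dilInter r).dilInter m).set i = (U.dilInter (m + r)).set i := by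
  ext x
  simp only [mem_dilInter]
  constructor
  · intro h t ht
    obtain ⟨y, hy, rfl⟩ := h (min t m) (min_le_right _ _)
    obtain ⟨z, hz, rfl⟩ := hy (t - min t m) (by omega)
    refine ⟨z, hz, ?_⟩
    rw [smul_smul, ← pow_add]
    congr 2
    omega
  · intro h t ht
    obtain ⟨y, -, rfl⟩ := h t (by omega)
    refine ⟨y, fun s hs => ?_, rfl⟩
    obtain ⟨z, hz, hzy⟩ := h (t + s) (by omega)
    refine ⟨z, hz, two_pow_nsmul_injective h2 t ?_⟩
    simp only
    rw [smul_smul, ← pow_add, hzy]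

lemma dilInter_inter (h2 : ∀ x : G, 2 • x = 0 → x = 0) (m : ℕ) (U V : GSystem G) (i : ℕ) :
    ((U.inter V).dilInter m).set i = (U.dilInter m).set i ∩ (V.dilInter m).set i := by
  ext x
  simp only [mem_dilInter, Set.mem_inter_iff]
  constructor
  · intro h
    refine ⟨fun t ht => ?_, fun t ht => ?_⟩
    · obtain ⟨y, hy, rfl⟩ := h t ht
      exact ⟨y, hy.1, rfl⟩
    · obtain ⟨y, hy, rfl⟩ := h t ht
      exact ⟨y, hy.2, rfl⟩
  · rintro ⟨hU, hV⟩ t ht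
    obtain ⟨y, hy, rfl⟩ := hU t ht
    obtain ⟨z, hz, hzy⟩ := hV t ht
    have : z = y := two_pow_nsmul_injective h2 t hzy
    exact ⟨y, ⟨hy, this ▸ hz⟩, rfl⟩

/-- The system obtained from `U` by taking dilates, shifting by `n` and intersecting with the Bohr
neighbourhoods of a character. -/
def refine (r n p : ℕ) (γ : AddChar G Circle) (U : GSystem G) : GSystem G :=
  ((U.dilInter r).shift n).inter (bohr γ p)

/-- Control on the covering numbers of all the systems `dilInter m' U`, `m' ≤ m`. -/
def Ctrl (T : Set G) (m : ℕ) (F h : ℝ) (U : GSystem G) : Prop :=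
  ∀ m' ≤ m, (∀ i, Cov (2 ^ F) ((U.dilInter m').set i) ((U.dilInter m').set (i + 1))) ∧
    Cov (2 ^ h) T ((U.dilInter m').set 0)

/-- A refinement uses up `r` of the available dilates. The dimension exponent pays `7` per remaining
dilate for the Bohr system. The cover of `T` pays for `n` steps down `U` and, per dilate, for
splitting into differences in a Bohr neighbourhood of radius `2 ^ (-p)`. -/
lemma Ctrl.refine (h2 : ∀ x : G, 2 • x = 0 → x = 0) {T : Set G} {m r : ℕ} {F h : ℝ}
    {U : GSystem G} (hU : Ctrl T (m + r) F h U) {n : ℕ} (hn : 1 ≤ n) (p : ℕ)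
    (γ : AddChar G Circle) :
    Ctrl T m (F + 7 * (m + 1)) (h + n * F + (2 * p + 8) * (m + 1)) (U.refine r n p γ) := by
  intro m' hm'
  have hm : (m' : ℝ) ≤ m := by exact_mod_cast hm'
  obtain ⟨h1, h3⟩ := hU (m' + r) (by omega)
  have e : ∀ i, ((U.refine r n p γ).dilInter m').set i =
      (U.dilInter (m' + r)).set (n + i) ∩ ((bohr γ p).dilInter m').set i := by
    intro i
    unfold GSystem.refine
    rw [dilInter_inter h2, ← dilInter_dilInter h2]
    rfl
  constructor
  · intro i
    rw [e, e]
    have b := dilInter_cov m' _ _ (bohr_cov_succ γ p i)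
    refine ((((h1 (n + i)).mono le_rfl Set.inter_subset_left subset_rfl).inter
      (b.mono le_rfl Set.inter_subset_right subset_rfl))).mono ?_ subset_rfl subset_rfl
    rw [← Real.rpow_add (by norm_num)]
    refine Real.rpow_le_rpow_of_exponent_le (by norm_num) ?_
    linarith
  · rw [e]
    have c := (U.dilInter (m' + r)).cov_add h1 0 n hn
    rw [Nat.zero_add] at c
    have b := dilInter_cov m' U (bohr γ p) (i := 0) (bohr_cov_zero γ p (U.set 0))
    have hsub : (U.dilInter (m' + r)).set 0 ⊆ (U.dilInter m').set 0 :=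
      fun x hx t ht => hx t (by omega)
    refine (h3.trans (c.inter (b.mono le_rfl hsub subset_rfl))).mono ?_ subset_rfl subset_rfl
    rw [← Real.rpow_add (by norm_num), ← Real.rpow_add (by norm_num)]
    refine Real.rpow_le_rpow_of_exponent_le (by norm_num) ?_
    have : (2 * (p : ℝ) + 8) * (m' + 1) ≤ (2 * p + 8) * (m + 1) :=
      mul_le_mul_of_nonneg_left (by linarith) (by positivity)
    linarith

lemma Ctrl.mono {T : Set G} {m m' : ℕ} {F F' h h' : ℝ} {U : GSystem G} (hU : Ctrl T m F h U)
    (hm : m' ≤ m) (hF : F ≤ F') (hh : h ≤ h') : Ctrl T m' F' h' U := fun t ht =>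
  ⟨fun i => ((hU t (ht.trans hm)).1 i).mono
      (Real.rpow_le_rpow_of_exponent_le (by norm_num) hF) subset_rfl subset_rfl,
    (hU t (ht.trans hm)).2.mono
      (Real.rpow_le_rpow_of_exponent_le (by norm_num) hh) subset_rfl subset_rfl⟩

/-- The initial system is controlled. -/
lemma ctrl_shift (h2 : ∀ x : G, 2 • x = 0 → x = 0) (T : GSystem G) (hfin : (T.set 0).Finite)
    {d : ℝ} (hd : 0 ≤ d) (hT : ∀ i, Cov (2 ^ d) (T.set i) (T.set (i + 1))) (M : ℕ) :
    Ctrl (T.set 0) M (d * (M + 1)) (d + (M + 2) * d * (M + 1)) (T.shift M) := by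
  intro m hm
  have hm' : (m : ℝ) ≤ M := by exact_mod_cast hm
  have hf := T.finite_of_finite hfin
  constructor
  · intro i
    refine (dilInter_cov m (T.shift M) (T.shift M) (hT (M + i))).mono ?_ subset_rfl subset_rfl
    exact Real.rpow_le_rpow_of_exponent_le (by norm_num)
      (mul_le_mul_of_nonneg_left (by linarith) hd)
  -- Ruzsa's covering lemma returns differences of differences of the dilate of `T.set (M + 2)`,
  -- which must fall in the dilate of `T.set M`; hence the two extra indices. Dilation is injective,
  -- so the size of the dilate is that of `T.set (M + 2)`.
  · have hcard := (T.cov_add hT 0 (M + 2) (by omega)).ncard_le (hf _) (hf _)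
    rw [Nat.zero_add] at hcard
    have key : ∀ t ≤ m, Cov (2 ^ (((M + 2 : ℕ) : ℝ) * d)) (T.set 1)
        (dilate (2 ^ t) (T.set (M + 0))) := by
      intro t ht
      have hinj := two_pow_nsmul_injective h2 t
      have hYf : (dilate (2 ^ t) (T.set (M + 2))).Finite := (hf _).image _
      have hYc : (dilate (2 ^ t) (T.set (M + 2))).ncard = (T.set (M + 2)).ncard :=
        Set.ncard_image_of_injective _ hinj
      have hsub : T.set 1 + dilate (2 ^ t) (T.set (M + 2)) ⊆ T.set 0 := by
        rintro _ ⟨x, hx, _, ⟨y, hy, rfl⟩, rfl⟩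
        refine T.add_mem hx (T.two_pow_nsmul_mem t ?_)
        exact T.antitone (by omega) hy
      have hr := Cov.of_ncard_add_le (B := 2 ^ (((M + 2 : ℕ) : ℝ) * d)) (hf 1) hYf
        ⟨0, 0, T.zero_mem _, by simp⟩ (by
          rw [hYc]
          refine le_trans ?_ hcard
          exact_mod_cast Set.ncard_le_ncard hsub (hf 0))
      refine hr.mono le_rfl subset_rfl ?_
      rintro _ ⟨_, ⟨_, ⟨a, ha, rfl⟩, _, ⟨b, hb, rfl⟩, rfl⟩, _,
        ⟨_, ⟨a', ha', rfl⟩, _, ⟨b', hb', rfl⟩, rfl⟩, rfl⟩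
      exact ⟨(a - b) - (a' - b'), T.sub_mem (T.sub_mem ha hb) (T.sub_mem ha' hb'),
        by simp [smul_sub]⟩
    have h3 := Cov.forall_le key
    refine ((hT 0).trans h3).mono ?_ subset_rfl subset_rfl
    rw [← Real.rpow_natCast, ← Real.rpow_mul (by norm_num), ← Real.rpow_add (by norm_num)]
    refine Real.rpow_le_rpow_of_exponent_le (by norm_num) ?_
    push_cast
    have : (0 : ℝ) ≤ (M + 2) * d := by positivity
    nlinarith

end GSystem

/-! ### Averages -/

section Averages

variable {κ : Type*} {s : Finset κ}

lemma abs_expect_sub_expect_le (hs : s.Nonempty) {φ ψ : κ → ℝ} {ε : ℝ}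
    (h : ∀ i ∈ s, |φ i - ψ i| ≤ ε) : |(𝔼 i ∈ s, φ i) - 𝔼 i ∈ s, ψ i| ≤ ε := by
  rw [← Finset.expect_sub_distrib]
  exact (Finset.abs_expect_le _ _).trans (Finset.expect_le hs h)

lemma sq_expect_le (hs : s.Nonempty) (φ : κ → ℝ) :
    (𝔼 i ∈ s, φ i) ^ 2 ≤ 𝔼 i ∈ s, φ i ^ 2 := by
  have h1 := Finset.expect_mul_sq_le_sq_mul_sq s φ (fun _ => (1 : ℝ))
  have h2 : 𝔼 v ∈ s, (1 : ℝ) ^ 2 = 1 := by rw [Finset.expect_const hs, one_pow]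
  rw [h2] at h1
  simpa only [mul_one] using h1

lemma expect_mem_Icc (hs : s.Nonempty) {φ : κ → ℝ} (h0 : ∀ i ∈ s, 0 ≤ φ i)
    (h1 : ∀ i ∈ s, φ i ≤ 1) : 0 ≤ 𝔼 i ∈ s, φ i ∧ 𝔼 i ∈ s, φ i ≤ 1 :=
  ⟨Finset.expect_nonneg h0, Finset.expect_le hs h1⟩

lemma expect_sub_sq (hs : s.Nonempty) (φ : κ → ℝ) (c : ℝ) :
    𝔼 i ∈ s, (φ i - c) ^ 2 = (𝔼 i ∈ s, φ i ^ 2) - 2 * c * (𝔼 i ∈ s, φ i) + c ^ 2 := by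
  simp_rw [sub_sq]
  rw [Finset.expect_add_distrib, Finset.expect_sub_distrib, Finset.expect_const hs,
    Finset.mul_expect]
  congr 2
  exact Finset.expect_congr rfl fun i _ => by ring

lemma abs_expect_le_one (hs : s.Nonempty) {φ : κ → ℝ} (h : ∀ i ∈ s, |φ i| ≤ 1) :
    |𝔼 i ∈ s, φ i| ≤ 1 :=
  (Finset.abs_expect_le _ _).trans (Finset.expect_le hs h)

lemma abs_sq_sub_sq_le {x y : ℝ} (hx : |x| ≤ 1) (hy : |y| ≤ 1) :
    |x ^ 2 - y ^ 2| ≤ 2 * |x - y| := by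
  rw [sq_sub_sq, abs_mul]
  refine mul_le_mul_of_nonneg_right ?_ (abs_nonneg _)
  exact (abs_add_le _ _).trans (by linarith)

end Averages

/-! ### Averages over a closed pair -/

lemma TauClosed.expect_indicator_le {G : Type u} [AddCommGroup G] [DecidableEq G] {η : ℝ}
    {W : Finset G} {V : Set G} (h : TauClosed η (W : Set G) V) (hη : 0 ≤ η) {v : G} (hv : v ∈ V) :
    𝔼 t ∈ W, (if t + v ∈ W then (0 : ℝ) else 1) ≤ η := by
  have h1 := h.abs_expect_sub_le hη hv (f := fun x => if x ∈ W then (0 : ℝ) else 1) (fun x => by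
    split_ifs <;> simp)
  have h2 : 𝔼 t ∈ W, (if t ∈ W then (0 : ℝ) else 1) = 0 :=
    Finset.expect_eq_zero fun t ht => by simp [ht]
  rw [h2, sub_zero] at h1
  exact (le_abs_self _).trans h1

lemma TauClosed.expect_indicator_sub_le {G : Type u} [AddCommGroup G] [DecidableEq G] {η : ℝ}
    {W : Finset G} {V : Set G} (h : TauClosed η (W : Set G) V) (hη : 0 ≤ η) {v : G} (hv : v ∈ V) :
    𝔼 t ∈ W, (if t - v ∈ W then (0 : ℝ) else 1) ≤ η := by
  simp_rw [sub_eq_add_neg]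
  exact h.expect_indicator_le hη (Nbhd.neg_mem h.2.1 hv)

/-- The density of `a` on the dilate `2 ^ s · (z + Z)`. -/
noncomputable def dilDens {G : Type u} [AddCommGroup G] (a : G → ℝ) (s : ℕ) (z : G)
    (Z : Finset G) : ℝ := 𝔼 w ∈ Z, a (2 ^ s • (z + w))

/-- The first-order uniformity defect. -/
noncomputable def defectOne {G : Type u} [AddCommGroup G] (a : G → ℝ) (s : ℕ) (z : G)
    (Z W : Finset G) : ℝ :=
  𝔼 w ∈ Z, ((𝔼 v ∈ W, a (2 ^ s • (z + w) + v)) - dilDens a s z Z) ^ 2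

open scoped Classical in
/-- The second-order uniformity defect. -/
noncomputable def defectTwo {G : Type u} [AddCommGroup G] (a : G → ℝ) (s : ℕ) (z : G)
    (Z W V : Finset G) : ℝ :=
  𝔼 w ∈ Z, 𝔼 t ∈ W, ((𝔼 v ∈ V, if t - v ∈ W then
    a (2 ^ s • (z + w) + t - v) * a (2 ^ s • (z + w) + v) else 0) - dilDens a s z Z ^ 2) ^ 2

/-- The local second-order correlation of `g` about `x`. -/
noncomputable def localCorr {G : Type u} [AddCommGroup G] (g : G → ℝ) (W V : Finset G) (x : G) :
    ℝ := 𝔼 t ∈ W, (𝔼 v ∈ V, g (x + t - v) * g (x + v)) ^ 2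

/-! ### Trivial bounds for the defects, and reduction of the second-order defect to local
correlations. -/

section Defects

variable {G : Type u} [AddCommGroup G] {a : G → ℝ} {s : ℕ} {z : G} {Z W V : Finset G} {U : Set G}
  {η : ℝ}

lemma abs_expect_dilate_add_sub_le (hZ : TauClosed η (Z : Set G) U) (hη : 0 ≤ η) {u : G}
    (hu : u ∈ U) {f : G → ℝ} (hf : ∀ x, |f x| ≤ 1) :
    |(𝔼 w ∈ Z, f (2 ^ s • (z + w) + 2 ^ s • u)) - 𝔼 w ∈ Z, f (2 ^ s • (z + w))| ≤ η := by
  have := hZ.abs_expect_sub_le hη hu (f := fun w => f (2 ^ s • (z + w))) (fun x => hf _)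
  simpa only [← smul_add, add_assoc] using this

/-- A shift of `2 ^ s • (z + w)` by `v = 2 ^ s • u` is a shift of `w` by `u`, which `Z` absorbs.
This is why the chain is built from intersections of dilates. -/
lemma abs_expect_dilate_sub_le (hZ : TauClosed η (Z : Set G) U) (hη : 0 ≤ η)
    (hW : W.Nonempty) (hWU : ∀ v ∈ W, ∃ u ∈ U, 2 ^ s • u = v) {f : G → ℝ} (hf : ∀ x, |f x| ≤ 1) :
    |(𝔼 w ∈ Z, 𝔼 v ∈ W, f (2 ^ s • (z + w) + v)) - 𝔼 w ∈ Z, f (2 ^ s • (z + w))| ≤ η := by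
  rw [Finset.expect_comm, ← Finset.expect_const hW (𝔼 w ∈ Z, f (2 ^ s • (z + w)))]
  refine abs_expect_sub_expect_le hW fun v hv => ?_
  obtain ⟨u, hu, rfl⟩ := hWU v hv
  exact abs_expect_dilate_add_sub_le hZ hη hu hf

lemma dilDens_mem_Icc (hZ : Z.Nonempty) (ha0 : ∀ x, 0 ≤ a x) (ha1 : ∀ x, a x ≤ 1) :
    0 ≤ dilDens a s z Z ∧ dilDens a s z Z ≤ 1 :=
  expect_mem_Icc hZ (fun _ _ => ha0 _) (fun _ _ => ha1 _)

lemma abs_le_one_of_mem_Icc {G : Type*} {a : G → ℝ} (ha0 : ∀ x, 0 ≤ a x) (ha1 : ∀ x, a x ≤ 1) (x : G) : |a x| ≤ 1 :=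
  abs_le.2 ⟨by linarith [ha0 x], ha1 x⟩

/-- A `[0, 1]`-valued average with mean within `η` of `α` has second moment about `α` at most `α - α
^ 2 + O(η)`, well below `1 / 2`. -/
lemma defectOne_le_half (ha0 : ∀ x, 0 ≤ a x) (ha1 : ∀ x, a x ≤ 1)
    (hZ : TauClosed η (Z : Set G) U) (hη : 0 ≤ η) (hη1 : η ≤ 1 / 100) (hW : W.Nonempty)
    (hWU : ∀ v ∈ W, ∃ u ∈ U, 2 ^ s • u = v) : defectOne a s z Z W ≤ 1 / 2 := by
  obtain ⟨h0, h1⟩ := dilDens_mem_Icc (s := s) (z := z) hZ.nonempty ha0 ha1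
  unfold defectOne
  rw [expect_sub_sq hZ.nonempty]
  have h2 := abs_expect_dilate_sub_le (z := z) hZ hη hW hWU (abs_le_one_of_mem_Icc ha0 ha1)
  change |_ - dilDens a s z Z| ≤ η at h2
  have h3 : 𝔼 w ∈ Z, (𝔼 v ∈ W, a (2 ^ s • (z + w) + v)) ^ 2 ≤
      𝔼 w ∈ Z, 𝔼 v ∈ W, a (2 ^ s • (z + w) + v) := by
    refine Finset.expect_le_expect fun w _ => ?_
    obtain ⟨h4, h5⟩ := expect_mem_Icc hW (φ := fun v => a (2 ^ s • (z + w) + v))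
      (fun _ _ => ha0 _) (fun _ _ => ha1 _)
    nlinarith
  set α := dilDens a s z Z
  set p := 𝔼 w ∈ Z, 𝔼 v ∈ W, a (2 ^ s • (z + w) + v)
  obtain ⟨h6, h7⟩ := abs_le.1 h2
  nlinarith [sq_nonneg (α - 1 / 2)]

/-- The expression is linear in `p`, so only an endpoint matters, chosen by the sign of `1 - 2 * α ^
2`. The error `ε` costs `1 / 20` and the remaining polynomial in `α` is at most `9 / 20`. -/
lemma real_quartic_bound {α p ε : ℝ} (h0 : 0 ≤ α) (h1 : α ≤ 1) (hε : ε ≤ 1 / 20)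
    (hp1 : 2 * α - 1 - ε ≤ p) (hp2 : p ≤ α + ε) (hε0 : 0 ≤ ε) :
    p * (1 - 2 * α ^ 2) + α ^ 4 ≤ 1 / 2 := by
  by_cases h : 2 * α ^ 2 ≤ 1
  · have e1 : p * (1 - 2 * α ^ 2) ≤ (α + ε) * (1 - 2 * α ^ 2) :=
      mul_le_mul_of_nonneg_right hp2 (by linarith)
    have e2 : ε * (1 - 2 * α ^ 2) ≤ 1 / 20 := by nlinarith [sq_nonneg α]
    have e3 : α * (1 - 2 * α ^ 2) + α ^ 4 ≤ 9 / 20 := by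
      nlinarith [sq_nonneg (α ^ 2 - α), sq_nonneg (α - 1 / 2), sq_nonneg (α ^ 2 - 1 / 4),
        mul_nonneg h0 (sq_nonneg (α - 1 / 2))]
    nlinarith
  · push Not at h
    have h7 : 7 / 10 ≤ α := by nlinarith
    have e1 : p * (1 - 2 * α ^ 2) ≤ (2 * α - 1 - ε) * (1 - 2 * α ^ 2) := by nlinarith
    have e2 : -ε * (1 - 2 * α ^ 2) ≤ 1 / 20 := by nlinarith
    have e3 : (2 * α - 1) * (1 - 2 * α ^ 2) + α ^ 4 ≤ 9 / 20 := by
      have : 0 ≤ (1 - α) * (α - 7 / 10) := mul_nonneg (by linarith) (by linarith)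
      nlinarith [sq_nonneg (α ^ 2 - α), mul_nonneg this h0, mul_nonneg this (sq_nonneg α)]
    nlinarith

/-- Since the correlations `f` lie in `[0, 1]`, `f ^ 2 ≤ f` makes the bound linear in their mean.
That mean is at most about `α`, and at least about `2 * α - 1` because `x * y ≥ x + y - 1` on the
unit square. -/
lemma defectTwo_le_half (ha0 : ∀ x, 0 ≤ a x) (ha1 : ∀ x, a x ≤ 1)
    (hZ : TauClosed η (Z : Set G) U) (hη : 0 ≤ η) (hη1 : η ≤ 1 / 100)
    (hWV : TauClosed η (W : Set G) V) (hVn : V.Nonempty)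
    (hWU : ∀ v ∈ W, ∃ u ∈ U, 2 ^ s • u = v) (hVU : ∀ v ∈ V, ∃ u ∈ U, 2 ^ s • u = v) :
    defectTwo a s z Z W V ≤ 1 / 2 := by
  classical
  have hW := hWV.nonempty
  have ha := abs_le_one_of_mem_Icc ha0 ha1
  obtain ⟨h0, h1⟩ := dilDens_mem_Icc (s := s) (z := z) hZ.nonempty ha0 ha1
  set α := dilDens a s z Z with hα
  set f : G → G → ℝ := fun w t => 𝔼 v ∈ V, if t - v ∈ W then
    a (2 ^ s • (z + w) + t - v) * a (2 ^ s • (z + w) + v) else 0 with hf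
  have hfI : ∀ w t, 0 ≤ f w t ∧ f w t ≤ 1 := fun w t => expect_mem_Icc hVn
    (fun v _ => by split_ifs; exacts [mul_nonneg (ha0 _) (ha0 _), le_rfl])
    (fun v _ => by split_ifs; exacts [mul_le_one₀ (ha1 _) (ha0 _) (ha1 _), zero_le_one])
  have hstep : defectTwo a s z Z W V ≤
      (𝔼 w ∈ Z, 𝔼 t ∈ W, f w t) * (1 - 2 * α ^ 2) + α ^ 4 := by
    have : defectTwo a s z Z W V ≤ 𝔼 w ∈ Z, 𝔼 t ∈ W, (f w t * (1 - 2 * α ^ 2) + α ^ 4) := by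
      refine Finset.expect_le_expect fun w _ => Finset.expect_le_expect fun t _ => ?_
      obtain ⟨h2, h3⟩ := hfI w t
      have : (f w t - α ^ 2) ^ 2 ≤ f w t * (1 - 2 * α ^ 2) + α ^ 4 := by nlinarith
      convert this
    refine this.trans (le_of_eq ?_)
    simp_rw [Finset.expect_add_distrib, ← Finset.expect_mul, Finset.expect_const hW,
      Finset.expect_const hZ.nonempty]
  refine hstep.trans (real_quartic_bound (ε := 4 * η) h0 h1 (by linarith) ?_ ?_ (by linarith))
  · have hpt : ∀ w t, ∀ v, (1 - if t - v ∈ W then (0 : ℝ) else 1) + a (2 ^ s • (z + w) + t - v) +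
        a (2 ^ s • (z + w) + v) - 2 ≤ if t - v ∈ W then
          a (2 ^ s • (z + w) + t - v) * a (2 ^ s • (z + w) + v) else 0 := by
      intro w t v
      have := ha1 (2 ^ s • (z + w) + t - v)
      have := ha1 (2 ^ s • (z + w) + v)
      split_ifs <;> nlinarith
    have hlow : 𝔼 v ∈ V, 𝔼 t ∈ W, 𝔼 w ∈ Z, ((1 - if t - v ∈ W then (0 : ℝ) else 1) +
        a (2 ^ s • (z + w) + t - v) + a (2 ^ s • (z + w) + v) - 2) ≤
        𝔼 w ∈ Z, 𝔼 t ∈ W, f w t := by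
      rw [Finset.expect_comm]
      rw [Finset.expect_congr rfl fun t _ => Finset.expect_comm _ _ _]
      rw [Finset.expect_comm]
      exact Finset.expect_le_expect fun w _ => Finset.expect_le_expect fun t _ =>
        Finset.expect_le_expect fun v _ => hpt w t v
    refine le_trans ?_ hlow
    refine Finset.le_expect hVn fun v hv => ?_
    obtain ⟨u, hu, hv'⟩ := hVU v hv
    have b1 := hWV.expect_indicator_sub_le hη hv
    have b3 := abs_expect_dilate_add_sub_le (s := s) (z := z) hZ hη hu ha
    change |_ - dilDens a s z Z| ≤ η at b3
    rw [← hα, hv'] at b3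
    have b2 : ∀ t ∈ W, α - 2 * η ≤ 𝔼 w ∈ Z, a (2 ^ s • (z + w) + t - v) := by
      intro t ht
      obtain ⟨u', hu', rfl⟩ := hWU t ht
      have c1 := abs_expect_dilate_add_sub_le (s := s) (z := z) hZ hη
        (Nbhd.neg_mem hZ.2.1 hu) (f := fun x => a (x + 2 ^ s • u')) (fun x => ha _)
      have c2 := abs_expect_dilate_add_sub_le (s := s) (z := z) hZ hη hu' ha
      change |_ - dilDens a s z Z| ≤ η at c2
      rw [← hα] at c2
      have e : ∀ w, 2 ^ s • (z + w) + 2 ^ s • -u + 2 ^ s • u' =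
          2 ^ s • (z + w) + 2 ^ s • u' - v := by
        intro w; rw [← hv', smul_neg]; abel
      simp_rw [e] at c1
      linarith [(abs_le.1 c1).1, (abs_le.1 c2).1]
    have e1 : 𝔼 t ∈ W, 𝔼 w ∈ Z, ((1 - if t - v ∈ W then (0 : ℝ) else 1) +
        a (2 ^ s • (z + w) + t - v) + a (2 ^ s • (z + w) + v) - 2) =
        (1 - 𝔼 t ∈ W, if t - v ∈ W then (0 : ℝ) else 1) +
        (𝔼 t ∈ W, 𝔼 w ∈ Z, a (2 ^ s • (z + w) + t - v)) +
        (𝔼 w ∈ Z, a (2 ^ s • (z + w) + v)) - 2 := by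
      simp_rw [Finset.expect_sub_distrib, Finset.expect_add_distrib, Finset.expect_sub_distrib,
        Finset.expect_const hZ.nonempty, Finset.expect_const hW]
    rw [e1]
    have b4 : α - 2 * η ≤ 𝔼 t ∈ W, 𝔼 w ∈ Z, a (2 ^ s • (z + w) + t - v) :=
      Finset.le_expect hW b2
    linarith [(abs_le.1 b3).1]
  · have b := abs_expect_dilate_sub_le (s := s) (z := z) hZ hη hVn hVU ha
    change |_ - dilDens a s z Z| ≤ η at b
    rw [← hα] at b
    have : 𝔼 w ∈ Z, 𝔼 t ∈ W, f w t ≤ 𝔼 w ∈ Z, 𝔼 v ∈ V, a (2 ^ s • (z + w) + v) := by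
      refine Finset.expect_le_expect fun w _ => Finset.expect_le hW fun t _ =>
        Finset.expect_le_expect fun v _ => ?_
      split_ifs
      · exact mul_le_of_le_one_left (ha0 _) (ha1 _)
      · exact ha0 _
    linarith [(abs_le.1 b).2]

/-- Writing `a = α + g`, the correlation of `a` is that of `g` plus `α` times averages of `a` over
translates of `V`, which the first-order defect controls. The condition `t - v ∈ W` costs `η` on
average, and the factor `4` is Cauchy–Schwarz for four terms. -/
lemma defectTwo_le (ha0 : ∀ x, 0 ≤ a x) (ha1 : ∀ x, a x ≤ 1)
    (hZ : TauClosed η (Z : Set G) U) (hη : 0 ≤ η)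
    (hWV : TauClosed η (W : Set G) V) (hV : (V : Set G) ∈ Nbhd G)
    (hWU : ∀ v ∈ W, ∃ u ∈ U, 2 ^ s • u = v) :
    defectTwo a s z Z W V ≤ 4 * (2 * η + 2 * defectOne a s z Z V +
      𝔼 w ∈ Z, localCorr (fun x => a x - dilDens a s z Z) W V (2 ^ s • (z + w))) := by
  classical
  have hW := hWV.nonempty
  have hVn : V.Nonempty := ⟨0, hV.2.2⟩
  have ha := abs_le_one_of_mem_Icc ha0 ha1
  obtain ⟨h0, h1⟩ := dilDens_mem_Icc (s := s) (z := z) hZ.nonempty ha0 ha1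
  set α := dilDens a s z Z with hα
  set D : G → ℝ := fun x => 𝔼 v ∈ V, a (x + v) with hD
  have hDI : ∀ x, 0 ≤ D x ∧ D x ≤ 1 := fun x =>
    expect_mem_Icc hVn (fun _ _ => ha0 _) (fun _ _ => ha1 _)
  set e : G → ℝ := fun t => 𝔼 v ∈ V, if t - v ∈ W then (0 : ℝ) else 1 with he
  have hsym : ∀ x, 𝔼 v ∈ V, a (x - v) = D x := fun x =>
    Finset.expect_nbij' (fun v => -v) (fun v => -v) (fun v hv => Nbhd.neg_mem hV hv)
      (fun v hv => Nbhd.neg_mem hV hv) (by simp) (by simp) (by simp [sub_eq_add_neg])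
  have heI : ∀ t, 0 ≤ e t ∧ e t ≤ 1 := fun t => expect_mem_Icc hVn
    (fun v _ => by split_ifs <;> norm_num) (fun v _ => by split_ifs <;> norm_num)
  have heW : 𝔼 t ∈ W, e t ≤ η := by
    rw [he, Finset.expect_comm]
    exact Finset.expect_le hVn fun v hv => hWV.expect_indicator_sub_le hη hv
  have hpt : ∀ x t, ((𝔼 v ∈ V, if t - v ∈ W then a (x + t - v) * a (x + v) else 0) - α ^ 2) ^ 2 ≤
      4 * (e t + (D (x + t) - α) ^ 2 + (D x - α) ^ 2 +
        (𝔼 v ∈ V, (a (x + t - v) - α) * (a (x + v) - α)) ^ 2) := by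
    intro x t
    set c := 𝔼 v ∈ V, (a (x + t - v) - α) * (a (x + v) - α) with hc
    set f := 𝔼 v ∈ V, if t - v ∈ W then a (x + t - v) * a (x + v) else 0 with hf
    set f' := 𝔼 v ∈ V, a (x + t - v) * a (x + v) with hf'
    have d1 : f' = c + α * D (x + t) + α * D x - α ^ 2 := by
      rw [hf', hc, ← hsym (x + t), show D x = 𝔼 v ∈ V, a (x + v) from rfl, Finset.mul_expect, Finset.mul_expect, ← Finset.expect_add_distrib,
        ← Finset.expect_add_distrib, ← Finset.expect_const hVn (α ^ 2),
        ← Finset.expect_sub_distrib]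
      exact Finset.expect_congr rfl fun v _ => by ring
    have d2 : f ≤ f' := Finset.expect_le_expect fun v _ => by
      split_ifs
      · exact le_rfl
      · exact mul_nonneg (ha0 _) (ha0 _)
    have d3 : f' - f ≤ e t := by
      rw [hf, hf', ← Finset.expect_sub_distrib]
      refine Finset.expect_le_expect fun v _ => ?_
      split_ifs
      · simp
      · simpa using mul_le_one₀ (ha1 _) (ha0 _) (ha1 _)
    obtain ⟨e0, e1⟩ := heI t
    have d4 : (f' - f) ^ 2 ≤ e t := by nlinarith
    have d5 : f - α ^ 2 = -(f' - f) + α * (D (x + t) - α) + α * (D x - α) + c := by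
      rw [d1]; ring
    have d6 : α ^ 2 ≤ 1 := by nlinarith
    have d7 : (α * (D (x + t) - α)) ^ 2 ≤ (D (x + t) - α) ^ 2 := by
      rw [mul_pow]; exact mul_le_of_le_one_left (sq_nonneg _) d6
    have d8 : (α * (D x - α)) ^ 2 ≤ (D x - α) ^ 2 := by
      rw [mul_pow]; exact mul_le_of_le_one_left (sq_nonneg _) d6
    rw [d5]
    have d9 : ∀ p q r u : ℝ, (-p + q + r + u) ^ 2 ≤ 4 * (p ^ 2 + q ^ 2 + r ^ 2 + u ^ 2) := by
      intro p q r u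
      nlinarith [sq_nonneg (p + q), sq_nonneg (p + r), sq_nonneg (p + u), sq_nonneg (q - r),
        sq_nonneg (q - u), sq_nonneg (r - u)]
    refine (d9 _ _ _ _).trans ?_
    linarith
  have hsum : defectTwo a s z Z W V ≤ 𝔼 w ∈ Z, 𝔼 t ∈ W, (4 * (e t +
      (D (2 ^ s • (z + w) + t) - α) ^ 2 + (D (2 ^ s • (z + w)) - α) ^ 2 +
        (𝔼 v ∈ V, (a (2 ^ s • (z + w) + t - v) - α) * (a (2 ^ s • (z + w) + v) - α)) ^ 2)) := by
    refine Finset.expect_le_expect fun w _ => Finset.expect_le_expect fun t _ => ?_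
    convert hpt (2 ^ s • (z + w)) t
  refine hsum.trans ?_
  simp_rw [← Finset.mul_expect, Finset.expect_add_distrib]
  refine mul_le_mul_of_nonneg_left ?_ (by norm_num)
  simp_rw [Finset.expect_const hW]
  rw [Finset.expect_const hZ.nonempty]
  have hb := abs_expect_dilate_sub_le (s := s) (z := z) hZ hη hW hWU
    (f := fun x => (D x - α) ^ 2) (fun x => by
      obtain ⟨h2, h3⟩ := hDI x
      rw [abs_of_nonneg (sq_nonneg _)]
      nlinarith)
  have hd1 : 𝔼 w ∈ Z, (D (2 ^ s • (z + w)) - α) ^ 2 = defectOne a s z Z V := rfl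
  rw [hd1] at hb ⊢
  have : 𝔼 w ∈ Z, 𝔼 t ∈ W, (𝔼 v ∈ V, (a (2 ^ s • (z + w) + t - v) - α) *
      (a (2 ^ s • (z + w) + v) - α)) ^ 2 =
      𝔼 w ∈ Z, localCorr (fun x => a x - α) W V (2 ^ s • (z + w)) := rfl
  rw [this]
  linarith [(abs_le.1 hb).2]

end Defects

/-! ### Energy increments -/

/-- A large local correlation yields a character on whose Bohr neighbourhoods the averages of `g`
are large in `L²`. -/
lemma exists_character_of_localCorr {G : Type u} [AddCommGroup G] {g : G → ℝ} {W V : Finset G}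
    {M : Set G} {η ν : ℝ} {x : G} (hg : ∀ y, |g y| ≤ 1) (hη : 0 ≤ η)
    (hWV : TauClosed η (W : Set G) V) (hWM : TauClosed η (W : Set G) M)
    (hVM : TauClosed η (V : Set G) M) (hν : 0 < ν) (hν1 : ν ≤ 1) (hην : 192 * η ≤ ν ^ 2)
    (h : ν ≤ localCorr g W V x) :
    ∃ γ : AddChar G Circle, ∀ B : Finset G, (B : Set G) ∈ Nbhd G → (B : Set G) ⊆ M →
      (∀ v ∈ B, ‖(γ v : ℂ) - 1‖ ≤ 1 / 4) →
      ν ^ 2 / 64 ≤ 𝔼 t ∈ W, (𝔼 v ∈ B, g (x + t + v)) ^ 2 := by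
  classical
  have hW := hWV.nonempty
  have hcW : (0 : ℝ) < W.card := by exact_mod_cast hW.card_pos
  have hMfin : M.Finite := hWM.2.1.1
  set MF : Finset G := hMfin.toFinset with hMF
  have hVne := hVM.nonempty
  -- `T` has to hold both the correlation, supported on `W + V`, and the Bohr averages, supported on
  -- `W + M`.
  set T : Finset G := W + (V ∪ MF) with hT
  have hWT : W ⊆ T := fun t ht => by
    have := Finset.add_mem_add (t := V ∪ MF) ht
      (Finset.mem_union_right _ (hMfin.mem_toFinset.2 hWM.2.1.2.2))
    simpa using this
  set f : G → ℝ := fun y => if y ∈ W then g (x + y) else 0 with hf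
  have hf1 : ∀ y, |f y| ≤ 1 := fun y => by
    simp only [hf]; split_ifs
    · exact hg _
    · simp
  set N := (∑ t ∈ T, (𝔼 v ∈ V, f (t - v) * g (x + v)) ^ 2) / W.card with hN
  have herr : ∀ (B : Finset G) (k : G → ℝ), B.Nonempty → (∀ y, |k y| ≤ 1) → ∀ t,
      |(𝔼 v ∈ B, g (x + t - v) * k v) ^ 2 - (𝔼 v ∈ B, f (t - v) * k v) ^ 2| ≤
        2 * 𝔼 v ∈ B, (if t - v ∈ W then (0 : ℝ) else 1) := by
    intro B k hB hk t
    have hm : ∀ p q : ℝ, |p| ≤ 1 → |q| ≤ 1 → |p * q| ≤ 1 := fun p q hp hq => by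
      rw [abs_mul]; exact mul_le_one₀ hp (abs_nonneg _) hq
    refine (abs_sq_sub_sq_le (abs_expect_le_one hB fun v _ => hm _ _ (hg _) (hk _))
      (abs_expect_le_one hB fun v _ => hm _ _ (hf1 _) (hk _))).trans ?_
    refine mul_le_mul_of_nonneg_left ?_ (by norm_num)
    rw [← Finset.expect_sub_distrib]
    refine (Finset.abs_expect_le _ _).trans (Finset.expect_le_expect fun v _ => ?_)
    simp only [hf]
    split_ifs
    · simp [add_sub_assoc]
    · rw [zero_mul, sub_zero]; exact hm _ _ (hg _) (hk _)
  have herr2 : ∀ (B : Finset G), B.Nonempty → (∀ v ∈ B, 𝔼 t ∈ W,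
      (if t - v ∈ W then (0 : ℝ) else 1) ≤ η) →
      𝔼 t ∈ W, 𝔼 v ∈ B, (if t - v ∈ W then (0 : ℝ) else 1) ≤ η := by
    intro B hB h
    rw [Finset.expect_comm]
    exact Finset.expect_le hB h
  have hNν : ν / 2 ≤ N := by
    have e1 : 𝔼 t ∈ W, (𝔼 v ∈ V, f (t - v) * g (x + v)) ^ 2 ≤ N := by
      rw [hN, Finset.expect_eq_sum_div_card]
      exact div_le_div_of_nonneg_right (Finset.sum_le_sum_of_subset_of_nonneg hWT
        fun _ _ _ => sq_nonneg _) (Nat.cast_nonneg _)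
    have e2 : localCorr g W V x ≤ 𝔼 t ∈ W, ((𝔼 v ∈ V, f (t - v) * g (x + v)) ^ 2 +
        2 * 𝔼 v ∈ V, (if t - v ∈ W then (0 : ℝ) else 1)) := by
      refine Finset.expect_le_expect fun t _ => ?_
      have := (abs_le.1 (herr V (fun v => g (x + v)) hVne (fun y => hg _) t)).2
      linarith
    rw [Finset.expect_add_distrib, ← Finset.mul_expect] at e2
    have e3 := herr2 V hVne fun v hv => hWV.expect_indicator_sub_le hη hv
    nlinarith
  have hN0 : 0 < N := by linarith
  obtain ⟨γ, hγ⟩ := exists_character_of_conv_large (X := W) (Y := V) (T := T) (M := M) (f := f)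
    (h := fun v => g (x + v)) hη hVM hW
    (fun t ht v hv => Finset.add_mem_add ht (Finset.mem_union_left _ hv))
    (fun t ht v hv => Finset.add_mem_add ht (Finset.mem_union_right _ (hMfin.mem_toFinset.2 hv)))
    (fun y hy => by simp [hf, hy]) hf1 (fun y => hg _) hN.symm hN0 (by nlinarith)
  refine ⟨γ, fun B hB hBM hBγ => ?_⟩
  have hBn : B.Nonempty := ⟨0, hB.2.2⟩
  have h1 := hγ B hBn hBM hBγ
  have hin : ∀ v ∈ B, 𝔼 t ∈ W, (if t - v ∈ W then (0 : ℝ) else 1) ≤ η := fun v hv =>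
    hWM.expect_indicator_sub_le hη (hBM hv)
  have hsplit : (∑ t ∈ T, (𝔼 v ∈ B, f (t - v)) ^ 2) / W.card ≤
      (𝔼 t ∈ W, (𝔼 v ∈ B, f (t - v)) ^ 2) + η := by
    rw [← Finset.sum_sdiff hWT, add_div, add_comm, ← Finset.expect_eq_sum_div_card]
    refine add_le_add le_rfl ?_
    rw [div_le_iff₀ hcW]
    have e1 : ∑ t ∈ T \ W, (𝔼 v ∈ B, f (t - v)) ^ 2 ≤
        ∑ t ∈ T \ W, 𝔼 v ∈ B, (if t - v ∈ W then (1 : ℝ) else 0) := by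
      refine Finset.sum_le_sum fun t _ => (sq_expect_le hBn _).trans
        (Finset.expect_le_expect fun v _ => ?_)
      simp only [hf]
      split_ifs
      · rw [sq_le_one_iff_abs_le_one]; exact hg _
      · simp
    refine e1.trans ?_
    rw [← Finset.expect_sum_comm]
    refine Finset.expect_le hBn fun v hv => ?_
    have e2 := hWM.expect_indicator_le hη (hBM hv)
    rw [Finset.expect_eq_sum_div_card, div_le_iff₀ hcW] at e2
    refine le_trans ?_ e2
    have e3 : ∑ t ∈ T \ W, (if t - v ∈ W then (1 : ℝ) else 0) =
        (((T \ W).filter fun t => t - v ∈ W).card : ℝ) := by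
      rw [Finset.card_filter]; push_cast; rfl
    have e4 : ∑ t ∈ W, (if t + v ∈ W then (0 : ℝ) else 1) =
        ((W.filter fun t => ¬ t + v ∈ W).card : ℝ) := by
      rw [Finset.card_filter]; push_cast
      exact Finset.sum_congr rfl fun t _ => by split_ifs <;> simp_all
    rw [e3, e4]
    -- The map `t ↦ t - v` sends points outside `W` that return to `W` injectively to points of `W`
    -- that leave it under `+ v`; these have proportion at most `η`.
    have : ((T \ W).filter fun t => t - v ∈ W).card ≤ (W.filter fun t => ¬ t + v ∈ W).card := by
      refine Finset.card_le_card_of_injOn (fun t => t - v) ?_ (fun _ _ _ _ h => by simpa using h)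
      intro t ht
      simp only [Finset.coe_filter, Finset.mem_sdiff, Set.mem_ofPred_eq] at ht ⊢
      exact ⟨ht.2, by simpa using ht.1.2⟩
    exact_mod_cast this
  have hW2 : 𝔼 t ∈ W, (𝔼 v ∈ B, f (t - v)) ^ 2 ≤
      (𝔼 t ∈ W, (𝔼 v ∈ B, g (x + t + v)) ^ 2) + 2 * η := by
    have e2 : 𝔼 t ∈ W, (𝔼 v ∈ B, f (t - v)) ^ 2 ≤ 𝔼 t ∈ W, ((𝔼 v ∈ B, g (x + t + v)) ^ 2 +
        2 * 𝔼 v ∈ B, (if t - v ∈ W then (0 : ℝ) else 1)) := by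
      refine Finset.expect_le_expect fun t _ => ?_
      have h3 := (abs_le.1 (herr B (fun _ => 1) hBn (by simp) t)).1
      simp only [mul_one] at h3
      have h4 : 𝔼 v ∈ B, g (x + t - v) = 𝔼 v ∈ B, g (x + t + v) :=
        Finset.expect_nbij' (fun v => -v) (fun v => -v) (fun v hv => Nbhd.neg_mem hB hv)
          (fun v hv => Nbhd.neg_mem hB hv) (by simp) (by simp) (by simp [sub_eq_add_neg])
      rw [h4] at h3
      linarith
    rw [Finset.expect_add_distrib, ← Finset.mul_expect] at e2
    have e3 := herr2 B hBn hin
    linarith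
  -- The main term is `N ^ 2 / 8 ≥ ν ^ 2 / 32`, and the total loss `3 * η` is at most `ν ^ 2 / 64`.
  nlinarith

/-! ### Effect of a refinement on averages and on the energy. -/

section Refine

variable {G : Type u} [AddCommGroup G] {Z W : Finset G} {U M : Set G} {η : ℝ} {z : G} {s₀ : ℕ}
  {ι : G → G} {B : G → Finset G}

/-- Here `ι` divides by `2 ^ s₀`. A shift by `y` becomes a shift of `v` by `2 ^ s₀ • y ∈ M`,
absorbed by `W`; then the shift by `ι v ∈ U` is absorbed by `Z`. Each costs `η`. -/
lemma abs_expect_refine_sub_le (hη : 0 ≤ η) (hZ : TauClosed η (Z : Set G) U)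
    (hWM : TauClosed η (W : Set G) M) (hι : ∀ v ∈ W, ι v ∈ U)
    (hι2 : ∀ y, ι (2 ^ s₀ • y) = y) (hι3 : ∀ v ∈ W, 2 ^ s₀ • ι v = v)
    (hB : ∀ w ∈ Z, (B w).Nonempty) (hBM : ∀ w ∈ Z, ∀ y ∈ B w, 2 ^ s₀ • y ∈ M)
    {f : G → ℝ} (hf : ∀ x, |f x| ≤ 1) :
    |(𝔼 w ∈ Z, 𝔼 v ∈ W, 𝔼 y ∈ B w, f (z + w + ι v + y)) - 𝔼 w ∈ Z, f (z + w)| ≤ 2 * η := by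
  have hW := hWM.nonempty
  have s1 : |(𝔼 w ∈ Z, 𝔼 v ∈ W, 𝔼 y ∈ B w, f (z + w + ι v + y)) -
      𝔼 w ∈ Z, 𝔼 v ∈ W, f (z + w + ι v)| ≤ η := by
    refine abs_expect_sub_expect_le hZ.nonempty fun w hw => ?_
    rw [Finset.expect_comm, ← Finset.expect_const (hB w hw) (𝔼 v ∈ W, f (z + w + ι v))]
    refine abs_expect_sub_expect_le (hB w hw) fun y hy => ?_
    have := hWM.abs_expect_sub_le hη (hBM w hw y hy) (f := fun v => f (z + w + ι v))
      (fun _ => hf _)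
    have e : ∀ v ∈ W, f (z + w + ι (v + 2 ^ s₀ • y)) = f (z + w + ι v + y) := by
      intro v hv
      have : ι (v + 2 ^ s₀ • y) = ι v + y := by
        conv_lhs => rw [← hι3 v hv, ← smul_add, hι2]
      rw [this, add_assoc]
      congr 1
      abel
    rwa [Finset.expect_congr rfl e] at this
  have s2 : |(𝔼 w ∈ Z, 𝔼 v ∈ W, f (z + w + ι v)) - 𝔼 w ∈ Z, f (z + w)| ≤ η := by
    rw [Finset.expect_comm, ← Finset.expect_const hW (𝔼 w ∈ Z, f (z + w))]
    refine abs_expect_sub_expect_le hW fun v hv => ?_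
    have := hZ.abs_expect_sub_le hη (hι v hv) (f := fun w => f (z + w)) (fun _ => hf _)
    simpa only [add_assoc] using this
  have := abs_sub_le (𝔼 w ∈ Z, 𝔼 v ∈ W, 𝔼 y ∈ B w, f (z + w + ι v + y))
    (𝔼 w ∈ Z, 𝔼 v ∈ W, f (z + w + ι v)) (𝔼 w ∈ Z, f (z + w))
  linarith

/-- Mean square equals squared mean plus variance, up to the error `2 * η` in the mean. -/
lemma energy_refine_ge (hη : 0 ≤ η) (hZ : TauClosed η (Z : Set G) U)
    (hWM : TauClosed η (W : Set G) M) (hι : ∀ v ∈ W, ι v ∈ U)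
    (hι2 : ∀ y, ι (2 ^ s₀ • y) = y) (hι3 : ∀ v ∈ W, 2 ^ s₀ • ι v = v)
    (hB : ∀ w ∈ Z, (B w).Nonempty) (hBM : ∀ w ∈ Z, ∀ y ∈ B w, 2 ^ s₀ • y ∈ M)
    {a : G → ℝ} (ha0 : ∀ x, 0 ≤ a x) (ha1 : ∀ x, a x ≤ 1) (s : ℕ) :
    dilDens a s z Z ^ 2 + (𝔼 w ∈ Z, 𝔼 v ∈ W,
      (dilDens a s (z + w + ι v) (B w) - dilDens a s z Z) ^ 2) - 4 * η ≤
      𝔼 w ∈ Z, 𝔼 v ∈ W, dilDens a s (z + w + ι v) (B w) ^ 2 := by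
  have hW := hWM.nonempty
  have h1 := abs_expect_refine_sub_le (z := z) hη hZ hWM hι hι2 hι3 hB hBM
    (f := fun x => a (2 ^ s • x)) (fun x => abs_le_one_of_mem_Icc ha0 ha1 _)
  change |_ - dilDens a s z Z| ≤ 2 * η at h1
  change |(𝔼 w ∈ Z, 𝔼 v ∈ W, dilDens a s (z + w + ι v) (B w)) - _| ≤ _ at h1
  simp_rw [expect_sub_sq hW]
  rw [Finset.expect_add_distrib, Finset.expect_sub_distrib, Finset.expect_const hZ.nonempty,
    ← Finset.mul_expect]
  obtain ⟨h2, h3⟩ := dilDens_mem_Icc (s := s) (z := z) hZ.nonempty ha0 ha1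
  have h4 := (abs_le.1 h1).1
  nlinarith

end Refine

/-! ### Chains of regular sets and the increment step -/

/-- A chain of regular sets along a system. -/
def IsRegChain {G : Type u} [AddCommGroup G] (η : ℝ) (V : GSystem G) (q : ℕ) (W : ℕ → Finset G) :
    Prop :=
  ∀ i, V.set (i * q + 1) ⊆ W i ∧ (W i : Set G) ⊆ V.set (i * q) ∧
    TauClosed η (W i : Set G) (V.set ((i + 1) * q))

/-- The approximation, closedness and covering properties of `z + Z` and a chain `W`, together with
the trivial bounds for the uniformity defects. -/
structure IsLeaf {G : Type u} [AddCommGroup G] (a : G → ℝ) (η h : ℝ) (k r : ℕ) (T : Set G) (z : G)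
    (Z : Finset G) (W : ℕ → Finset G) : Prop where
  nbhd : (Z : Set G) ∈ Nbhd G
  nbhd_chain : ∀ i, (W i : Set G) ∈ Nbhd G
  approx : ∀ i s, s ≤ r → ∀ f : G → ℝ, (∀ x, |f x| ≤ 1) →
    |(𝔼 w ∈ Z, 𝔼 v ∈ W i, f (2 ^ s • (z + w) + v)) - 𝔼 w ∈ Z, f (2 ^ s • (z + w))| ≤ η
  closed : ∀ i, TauClosed η (W i : Set G) (W (i + 1))
  cover : ∃ Y : Set G, Cov (2 ^ h) T Y ∧ Y - Y ⊆ W k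
  one : ∀ i s, s ≤ r → defectOne a s z Z (W i) ≤ 1 / 2
  two : ∀ i j s, i < j → s ≤ r → defectTwo a s z Z (W i) (W j) ≤ 1 / 2

/-- Both uniformity defects are at most `ε`. -/
structure IsUniform {G : Type u} [AddCommGroup G] (a : G → ℝ) (ε : ℝ) (k r : ℕ) (z : G)
    (Z : Finset G) (W : ℕ → Finset G) : Prop where
  one : ∀ i s, 1 ≤ i → i ≤ k → s ≤ r → defectOne a s z Z (W i) ≤ ε
  two : ∀ i j s, 1 ≤ i → i < j → j ≤ k → s ≤ r → defectTwo a s z Z (W i) (W j) ≤ ε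

namespace IsRegChain

variable {G : Type u} [AddCommGroup G] {a : G → ℝ} {η κ F h : ℝ} {k r q : ℕ} {T : Set G} {z : G}
  {Z : Finset G} {W : ℕ → Finset G} {U V : GSystem G}

lemma nbhd (hW : IsRegChain η V q W) (i : ℕ) : (W i : Set G) ∈ Nbhd G := (hW i).2.2.1

lemma closed_of_lt (hW : IsRegChain η V q W) {i j : ℕ} (hij : i < j) :
    TauClosed η (W i : Set G) (W j) :=
  (hW i).2.2.mono le_rfl (hW.nbhd j)
    ((hW j).2.1.trans (V.antitone (Nat.mul_le_mul_right q hij)))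

lemma closed_system (hW : IsRegChain η V q W) {i n : ℕ} (hn : (i + 1) * q ≤ n) :
    TauClosed η (W i : Set G) (V.set n) :=
  (hW i).2.2.mono le_rfl (V.mem_Nbhd ((hW i).2.2.2.1.1.subset (V.antitone hn))) (V.antitone hn)

lemma exists_dilate (hW : IsRegChain η (U.dilInter r) q W) (i : ℕ) {s : ℕ} (hs : s ≤ r) :
    ∀ v ∈ W i, ∃ u ∈ U.set 0, 2 ^ s • u = v := fun v hv => by
  obtain ⟨u, hu, h⟩ := (hW i).2.1 hv s hs
  exact ⟨u, U.antitone (Nat.zero_le _) hu, h⟩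

lemma isLeaf (hW : IsRegChain η (U.dilInter r) q W) (ha0 : ∀ x, 0 ≤ a x) (ha1 : ∀ x, a x ≤ 1)
    (hη : 0 ≤ η) (hη1 : η ≤ 1 / 100) (hZ : TauClosed η (Z : Set G) (U.set 0))
    (hU : GSystem.Ctrl T r F h U) :
    IsLeaf a η (h + ((k * q + 2 : ℕ) : ℝ) * F) k r T z Z W where
  nbhd := hZ.1
  nbhd_chain := hW.nbhd
  approx i _ hs _ hf := abs_expect_dilate_sub_le hZ hη (hW i).2.2.nonempty
    (hW.exists_dilate i hs) hf
  closed i := hW.closed_of_lt (Nat.lt_succ_self i)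
  cover := by
    obtain ⟨h1, h2⟩ := hU r le_rfl
    refine ⟨(U.dilInter r).set (k * q + 2), ?_, ?_⟩
    · have h3 := (U.dilInter r).cov_add h1 0 (k * q + 2) (by omega)
      rw [Nat.zero_add] at h3
      refine (h2.trans h3).mono (le_of_eq ?_) subset_rfl subset_rfl
      rw [← Real.rpow_add (by norm_num)]
    · rintro _ ⟨x, hx, y, hy, rfl⟩
      exact (hW k).1 ((U.dilInter r).sub_mem hx hy)
  one i _ hs := defectOne_le_half ha0 ha1 hZ hη hη1 (hW i).2.2.nonempty (hW.exists_dilate i hs)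
  two i j _ hij hs := defectTwo_le_half ha0 ha1 hZ hη hη1 (hW.closed_of_lt hij)
    (hW j).2.2.nonempty (hW.exists_dilate i hs) (hW.exists_dilate j hs)

/-- Failure of uniformity produces characters whose Bohr neighbourhoods give increments. -/
lemma exists_characters (hW : IsRegChain η (U.dilInter r) q W) (ha0 : ∀ x, 0 ≤ a x)
    (ha1 : ∀ x, a x ≤ 1) (hη : 0 ≤ η) (hκ : 0 < κ) (hκ1 : κ ≤ 1) (hηκ : 1000 * η ≤ κ ^ 3)
    (hZ : TauClosed η (Z : Set G) (U.set 0)) (hbad : ¬ IsUniform a (32 * κ) k r z Z W) :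
    ∃ i s, i ≤ k ∧ s ≤ r ∧ ∃ γ : G → AddChar G Circle, ∀ B : G → Finset G,
      (∀ w ∈ Z, (B w : Set G) ∈ Nbhd G) →
      (∀ w ∈ Z, (B w : Set G) ⊆ (U.dilInter r).set ((k + 1) * q)) →
      (∀ w ∈ Z, ∀ y ∈ B w, ‖(γ w y : ℂ) - 1‖ ≤ 1 / 4) →
      κ ^ 3 / 512 ≤ 𝔼 w ∈ Z, 𝔼 t ∈ W i,
        ((𝔼 y ∈ B w, a (2 ^ s • (z + w) + t + y)) - dilDens a s z Z) ^ 2 := by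
  have hκ3 : κ ^ 3 ≤ κ := by nlinarith [mul_pos hκ hκ]
  have hκ2 : κ ^ 3 ≤ κ ^ 2 := by nlinarith [mul_pos hκ hκ]
  have hαI := fun s => dilDens_mem_Icc (s := s) (z := z) hZ.nonempty ha0 ha1
  -- First-order failure needs no character: by Cauchy–Schwarz, averaging further over `B w`
  -- preserves the variance up to `2 * η`.
  by_cases h1 : ∃ i s, i ≤ k ∧ s ≤ r ∧ κ < defectOne a s z Z (W i)
  · obtain ⟨i, s, hi, hs, hd⟩ := h1
    refine ⟨i, s, hi, hs, fun _ => 1, fun B hB hBM _ => ?_⟩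
    have hWi := (hW i).2.2.nonempty
    have key : defectOne a s z Z (W i) ≤ 𝔼 w ∈ Z, ((𝔼 t ∈ W i,
        ((𝔼 y ∈ B w, a (2 ^ s • (z + w) + t + y)) - dilDens a s z Z) ^ 2) + 2 * η) := by
      refine Finset.expect_le_expect fun w hw => ?_
      have hBn : (B w).Nonempty := ⟨0, (hB w hw).2.2⟩
      have hc := hW.closed_system (i := i) (n := (k + 1) * q)
        (Nat.mul_le_mul_right q (by omega))
      set x := 2 ^ s • (z + w)
      have e1 : |(𝔼 t ∈ W i, 𝔼 y ∈ B w, a (x + t + y)) - 𝔼 t ∈ W i, a (x + t)| ≤ η := by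
        rw [Finset.expect_comm, ← Finset.expect_const hBn (𝔼 t ∈ W i, a (x + t))]
        refine abs_expect_sub_expect_le hBn fun y hy => ?_
        have := hc.abs_expect_sub_le hη (hBM w hw hy) (f := fun t => a (x + t))
          (fun _ => abs_le_one_of_mem_Icc ha0 ha1 _)
        simpa only [add_assoc] using this
      have e2 := sq_expect_le hWi (fun t => (𝔼 y ∈ B w, a (x + t + y)) - dilDens a s z Z)
      rw [Finset.expect_sub_distrib, Finset.expect_const hWi] at e2
      have I1 := expect_mem_Icc hWi (φ := fun t => a (x + t)) (fun _ _ => ha0 _)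
        (fun _ _ => ha1 _)
      have I2 := expect_mem_Icc hWi (φ := fun t => 𝔼 y ∈ B w, a (x + t + y))
        (fun t _ => (expect_mem_Icc hBn (fun _ _ => ha0 _) (fun _ _ => ha1 _)).1)
        (fun t _ => (expect_mem_Icc hBn (fun _ _ => ha0 _) (fun _ _ => ha1 _)).2)
      have I3 := hαI s
      have e3 := abs_sq_sub_sq_le (x := (𝔼 t ∈ W i, 𝔼 y ∈ B w, a (x + t + y)) - dilDens a s z Z)
        (y := (𝔼 t ∈ W i, a (x + t)) - dilDens a s z Z)
        (abs_le.2 ⟨by linarith [I2.1, I3.2], by linarith [I2.2, I3.1]⟩)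
        (abs_le.2 ⟨by linarith [I1.1, I3.2], by linarith [I1.2, I3.1]⟩)
      rw [sub_sub_sub_cancel_right] at e3
      linarith [(abs_le.1 e3).1]
    rw [Finset.expect_add_distrib, Finset.expect_const hZ.nonempty] at key
    nlinarith
  push Not at h1
  -- Otherwise all correlations are at most `κ`, and `defectTwo_le` bounds the second-order defects
  -- by `8 * η + 12 * κ ≤ 32 * κ`.
  have h3 : ∃ i j s, i < j ∧ j ≤ k ∧ s ≤ r ∧ κ < 𝔼 w ∈ Z,
      localCorr (fun x => a x - dilDens a s z Z) (W i) (W j) (2 ^ s • (z + w)) := by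
    by_contra hcon
    push Not at hcon
    refine hbad ⟨fun i s _ hi hs => (h1 i s hi hs).trans (by linarith),
      fun i j s _ hij hj hs => ?_⟩
    have e1 := defectTwo_le (z := z) ha0 ha1 hZ hη (hW.closed_of_lt hij) (hW.nbhd j)
      (hW.exists_dilate i hs)
    have e2 := h1 j s hj hs
    have e3 := hcon i j s hij hj hs
    nlinarith
  obtain ⟨i, j, s, hij, hj, hs, hN⟩ := h3
  set g : G → ℝ := fun x => a x - dilDens a s z Z with hg
  have hI := hαI s
  have hg1 : ∀ y, |g y| ≤ 1 := fun y => abs_le.2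
    ⟨by simp only [hg]; linarith [ha0 y, hI.2], by simp only [hg]; linarith [ha1 y, hI.1]⟩
  have hex : ∀ w : G, ∃ γ : AddChar G Circle,
      κ / 2 ≤ localCorr g (W i) (W j) (2 ^ s • (z + w)) →
      ∀ B : Finset G, (B : Set G) ∈ Nbhd G → (B : Set G) ⊆ (U.dilInter r).set ((k + 1) * q) →
      (∀ v ∈ B, ‖(γ v : ℂ) - 1‖ ≤ 1 / 4) →
      (κ / 2) ^ 2 / 64 ≤ 𝔼 t ∈ W i, (𝔼 v ∈ B, g (2 ^ s • (z + w) + t + v)) ^ 2 := by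
    intro w
    by_cases hw : κ / 2 ≤ localCorr g (W i) (W j) (2 ^ s • (z + w))
    · obtain ⟨γ, hγ⟩ := exists_character_of_localCorr hg1 hη (hW.closed_of_lt hij)
        (hW.closed_system (n := (k + 1) * q) (Nat.mul_le_mul_right q (by omega)))
        (hW.closed_system (n := (k + 1) * q) (Nat.mul_le_mul_right q (by omega)))
        (by linarith) (by linarith) (by nlinarith) hw
      exact ⟨γ, fun _ => hγ⟩
    · exact ⟨1, fun h => absurd h hw⟩
  choose γ hγ using hex
  refine ⟨i, s, by omega, hs, γ, fun B hB hBM hBγ => ?_⟩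
  have hWi := (hW i).2.2.nonempty
  -- Subtracting `κ / 2` makes the bound hold trivially where the correlation is small. As the mean
  -- correlation exceeds `κ`, what remains is `κ ^ 2 / 256 * (κ / 2) = κ ^ 3 / 512`.
  have hpt : ∀ w ∈ Z, κ ^ 2 / 256 * (localCorr g (W i) (W j) (2 ^ s • (z + w)) - κ / 2) ≤
      𝔼 t ∈ W i, ((𝔼 y ∈ B w, a (2 ^ s • (z + w) + t + y)) - dilDens a s z Z) ^ 2 := by
    intro w hw
    have hBn : (B w).Nonempty := ⟨0, (hB w hw).2.2⟩
    have e1 : 𝔼 t ∈ W i, ((𝔼 y ∈ B w, a (2 ^ s • (z + w) + t + y)) - dilDens a s z Z) ^ 2 =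
        𝔼 t ∈ W i, (𝔼 v ∈ B w, g (2 ^ s • (z + w) + t + v)) ^ 2 := by
      refine Finset.expect_congr rfl fun t _ => ?_
      rw [hg, Finset.expect_sub_distrib, Finset.expect_const hBn]
    rw [e1]
    by_cases hc : κ / 2 ≤ localCorr g (W i) (W j) (2 ^ s • (z + w))
    · have e2 := hγ w hc (B w) (hB w hw) (hBM w hw) (hBγ w hw)
      have e3 : localCorr g (W i) (W j) (2 ^ s • (z + w)) ≤ 1 := by
        refine Finset.expect_le hWi fun t _ => ?_
        rw [sq_le_one_iff_abs_le_one]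
        refine abs_expect_le_one (hW j).2.2.nonempty fun v _ => ?_
        rw [abs_mul]
        exact mul_le_one₀ (hg1 _) (abs_nonneg _) (hg1 _)
      have : 0 < κ ^ 2 := by positivity
      nlinarith
    · push Not at hc
      have e2 : 0 ≤ 𝔼 t ∈ W i, (𝔼 v ∈ B w, g (2 ^ s • (z + w) + t + v)) ^ 2 :=
        Finset.expect_nonneg fun _ _ => sq_nonneg _
      have : 0 < κ ^ 2 := by positivity
      nlinarith
  have hsum := Finset.expect_le_expect hpt
  rw [← Finset.mul_expect, Finset.expect_sub_distrib, Finset.expect_const hZ.nonempty] at hsum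
  have : 0 < κ ^ 2 := by positivity
  nlinarith

end IsRegChain

namespace GSystem

variable {G : Type u} [AddCommGroup G] {a : G → ℝ} {η κ F Fmax h : ℝ} {k r q m : ℕ} {T : Set G}
  {z : G} {Z : Finset G} {W : ℕ → Finset G} {U : GSystem G}

lemma exists_isRegChain (hfin : (U.set 0).Finite) (hη : 0 < η) (hη1 : η ≤ 1)
    (hU : Ctrl T r F h U) (hF : F ≤ Fmax) (hq : 4 * Fmax / η ≤ 2 ^ q) (hq2 : 2 ≤ q) :
    ∃ W, IsRegChain η (U.dilInter r) q W := by
  have hF' : 4 * F / η ≤ 2 ^ q := le_trans (by gcongr) hq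
  have : ∀ i, ∃ Wi : Finset G, (U.dilInter r).set (i * q + 1) ⊆ Wi ∧
      (Wi : Set G) ⊆ (U.dilInter r).set (i * q) ∧
      TauClosed η (Wi : Set G) ((U.dilInter r).set ((i + 1) * q)) := by
    intro i
    rw [add_mul, one_mul]
    exact (U.dilInter r).exists_tauClosed (hfin.subset (U.dilInter_subset r 0)) hη hη1 (i * q)
      ((hU r le_rfl).1 _) hF' hq2
  choose W hW using this
  exact ⟨W, hW⟩

/-- The increment step. -/
lemma exists_increment (h2 : ∀ x : G, 2 • x = 0 → x = 0) (ha0 : ∀ x, 0 ≤ a x)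
    (ha1 : ∀ x, a x ≤ 1) (hη : 0 < η) (hκ : 0 < κ) (hκ1 : κ ≤ 1)
    (hηκ : 10000 * (r + 1) * η ≤ κ ^ 3) (hZ : TauClosed η (Z : Set G) (U.set 0))
    (hU : Ctrl T (m + r) F h U) (hF : F + 7 * (m + 1) ≤ Fmax) (hq : 4 * Fmax / η ≤ 2 ^ q)
    (hq2 : 2 ≤ q) (hW : IsRegChain η (U.dilInter r) q W)
    (hbad : ¬ IsUniform a (32 * κ) k r z Z W) :
    ∃ (W₀ : Finset G) (ι : G → G) (B : G → Finset G) (U' : G → GSystem G), W₀.Nonempty ∧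
      (∀ w, TauClosed η (B w : Set G) ((U' w).set 0) ∧
        Ctrl T m (F + 7 * (m + 1)) (h + (((k + 1) * q + r + q : ℕ) : ℝ) * F +
          (2 * ((r + 2 + q : ℕ) : ℝ) + 8) * (m + 1)) (U' w)) ∧
      (∀ f : G → ℝ, (∀ x, |f x| ≤ 1) →
        |(𝔼 w ∈ Z, 𝔼 v ∈ W₀, 𝔼 y ∈ B w, f (z + w + ι v + y)) - 𝔼 w ∈ Z, f (z + w)| ≤ 2 * η) ∧
      (∑ s ∈ Finset.range (r + 1), dilDens a s z Z ^ 2) + κ ^ 3 / 1024 ≤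
        𝔼 w ∈ Z, 𝔼 v ∈ W₀, ∑ s ∈ Finset.range (r + 1), dilDens a s (z + w + ι v) (B w) ^ 2 := by
  have hκ3 : κ ^ 3 ≤ 1 := pow_le_one₀ hκ.le hκ1
  have hr0 : (0 : ℝ) ≤ r := Nat.cast_nonneg _
  have hηr : 0 ≤ r * η := by positivity
  have hη1 : η ≤ 1 := by nlinarith
  obtain ⟨i, s₀, hi, hs₀, γ, hγ⟩ := hW.exists_characters (k := k) ha0 ha1 hη.le hκ hκ1
    (by nlinarith) hZ hbad
  have hq0 : 1 ≤ (k + 1) * q + r := by nlinarith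
  have hCtrl : ∀ (w : G) (n p : ℕ), 1 ≤ n → Ctrl T m (F + 7 * (m + 1))
      (h + n * F + (2 * p + 8) * (m + 1)) (U.refine r n p (γ w)) := fun w n p hn =>
    hU.refine h2 hn p (γ w)
  have hfinU : (U.set 0).Finite := hZ.2.1.1
  -- The extra shift by `r` keeps `2 ^ s • y` in `M` for `s ≤ r`, and the radius `2 ^ (-(r + 2))`
  -- keeps `γ w (2 ^ s₀ • y)` within `1 / 4` of `1`. The next system starts `q` indices further on.
  have hB : ∀ w, ∃ B : Finset G,
      (B : Set G) ⊆ (U.refine r ((k + 1) * q + r) (r + 2) (γ w)).set 0 ∧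
      TauClosed η (B : Set G) ((U.refine r ((k + 1) * q + r + q) (r + 2 + q) (γ w)).set 0) := by
    intro w
    have hc := ((hCtrl w ((k + 1) * q + r) (r + 2) hq0) 0 (Nat.zero_le _)).1 0
    have e : ∀ i, ((U.refine r ((k + 1) * q + r) (r + 2) (γ w)).dilInter 0).set i =
        (U.refine r ((k + 1) * q + r) (r + 2) (γ w)).set i := by
      intro i
      ext x
      simp [mem_dilInter]
    rw [e, e] at hc
    obtain ⟨B, -, hB1, hB2⟩ :=
      exists_tauClosed (U.refine r ((k + 1) * q + r) (r + 2) (γ w))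
      (hfinU.subset fun x hx => U.antitone (Nat.zero_le _) (U.dilInter_subset r _ hx.1))
      hη hη1 0 hc (q := q) (le_trans (by gcongr) hq) hq2
    refine ⟨B, hB1, ?_⟩
    have e2 : (U.refine r ((k + 1) * q + r) (r + 2) (γ w)).set (0 + q) =
        (U.refine r ((k + 1) * q + r + q) (r + 2 + q) (γ w)).set 0 := by
      simp [GSystem.refine, inter, shift, bohr]
    rwa [e2] at hB2
  choose B hB1 hB2 using hB
  set M := (U.dilInter r).set ((k + 1) * q) with hM
  have hBM : ∀ w, ∀ y ∈ B w, ∀ s ≤ r, 2 ^ s • y ∈ M := by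
    intro w y hy s hs
    have := (hB1 w hy).1
    refine two_pow_nsmul_mem _ s ((U.dilInter r).antitone (by omega) this)
  have hBγ : ∀ w, ∀ y ∈ B w, ‖(γ w (2 ^ s₀ • y) : ℂ) - 1‖ ≤ 1 / 4 := by
    intro w y hy
    have h1 := (hB1 w hy).2
    have h3 : y ∈ (bohr (γ w) 2).set (0 + s₀) := by
      simp only [bohr, Set.mem_ofPred_eq, Nat.zero_add, Nat.add_zero] at h1 ⊢
      refine h1.trans ?_
      refine one_div_le_one_div_of_le (by positivity) ?_
      exact pow_le_pow_right₀ (by norm_num) (by omega)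
    have h4 := two_pow_nsmul_mem _ s₀ h3
    simp only [bohr, Set.mem_ofPred_eq, Nat.add_zero] at h4
    norm_num at h4 ⊢
    exact h4
  have hBn : ∀ w, (B w).Nonempty := fun w => (hB2 w).nonempty
  have hinj := two_pow_nsmul_injective h2 s₀
  -- Off the multiples of `2 ^ s₀` the value of `ι` is arbitrary and never matters.
  set ι : G → G := Function.invFun (fun x : G => 2 ^ s₀ • x) with hι
  have hι2 : ∀ y, ι (2 ^ s₀ • y) = y := Function.leftInverse_invFun hinj
  have hι3 : ∀ v ∈ W i, ι v ∈ U.set 0 ∧ 2 ^ s₀ • ι v = v := by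
    intro v hv
    obtain ⟨u, hu, rfl⟩ := hW.exists_dilate i hs₀ v hv
    rw [hι2]
    exact ⟨hu, rfl⟩
  have hWM := hW.closed_system (i := i) (n := (k + 1) * q) (Nat.mul_le_mul_right q (by omega))
  refine ⟨W i, ι, B, fun w => U.refine r ((k + 1) * q + r + q) (r + 2 + q) (γ w),
    (hW i).2.2.nonempty, fun w => ⟨hB2 w, hCtrl w _ _ (by omega)⟩, fun f hf => ?_, ?_⟩
  · exact abs_expect_refine_sub_le hη.le hZ hWM (fun v hv => (hι3 v hv).1) hι2
      (fun v hv => (hι3 v hv).2) (fun w _ => hBn w) (fun w _ y hy => hBM w y hy s₀ hs₀) hf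
  · have hE := fun s => energy_refine_ge (z := z) hη.le hZ hWM (fun v hv => (hι3 v hv).1) hι2
      (fun v hv => (hι3 v hv).2) (fun w _ => hBn w) (fun w _ y hy => hBM w y hy s₀ hs₀) ha0 ha1 s
    classical
    have hinc : κ ^ 3 / 512 ≤ 𝔼 w ∈ Z, 𝔼 v ∈ W i,
        (dilDens a s₀ (z + w + ι v) (B w) - dilDens a s₀ z Z) ^ 2 := by
      -- The characters are tested on the dilate of `B w` by `2 ^ s₀`: an average over it about `2 ^
      -- s₀ • (z + w) + v` is the density of the piece at `z + w + ι v`.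
      have h5 := hγ (fun w => (B w).image (fun y => 2 ^ s₀ • y))
        (fun w _ => by
          have hb := finset_mem_Nbhd_iff.1 (hB2 w).1
          rw [finset_mem_Nbhd_iff]
          refine ⟨fun x hx => ?_, Finset.mem_image.2 ⟨0, hb.2, by simp⟩⟩
          obtain ⟨y, hy, rfl⟩ := Finset.mem_image.1 hx
          exact Finset.mem_image.2 ⟨-y, hb.1 y hy, by simp⟩)
        (fun w _ x hx => by
          obtain ⟨y, hy, rfl⟩ := Finset.mem_image.1 (Finset.mem_coe.1 hx)
          exact hBM w y hy s₀ hs₀)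
        (fun w _ x hx => by
          obtain ⟨y, hy, rfl⟩ := Finset.mem_image.1 hx
          exact hBγ w y hy)
      refine h5.trans (le_of_eq ?_)
      refine Finset.expect_congr rfl fun w _ => Finset.expect_congr rfl fun v hv => ?_
      rw [Finset.expect_image hinj.injOn]
      congr 2
      refine Finset.expect_congr rfl fun y _ => ?_
      rw [smul_add _ (z + w + ι v), smul_add _ (z + w) (ι v), (hι3 v hv).2]
    have hnn : ∀ s, 0 ≤ 𝔼 w ∈ Z, 𝔼 v ∈ W i,
        (dilDens a s (z + w + ι v) (B w) - dilDens a s z Z) ^ 2 := fun s =>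
      Finset.expect_nonneg fun _ _ => Finset.expect_nonneg fun _ _ => sq_nonneg _
    have hsum := Finset.sum_le_sum fun s (_ : s ∈ Finset.range (r + 1)) => hE s
    have hone := Finset.single_le_sum (fun s _ => hnn s)
      (Finset.mem_range.2 (Nat.lt_succ_of_le hs₀))
    rw [Finset.sum_sub_distrib, Finset.sum_add_distrib, Finset.sum_const, Finset.card_range,
      nsmul_eq_mul] at hsum
    simp_rw [Finset.expect_sum_comm]
    push_cast at hsum
    -- Scale `s₀` gains `κ ^ 3 / 512`, while the `r + 1` scales together lose at most `4 * (r + 1) *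
    -- η`.
    linarith

end GSystem

/-! ### The iteration -/

lemma expect_expect_eq_sum {κ κ' : Type*} (Z : Finset κ) (W : Finset κ') (φ : κ → κ' → ℝ) :
    𝔼 w ∈ Z, 𝔼 v ∈ W, φ w v = ∑ x : Z × W, ((Z.card : ℝ) * W.card)⁻¹ * φ x.1 x.2 := by
  rw [Fintype.sum_prod_type, Finset.expect_eq_sum_div_card,
    ← Finset.sum_coe_sort Z (fun w => 𝔼 v ∈ W, φ w v), Finset.sum_div]
  refine Finset.sum_congr rfl fun w _ => ?_
  rw [Finset.expect_eq_sum_div_card, ← Finset.sum_coe_sort W, div_div, mul_comm, ← Finset.mul_sum,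
    ← div_eq_inv_mul, mul_comm (Z.card : ℝ)]

lemma IsLeaf.mono {G : Type u} [AddCommGroup G] {a : G → ℝ} {η η' h h' : ℝ} {k r : ℕ} {T : Set G}
    {z : G} {Z : Finset G} {W : ℕ → Finset G} (hl : IsLeaf a η h k r T z Z W) (hη : η ≤ η')
    (hh : h ≤ h') : IsLeaf a η' h' k r T z Z W := by
  obtain ⟨Y, hY, hYk⟩ := hl.cover
  exact { hl with
    approx := fun i s hs f hf => (hl.approx i s hs f hf).trans hη
    closed := fun i => (hl.closed i).mono hη (hl.nbhd_chain _) subset_rfl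
    cover := ⟨Y, hY.mono (Real.rpow_le_rpow_of_exponent_le (by norm_num) hh)
      subset_rfl subset_rfl, hYk⟩ }

lemma sum_sq_dilDens_le {G : Type u} [AddCommGroup G] {a : G → ℝ} {z : G} {Z : Finset G}
    (hZ : Z.Nonempty) (ha0 : ∀ x, 0 ≤ a x) (ha1 : ∀ x, a x ≤ 1) (r : ℕ) :
    ∑ s ∈ Finset.range (r + 1), dilDens a s z Z ^ 2 ≤ r + 1 := by
  have : ∑ s ∈ Finset.range (r + 1), dilDens a s z Z ^ 2 ≤
      ∑ s ∈ Finset.range (r + 1), (1 : ℝ) := Finset.sum_le_sum fun s _ => by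
    obtain ⟨h0, h1⟩ := dilDens_mem_Icc (s := s) (z := z) hZ ha0 ha1
    exact pow_le_one₀ h0 h1
  simpa using this

/-- Induction on the number `J` of rounds left, with the system at each node able to supply `r * (J
+ 1)` dilates: `r` for each round and `r` for the final chain. The flag `b` marks leaves not known
to be uniform, and the last inequality says that every round run on them has been paid for in
energy. -/
lemma exists_leaves {G : Type u} [AddCommGroup G] {a : G → ℝ} {η κ Fmax Hmax Δ : ℝ}
    {k r q M : ℕ} {T : Set G}
    (h2 : ∀ x : G, 2 • x = 0 → x = 0) (ha0 : ∀ x, 0 ≤ a x)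
    (ha1 : ∀ x, a x ≤ 1) (hη : 0 < η) (hκ : 0 < κ) (hκ1 : κ ≤ 1)
    (hηκ : 10000 * (r + 1) * η ≤ κ ^ 3) (hq : 4 * Fmax / η ≤ 2 ^ q) (hq2 : 2 ≤ q)
    (hΔ : Δ = (((k + 1) * q + r + q : ℕ) : ℝ) * Fmax +
      (2 * ((r + 2 + q : ℕ) : ℝ) + 8) * (M + 1)) (hFmax : 0 ≤ Fmax) (J : ℕ) :
    ∀ (z : G) (Z : Finset G) (U : GSystem G) (F h : ℝ), r * (J + 1) ≤ M →
      TauClosed η (Z : Set G) (U.set 0) → GSystem.Ctrl T (r * (J + 1)) F h U →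
      F + J * (7 * (M + 1)) ≤ Fmax → h + J * Δ ≤ Hmax →
      ∃ (I : Type u) (_ : Fintype I) (p : I → ℝ) (zz : I → G) (ZZ : I → Finset G)
        (WW : I → ℕ → Finset G) (b : I → ℝ), (∀ i, 0 ≤ p i) ∧ ∑ i, p i = 1 ∧
        (∀ i, IsLeaf a η (Hmax + ((k * q + 2 : ℕ) : ℝ) * Fmax) k r T (zz i) (ZZ i) (WW i)) ∧
        (∀ f : G → ℝ, (∀ x, |f x| ≤ 1) →
          |∑ i, p i * (𝔼 w ∈ ZZ i, f (zz i + w)) - 𝔼 w ∈ Z, f (z + w)| ≤ 2 * J * η) ∧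
        (∀ i, b i = 1 ∨ (b i = 0 ∧ IsUniform a (32 * κ) k r (zz i) (ZZ i) (WW i))) ∧
        κ ^ 3 / 1024 * J * (∑ i, p i * b i) ≤
          (r + 1) - ∑ s ∈ Finset.range (r + 1), dilDens a s z Z ^ 2 := by
  have hr0 : (0 : ℝ) ≤ r := Nat.cast_nonneg _
  have hκ3 : κ ^ 3 ≤ 1 := pow_le_one₀ hκ.le hκ1
  have hηr : 0 ≤ r * η := by positivity
  have hη1 : η ≤ 1 / 100 := by nlinarith
  have hM0 : (0 : ℝ) ≤ 7 * (M + 1) := by positivity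
  have hΔ0 : 0 ≤ Δ := by rw [hΔ]; positivity
  have single : ∀ (z : G) (Z : Finset G) (U : GSystem G) (F h : ℝ),
      TauClosed η (Z : Set G) (U.set 0) → GSystem.Ctrl T r F h U → F ≤ Fmax → h ≤ Hmax →
      ∃ W, IsRegChain η (U.dilInter r) q W ∧
        IsLeaf a η (Hmax + ((k * q + 2 : ℕ) : ℝ) * Fmax) k r T z Z W := by
    intro z Z U F h hZ hU hF hh
    obtain ⟨W, hW⟩ := GSystem.exists_isRegChain hZ.2.1.1 hη (by linarith) hU hF hq hq2
    exact ⟨W, hW, (hW.isLeaf ha0 ha1 hη.le hη1 hZ hU).mono le_rfl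
      (add_le_add hh (mul_le_mul_of_nonneg_left hF (Nat.cast_nonneg _)))⟩
  induction J with
  | zero =>
    intro z Z U F h _ hZ hU hF hh
    obtain ⟨W, -, hl⟩ := single z Z U F h hZ (hU.mono (by simp) le_rfl le_rfl)
      (by simpa using hF) (by simpa using hh)
    -- With no rounds left the leaf is flagged without inspection; the factor `J = 0` makes this
    -- harmless.
    refine ⟨PUnit, inferInstance, fun _ => 1, fun _ => z, fun _ => Z, fun _ => W, fun _ => 1,
      by simp, by simp, fun _ => hl, by simp, fun _ => Or.inl rfl, ?_⟩
    simpa using sum_sq_dilDens_le hZ.nonempty ha0 ha1 r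
  | succ J ih =>
    intro z Z U F h hM hZ hU hF hh
    push_cast at hF hh
    have hJ0 : (0 : ℝ) ≤ J := Nat.cast_nonneg _
    have hJM : 0 ≤ J * (7 * ((M : ℝ) + 1)) := by positivity
    have hJΔ : 0 ≤ J * Δ := by positivity
    obtain ⟨W, hW, hl⟩ := single z Z U F h hZ
      (hU.mono (Nat.le_mul_of_pos_right r (by omega)) le_rfl le_rfl) (by linarith) (by linarith)
    by_cases hg : IsUniform a (32 * κ) k r z Z W
    · refine ⟨PUnit, inferInstance, fun _ => 1, fun _ => z, fun _ => Z, fun _ => W, fun _ => 0,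
        by simp, by simp, fun _ => hl, fun f _ => ?_, fun _ => Or.inr ⟨rfl, hg⟩, ?_⟩
      · simp; positivity
      · simpa using sum_sq_dilDens_le hZ.nonempty ha0 ha1 r
    have hm : r * (J + 1) ≤ M := le_trans (Nat.mul_le_mul_left r (by omega)) hM
    have hmR : ((r * (J + 1) : ℕ) : ℝ) ≤ M := by exact_mod_cast hm
    obtain ⟨W₀, ι, B, U', hW₀, hB, hTV, hE⟩ := GSystem.exists_increment (T := T) (m := r * (J + 1))
      (F := F) (Fmax := Fmax) (h := h) (k := k) h2 ha0 ha1 hη hκ hκ1 hηκ hZ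
      (hU.mono (by rw [mul_add r (J + 1) 1, mul_one]) le_rfl le_rfl) (by nlinarith) hq hq2 hW hg
    have hsub := fun (w v : G) => ih (z + w + ι v) (B w) (U' w) (F + 7 * (M + 1)) (h + Δ) hm
      (hB w).1 ((hB w).2.mono le_rfl (by linarith) (by
        rw [hΔ, add_assoc]
        refine add_le_add le_rfl (add_le_add ?_ ?_)
        · exact mul_le_mul_of_nonneg_left (by linarith) (Nat.cast_nonneg _)
        · exact mul_le_mul_of_nonneg_left (by linarith) (by positivity)))
      (by linarith) (by linarith)
    choose I hI p zz ZZ WW b hp0 hp1 hleaf htv hb hbad using hsub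
    set c : ℝ := ((Z.card : ℝ) * W₀.card)⁻¹ with hc
    have hc0 : 0 ≤ c := by positivity
    have hsum1 : ∀ φ : G → G → ℝ, ∑ x : Z × W₀, c * φ x.1 x.2 = 𝔼 w ∈ Z, 𝔼 v ∈ W₀, φ w v :=
      fun φ => (expect_expect_eq_sum Z W₀ φ).symm
    have hsum2 : ∀ φ : (w v : G) → I w v → ℝ,
        ∑ y : (Σ x : Z × W₀, I x.1 x.2), c * p y.1.1 y.1.2 y.2 * φ y.1.1 y.1.2 y.2 =
        𝔼 w ∈ Z, 𝔼 v ∈ W₀, ∑ i, p w v i * φ w v i := by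
      intro φ
      rw [Fintype.sum_sigma, ← hsum1]
      refine Finset.sum_congr rfl fun x _ => ?_
      rw [Finset.mul_sum]
      exact Finset.sum_congr rfl fun i _ => by ring
    refine ⟨Σ x : Z × W₀, I x.1 x.2, inferInstance, fun y => c * p y.1.1 y.1.2 y.2,
      fun y => zz _ _ y.2, fun y => ZZ _ _ y.2, fun y => WW _ _ y.2, fun y => b _ _ y.2,
      fun y => mul_nonneg hc0 (hp0 _ _ _), ?_, fun y => hleaf _ _ _, fun f hf => ?_,
      fun y => hb _ _ _, ?_⟩
    · have := hsum2 fun _ _ _ => 1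
      simp only [mul_one, hp1] at this
      rw [this, Finset.expect_const hW₀, Finset.expect_const hZ.nonempty]
    · have e1 := hsum2 fun w v i => 𝔼 y ∈ ZZ w v i, f (zz w v i + y)
      rw [e1]
      have e2 : |(𝔼 w ∈ Z, 𝔼 v ∈ W₀, ∑ i, p w v i * 𝔼 y ∈ ZZ w v i, f (zz w v i + y)) -
          𝔼 w ∈ Z, 𝔼 v ∈ W₀, 𝔼 y ∈ B w, f (z + w + ι v + y)| ≤ 2 * J * η :=
        abs_expect_sub_expect_le hZ.nonempty fun w _ => abs_expect_sub_expect_le hW₀ fun v _ =>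
          htv w v f hf
      have e3 := hTV f hf
      have e4 := abs_sub_le (𝔼 w ∈ Z, 𝔼 v ∈ W₀, ∑ i, p w v i * 𝔼 y ∈ ZZ w v i, f (zz w v i + y))
        (𝔼 w ∈ Z, 𝔼 v ∈ W₀, 𝔼 y ∈ B w, f (z + w + ι v + y)) (𝔼 w ∈ Z, f (z + w))
      push_cast
      linarith
    · have e1 := hsum2 fun w v i => b w v i
      rw [e1]
      set S := 𝔼 w ∈ Z, 𝔼 v ∈ W₀, ∑ i, p w v i * b w v i with hS
      have hS1 : S ≤ 1 := Finset.expect_le hZ.nonempty fun w _ => Finset.expect_le hW₀ fun v _ => by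
        rw [← hp1 w v]
        refine Finset.sum_le_sum fun i _ => mul_le_of_le_one_right (hp0 _ _ _) ?_
        rcases hb w v i with h | h
        · exact h.le
        · rw [h.1]; norm_num
      have e2 : κ ^ 3 / 1024 * J * S ≤ 𝔼 w ∈ Z, 𝔼 v ∈ W₀, ((r + 1 : ℝ) -
          ∑ s ∈ Finset.range (r + 1), dilDens a s (z + w + ι v) (B w) ^ 2) := by
        rw [hS, Finset.mul_expect]
        refine Finset.expect_le_expect fun w _ => ?_
        rw [Finset.mul_expect]
        exact Finset.expect_le_expect fun v _ => hbad w v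
      simp_rw [Finset.expect_sub_distrib, Finset.expect_const hW₀] at e2
      rw [Finset.expect_const hZ.nonempty] at e2
      -- The flagged mass `S` is at most `1`, so the energy gained in this round pays for the one
      -- additional multiple of `S`.
      have hk : κ ^ 3 / 1024 * S ≤ κ ^ 3 / 1024 := mul_le_of_le_one_right (by positivity) hS1
      push_cast
      linarith

/-! ### Choice of parameters -/

lemma abs_expect_subset_sub_le {κ : Type*} {Z Z' : Finset κ} (h : Z' ⊆ Z) (hZ' : Z'.Nonempty)
    {f : κ → ℝ} (hf : ∀ x, |f x| ≤ 1) :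
    |(𝔼 x ∈ Z', f x) - 𝔼 x ∈ Z, f x| ≤ 2 * (1 - (Z'.card : ℝ) / Z.card) := by
  classical
  have hm : (0 : ℝ) < Z'.card := by exact_mod_cast hZ'.card_pos
  have hn : (0 : ℝ) < Z.card := by exact_mod_cast (hZ'.mono h).card_pos
  have h1 : ∑ x ∈ Z, f x = (∑ x ∈ Z \ Z', f x) + Z'.card * 𝔼 x ∈ Z', f x := by
    rw [Finset.expect_eq_sum_div_card, mul_div_cancel₀ _ hm.ne', Finset.sum_sdiff h]
  have h2 : |∑ x ∈ Z \ Z', f x| ≤ Z.card - Z'.card := by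
    have : ((Z \ Z').card : ℝ) = Z.card - Z'.card := by
      rw [Finset.card_sdiff_of_subset h, Nat.cast_sub (Finset.card_le_card h)]
    rw [← this]
    exact (Finset.abs_sum_le_sum_abs _ _).trans ((Finset.sum_le_sum fun x _ => hf x).trans
      (by simp))
  have h3 : |𝔼 x ∈ Z', f x| ≤ 1 := abs_expect_le_one hZ' fun x _ => hf x
  have h4 : (Z'.card : ℝ) ≤ Z.card := by exact_mod_cast Finset.card_le_card h
  have h5 : (𝔼 x ∈ Z', f x) - 𝔼 x ∈ Z, f x =
      (((Z.card : ℝ) - Z'.card) * (𝔼 x ∈ Z', f x) - ∑ x ∈ Z \ Z', f x) / Z.card := by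
    rw [Finset.expect_eq_sum_div_card (s := Z), h1]
    field_simp
    ring
  rw [h5, abs_div, abs_of_pos hn, div_le_iff₀ hn]
  refine (abs_sub _ _).trans ?_
  rw [abs_mul, abs_of_nonneg (sub_nonneg.2 h4)]
  have : ((Z.card : ℝ) - Z'.card) * |𝔼 x ∈ Z', f x| ≤ Z.card - Z'.card :=
    mul_le_of_le_one_right (sub_nonneg.2 h4) h3
  have e : 2 * (1 - (Z'.card : ℝ) / Z.card) * Z.card = 2 * (Z.card - Z'.card) := by
    field_simp
  rw [e]
  linarith

section PowBounds

variable {x a b : ℝ} {m n : ℕ}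

lemma le_pow_of_le (hx : 2 ≤ x) (ha : a ≤ x ^ m) (h : m ≤ n) : a ≤ x ^ n :=
  ha.trans (pow_le_pow_right₀ (by linarith) h)

lemma add_le_pow (hx : 2 ≤ x) (ha : a ≤ x ^ m) (hb : b ≤ x ^ n) : a + b ≤ x ^ (max m n + 1) := by
  have h1 := le_pow_of_le hx ha (le_max_left m n)
  have h2 := le_pow_of_le hx hb (le_max_right m n)
  have : 0 < x ^ max m n := by positivity
  rw [pow_succ]
  nlinarith

lemma mul_le_pow (hx : 2 ≤ x) (ha : a ≤ x ^ m) (hb : b ≤ x ^ n) (hb0 : 0 ≤ b) :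
    a * b ≤ x ^ (m + n) := by
  rw [pow_add]
  exact mul_le_mul ha hb hb0 (by positivity)

end PowBounds

/-- The parameters of the iteration are polynomially bounded. -/
lemma param_bound {d δ : ℝ} {k r : ℕ} (hd : 1 ≤ d) (hδ : 0 < δ) (hδ1 : δ ≤ 1) (hk : 1 ≤ k)
    (hr : 1 ≤ r) (hdk : 2 ≤ d * k) {κ η Fmax Δ Hmax h0 : ℝ} {J J₀ q₀ q M : ℕ} (hκ : κ = δ / 64)
    (hη : η = κ ^ 3 * δ ^ 2 / (2 ^ 14 * (r + 1)))
    (hJ₀ : (J₀ : ℝ) ≤ 2048 * (r + 1) / (κ ^ 3 * δ) + 1) (hJ : J ≤ J₀)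
    (hq₀ : (q₀ : ℝ) ≤ 4 / η + 1) (hM : M = r * (J + 1) + q₀)
    (hF : Fmax = d * (M + 1) + J * (7 * (M + 1))) (hq : (q : ℝ) ≤ 4 * Fmax / η + 3)
    (hΔ : Δ = (((k + 1) * q + r + q : ℕ) : ℝ) * Fmax + (2 * ((r + 2 + q : ℕ) : ℝ) + 8) * (M + 1))
    (hh0 : h0 = d + (M + 2) * d * (M + 1)) (hH : Hmax = h0 + J * Δ) :
    Hmax + ((k * q + 2 : ℕ) : ℝ) * Fmax ≤ (d * k * r * δ⁻¹) ^ 400 := by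
  have hk1 : (1 : ℝ) ≤ k := by exact_mod_cast hk
  have hr1 : (1 : ℝ) ≤ r := by exact_mod_cast hr
  have hδi : 1 ≤ δ⁻¹ := (one_le_inv₀ hδ).2 hδ1
  set x := d * k * r * δ⁻¹ with hx
  have hdk1 : d ≤ d * k := le_mul_of_one_le_right (by linarith) hk1
  have hkd1 : (k : ℝ) ≤ d * k := le_mul_of_one_le_left (by linarith) hd
  have hdkr : d * k ≤ d * k * r := le_mul_of_one_le_right (by linarith) hr1
  have hrdk : (r : ℝ) ≤ d * k * r := le_mul_of_one_le_left (by linarith) (by linarith)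
  have hdkrx : d * k * r ≤ x := le_mul_of_one_le_right (by linarith) hδi
  -- This comes from `d * k ≥ 2`, and it allows every numerical constant to be absorbed into a power
  -- of `x`.
  have hx2 : 2 ≤ x := by linarith
  have hδx : δ⁻¹ ≤ x := le_mul_of_one_le_left (by linarith) (by linarith)
  have xd : d ≤ x ^ 1 := by rw [pow_one]; linarith
  have xk : (k : ℝ) ≤ x ^ 1 := by rw [pow_one]; linarith
  have xr : (r : ℝ) ≤ x ^ 1 := by rw [pow_one]; linarith
  have xδ : δ⁻¹ ≤ x ^ 1 := by rw [pow_one]; linarith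
  have x1 : (1 : ℝ) ≤ x ^ 0 := by simp
  have xc : ∀ n : ℕ, (2 : ℝ) ^ n ≤ x ^ n := fun n => pow_le_pow_left₀ (by norm_num) hx2 n
  have x2 : (2 : ℝ) ≤ x ^ 1 := by rw [pow_one]; exact hx2
  have x4 : (4 : ℝ) ≤ x ^ 2 := by have := xc 2; norm_num at this ⊢; exact this
  have x8 : (8 : ℝ) ≤ x ^ 3 := by have := xc 3; norm_num at this ⊢; exact this
  have x64 : (64 : ℝ) ≤ x ^ 6 := by have := xc 6; norm_num at this ⊢; exact this
  have x2048 : (2048 : ℝ) ≤ x ^ 11 := by have := xc 11; norm_num at this ⊢; exact this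
  have xr1 : (r : ℝ) + 1 ≤ x ^ 2 := add_le_pow hx2 xr x1
  have hκ0 : 0 < κ := by rw [hκ]; positivity
  have hη0 : 0 < η := by rw [hη]; positivity
  have xκ : κ⁻¹ ≤ x ^ 7 := by
    have : κ⁻¹ = 64 * δ⁻¹ := by rw [hκ]; field_simp
    rw [this]; exact mul_le_pow hx2 x64 xδ (by positivity)
  have xκ3 : (κ⁻¹) ^ 3 ≤ x ^ 21 := by
    have := pow_le_pow_left₀ (by positivity) xκ 3
    rwa [← pow_mul] at this
  have xηi : η⁻¹ ≤ x ^ 39 := by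
    have : η⁻¹ = ((2 ^ 14 * (r + 1)) * (κ⁻¹) ^ 3) * (δ⁻¹ * δ⁻¹) := by rw [hη]; field_simp
    rw [this]
    exact mul_le_pow hx2 (mul_le_pow hx2 (mul_le_pow hx2 (xc 14) xr1 (by positivity)) xκ3
      (by positivity)) (mul_le_pow hx2 xδ xδ (by positivity)) (by positivity)
  have xJ₀ : (J₀ : ℝ) ≤ x ^ 36 := by
    have : 2048 * ((r : ℝ) + 1) / (κ ^ 3 * δ) = 2048 * (r + 1) * (κ⁻¹) ^ 3 * δ⁻¹ := by field_simp
    rw [this] at hJ₀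
    exact hJ₀.trans (add_le_pow hx2 (mul_le_pow hx2 (mul_le_pow hx2 (mul_le_pow hx2 x2048 xr1
      (by positivity)) xκ3 (by positivity)) xδ (by positivity)) x1)
  have xJ : (J : ℝ) ≤ x ^ 36 := le_trans (by exact_mod_cast hJ) xJ₀
  have xq₀ : (q₀ : ℝ) ≤ x ^ 42 :=
    hq₀.trans (by
      rw [div_eq_mul_inv]
      exact add_le_pow hx2 (mul_le_pow hx2 x4 xηi (by positivity)) x1)
  have xM : (M : ℝ) ≤ x ^ 43 := by
    rw [hM]; push_cast
    exact add_le_pow hx2 (mul_le_pow hx2 xr (add_le_pow hx2 xJ x1) (by positivity)) xq₀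
  have xM1 : (M : ℝ) + 1 ≤ x ^ 44 := add_le_pow hx2 xM x1
  have xM2 : (M : ℝ) + 2 ≤ x ^ 44 := add_le_pow hx2 xM x2
  have x7 : (7 : ℝ) ≤ x ^ 3 := by linarith
  have xF : Fmax ≤ x ^ 84 := by
    rw [hF]
    exact add_le_pow hx2 (mul_le_pow hx2 xd xM1 (by positivity))
      (mul_le_pow hx2 xJ (mul_le_pow hx2 x7 xM1 (by positivity)) (by positivity))
  have hF0 : 0 ≤ Fmax := by rw [hF]; positivity
  have x3 : (3 : ℝ) ≤ x ^ 3 := by linarith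
  have xq : (q : ℝ) ≤ x ^ 126 := hq.trans (by
    rw [div_eq_mul_inv]
    exact add_le_pow hx2 (mul_le_pow hx2 (mul_le_pow hx2 x4 xF hF0) xηi (by positivity)) x3)
  have xΔ : Δ ≤ x ^ 216 := by
    rw [hΔ]; push_cast
    exact le_pow_of_le hx2 (add_le_pow hx2 (mul_le_pow hx2 (add_le_pow hx2 (add_le_pow hx2
      (mul_le_pow hx2 (add_le_pow hx2 xk x1) xq (by positivity)) xr) xq) xF hF0)
      (mul_le_pow hx2 (add_le_pow hx2 (mul_le_pow hx2 x2 (add_le_pow hx2 (add_le_pow hx2 xr x2) xq)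
        (by positivity)) x8) xM1 (by positivity))) (by norm_num)
  have hΔ0 : 0 ≤ Δ := by rw [hΔ]; positivity
  have xh0 : h0 ≤ x ^ 90 := by
    rw [hh0]
    exact add_le_pow hx2 xd (mul_le_pow hx2 (mul_le_pow hx2 xM2 xd (by positivity)) xM1
      (by positivity))
  have xH : Hmax ≤ x ^ 253 := by
    rw [hH]; exact add_le_pow hx2 xh0 (mul_le_pow hx2 xJ xΔ hΔ0)
  push_cast
  exact le_pow_of_le hx2 (add_le_pow hx2 xH (mul_le_pow hx2 (add_le_pow hx2 (mul_le_pow hx2 xk xq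
    (by positivity)) x2) xF hF0)) (by norm_num)

/-! ### The theorem at a point of the sample space -/

/-- Passing from `T₀` to a later set of a system costs little in total variation. -/
lemma GSystem.exists_tauClosed_subset {G : Type u} [AddCommGroup G] (z : G) {Z : Finset G}
    {T : GSystem G} {τ η : ℝ} {M : ℕ} (hτ0 : 0 < τ) (hτ1 : τ ≤ 1) (hη0 : 0 < η) (hη1 : η ≤ 1)
    (hZ : TauClosed τ (Z : Set G) (T.set 0)) (hM : 4 / η ≤ M) :
    ∃ Z' : Finset G, TauClosed η (Z' : Set G) (T.set M) ∧
      ∀ f : G → ℝ, (∀ x, |f x| ≤ 1) →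
        |(𝔼 w ∈ Z', f (z + w)) - 𝔼 w ∈ Z, f (z + w)| ≤ 2 * τ / (1 + τ) := by
  classical
  obtain ⟨hZN, hTN, Zm, hZm, Zp, hZp, hmZ, hZZp, hcard⟩ := hZ
  have hmZ' : Zm ⊆ (Z : Set G) := fun x hx => hmZ ⟨x, hx, 0, T.zero_mem 0, by simp⟩
  have hZp' : (Z : Set G) ⊆ Zp := fun x hx => hZZp ⟨x, hx, 0, T.zero_mem 0, by simp⟩
  have hZc : (Z.card : ℝ) ≤ (1 + τ) * Zm.ncard := by
    refine le_trans ?_ hcard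
    rw [← Set.ncard_coe_finset]
    exact_mod_cast Set.ncard_le_ncard hZp' hZp.1
  have hTfin := T.finite_of_finite hTN.1
  have hM0 : M ≠ 0 := by
    rintro rfl
    have : 0 < 4 / η := by positivity
    simp at hM
    linarith
  obtain ⟨n, hn⟩ := Nat.exists_eq_succ_of_ne_zero hM0
  -- The regular set is sought between `Zm` and `Z`, whose sizes differ by a factor of at most `1 +
  -- τ ≤ 2`; hence `F = 1`.
  obtain ⟨Z', hmZ1, hZ'Z, hZ'⟩ := exists_tauClosed_thicken (X := Zm) (W := T.set M)
    (Y := (Z : Set G)) (L := 2 ^ n) (F := 1) (η := η) hZm (T.mem_Nbhd (hTfin M)) Z.finite_toSet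
    (by
      refine (thicken_subset_add _ _ _).trans ((Set.add_subset_add_left ?_).trans hmZ)
      have := T.thicken_zero_subset M 0 (l := 2 * 2 ^ n) (by
        rw [hn, Nat.succ_eq_add_one, pow_succ'])
      rwa [Nat.zero_add] at this)
    hη0 hη1 (by
      have h1 := hM
      have h3 : (M : ℝ) ≤ 2 ^ M := by exact_mod_cast (Nat.lt_two_pow_self (n := M)).le
      have h4 : (2 : ℝ) ^ M = 2 * 2 ^ n := by rw [hn, Nat.succ_eq_add_one, pow_succ']
      rw [div_le_iff₀ hη0] at h1
      push_cast
      nlinarith) (by positivity) (by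
      rw [Real.rpow_one, Set.ncard_coe_finset]
      have : (0 : ℝ) ≤ Zm.ncard := by positivity
      nlinarith)
  have hZ'fin : Z'.Finite := hZ'.1.1
  lift Z' to Finset G using hZ'fin
  have hZ'Z : Z' ⊆ Z := by exact_mod_cast hZ'Z
  refine ⟨Z', hZ', fun f hf => ?_⟩
  refine (abs_expect_subset_sub_le hZ'Z hZ'.nonempty fun x => hf _).trans ?_
  have hc0 : (0 : ℝ) < Z.card := by exact_mod_cast (hZ'.nonempty.mono hZ'Z).card_pos
  have h1 : (Zm.ncard : ℝ) ≤ Z'.card := by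
    rw [← Set.ncard_coe_finset]
    exact_mod_cast Set.ncard_le_ncard hmZ1 Z'.finite_toSet
  have h3 : 1 / (1 + τ) ≤ (Z'.card : ℝ) / Z.card := by
    rw [div_le_div_iff₀ (by positivity) hc0]
    nlinarith
  have h4 : 2 * τ / (1 + τ) = 2 * (1 - 1 / (1 + τ)) := by field_simp; ring
  rw [h4]
  linarith

lemma two_mul_div_one_add_le' {τ δ : ℝ} (hτ0 : 0 < τ) (hδ : 0 < δ) (hδ1 : δ ≤ 1)
    (hτδ : τ ≤ δ ^ 3) : 2 * τ / (1 + τ) ≤ δ := by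
  rw [div_le_iff₀ (by positivity)]
  have : τ * (2 - δ) ≤ δ ^ 3 * (2 - δ) := mul_le_mul_of_nonneg_right hτδ (by linarith)
  have h5 : δ ^ 2 * (2 - δ) ≤ 1 := by nlinarith [sq_nonneg (1 - δ)]
  nlinarith

lemma two_mul_div_one_add_le {τ δ : ℝ} (hτ0 : 0 < τ) (hδ : 0 < δ) (hδ1 : δ ≤ 1 / 2)
    (hτδ : τ ≤ δ ^ 3) : 2 * τ / (1 + τ) ≤ δ / 2 := by
  rw [div_le_iff₀ (by positivity)]
  have : δ ^ 3 ≤ δ / 4 := by nlinarith [mul_pos hδ hδ]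
  nlinarith

/-- For `δ > 1 / 2` the bound `1 / 2` is enough everywhere. Otherwise flagged and unflagged indices
contribute at most `δ / 2` each. -/
lemma sum_mul_le_of_bad {I : Type*} [Fintype I] {p b D : I → ℝ} {δ : ℝ} (hp0 : ∀ i, 0 ≤ p i)
    (hp1 : ∑ i, p i = 1) (hδ : 0 ≤ δ) (hb : ∀ i, b i = 1 ∨ b i = 0)
    (hS : ¬ 1 / 2 < δ → ∑ i, p i * b i ≤ δ / 2) (hD : ∀ i, D i ≤ 1 / 2)
    (hD' : ∀ i, b i = 0 → D i ≤ δ / 2) : ∑ i, p i * D i ≤ δ := by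
  by_cases h : 1 / 2 < δ
  · calc ∑ i, p i * D i ≤ ∑ i, p i * (1 / 2) :=
          Finset.sum_le_sum fun i _ => mul_le_mul_of_nonneg_left (hD i) (hp0 i)
      _ = 1 / 2 := by rw [← Finset.sum_mul, hp1, one_mul]
      _ ≤ δ := h.le
  · have h1 := hS h
    calc ∑ i, p i * D i ≤ ∑ i, (p i * (δ / 2) + p i * b i) := by
          refine Finset.sum_le_sum fun i _ => ?_
          rw [← mul_add]
          refine mul_le_mul_of_nonneg_left ?_ (hp0 i)
          rcases hb i with hb | hb
          · rw [hb]; linarith [hD i]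
          · rw [hb]; linarith [hD' i hb]
      _ = δ / 2 + ∑ i, p i * b i := by
          rw [Finset.sum_add_distrib, ← Finset.sum_mul, hp1, one_mul]
      _ ≤ δ := by linarith

lemma exists_leaves_of_tauClosed {G : Type u} [AddCommGroup G] (h2 : ∀ x : G, 2 • x = 0 → x = 0)
    {a : G → ℝ} (ha0 : ∀ x, 0 ≤ a x) (ha1 : ∀ x, a x ≤ 1) (z : G) {Z : Finset G} {T : GSystem G}
    {d τ δ : ℝ} {k r : ℕ} (hd : 1 ≤ d) (hτ0 : 0 < τ) (hδ : 0 < δ) (hδ1 : δ ≤ 1) (hk : 1 ≤ k)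
    (hdk : 2 ≤ d * k) (hr : 1 ≤ r) (hdim : T.dim ≤ (d : EReal))
    (hZ : TauClosed τ (Z : Set G) (T.set 0)) (hτ : (δ⁻¹ * r) ^ 400 < τ⁻¹) :
    ∃ (I : Type u) (_ : Fintype I) (p : I → ℝ) (zz : I → G) (ZZ : I → Finset G)
      (WW : I → ℕ → Finset G), (∀ i, 0 ≤ p i) ∧ ∑ i, p i = 1 ∧
      (∀ i, IsLeaf a δ ((d * k * r * δ⁻¹) ^ 400) k r (T.set 0) (zz i) (ZZ i) (WW i)) ∧
      (∀ f : G → ℝ, (∀ x, |f x| ≤ 1) →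
        |∑ i, p i * (𝔼 w ∈ ZZ i, f (zz i + w)) - 𝔼 w ∈ Z, f (z + w)| ≤ δ) ∧
      (∀ j s, 1 ≤ j → j ≤ k → s ≤ r →
        ∑ i, p i * defectOne a s (zz i) (ZZ i) (WW i j) ≤ δ) ∧
      (∀ j l s, 1 ≤ j → j < l → l ≤ k → s ≤ r →
        ∑ i, p i * defectTwo a s (zz i) (ZZ i) (WW i j) (WW i l) ≤ δ) := by
  classical
  have hr1 : (1 : ℝ) ≤ r := by exact_mod_cast hr
  have hδi : 1 ≤ δ⁻¹ := (one_le_inv₀ hδ).2 hδ1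
  have hτδ : τ ≤ δ ^ 3 := by
    have e1 : (δ⁻¹) ^ 3 ≤ (δ⁻¹ * r) ^ 400 :=
      (pow_le_pow_left₀ (by positivity) (le_mul_of_one_le_right (by positivity) hr1) 3).trans
        (pow_le_pow_right₀ (one_le_mul_of_one_le_of_one_le hδi hr1) (by norm_num))
    rw [← inv_inv τ, ← inv_inv (δ ^ 3)]
    refine inv_anti₀ (by positivity) ?_
    rw [← inv_pow]
    linarith
  have hδ3 : δ ^ 3 ≤ 1 := pow_le_one₀ hδ.le hδ1
  -- Chosen so that the uniformity threshold `32 * κ` equals `δ / 2`.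
  obtain ⟨κ, hκ⟩ : ∃ x : ℝ, x = δ / 64 := ⟨_, rfl⟩
  have hκ0 : 0 < κ := by rw [hκ]; positivity
  have hκ1 : κ ≤ 1 := by linarith
  have hκ3 : κ ^ 3 ≤ 1 := pow_le_one₀ hκ0.le hκ1
  -- Small enough for the increment step, and such that `J₀` rounds cost at most `2 * J₀ * η ≤ δ /
  -- 2` in total variation.
  obtain ⟨η, hη⟩ : ∃ x : ℝ, x = κ ^ 3 * δ ^ 2 / (2 ^ 14 * (r + 1)) := ⟨_, rfl⟩
  have hη0 : 0 < η := by rw [hη]; positivity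
  have hr0 : (0 : ℝ) < 2 ^ 14 * (r + 1) := by positivity
  have hηr : 2 ^ 14 * (r + 1) * η = κ ^ 3 * δ ^ 2 := by rw [hη]; field_simp
  have hδ2 : δ ^ 2 ≤ δ := by nlinarith
  have hκδ : κ ^ 3 * δ ^ 2 ≤ δ := by nlinarith [sq_nonneg δ]
  have hrη : 0 ≤ r * η := by positivity
  have hκδ2 : κ ^ 3 * δ ^ 2 ≤ κ ^ 3 := mul_le_of_le_one_right (by positivity) (by nlinarith)
  have hηκ : 10000 * (r + 1) * η ≤ κ ^ 3 := by nlinarith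
  have hηδ : η ≤ δ := by nlinarith
  have hη1 : η ≤ 1 := hηδ.trans hδ1
  -- After `J₀` rounds the flagged mass is at most `1024 * (r + 1) / (κ ^ 3 * J₀) ≤ δ / 2`.
  obtain ⟨J₀, hJ₀⟩ : ∃ x : ℕ, x = ⌈2048 * (r + 1) / (κ ^ 3 * δ)⌉₊ := ⟨_, rfl⟩
  have hJ₀1 : (J₀ : ℝ) ≤ 2048 * (r + 1) / (κ ^ 3 * δ) + 1 :=
    by
    rw [hJ₀]; exact (Nat.ceil_lt_add_one (by positivity)).le
  have hJ₀2 : 2048 * ((r : ℝ) + 1) ≤ J₀ * (κ ^ 3 * δ) := by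
    rw [← div_le_iff₀ (by positivity), hJ₀]; exact Nat.le_ceil _
  obtain ⟨J, hJ⟩ : ∃ x : ℕ, x = if 1 / 2 < δ then 0 else J₀ := ⟨_, rfl⟩
  have hJJ₀ : J ≤ J₀ := by rw [hJ]; split_ifs <;> simp
  obtain ⟨q₀, hq₀⟩ : ∃ x : ℕ, x = ⌈4 / η⌉₊ := ⟨_, rfl⟩
  have hq₀1 : (q₀ : ℝ) ≤ 4 / η + 1 := by
    rw [hq₀]; exact (Nat.ceil_lt_add_one (by positivity)).le
  -- The first summand provides the dilates for all rounds, the second makes `T.set M` fine enough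
  -- for `Z` to be made regular.
  obtain ⟨M, hM⟩ : ∃ x : ℕ, x = r * (J + 1) + q₀ := ⟨_, rfl⟩
  obtain ⟨Fmax, hF⟩ : ∃ x : ℝ, x = d * (M + 1) + J * (7 * (M + 1)) := ⟨_, rfl⟩
  have hF0 : 0 ≤ Fmax := by rw [hF]; positivity
  obtain ⟨q, hq⟩ : ∃ x : ℕ, x = ⌈4 * Fmax / η⌉₊ + 2 := ⟨_, rfl⟩
  have hq1 : (q : ℝ) ≤ 4 * Fmax / η + 3 := by
    rw [hq]; push_cast
    linarith [(Nat.ceil_lt_add_one (a := 4 * Fmax / η) (by positivity)).le]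
  have hq2 : 4 * Fmax / η ≤ 2 ^ q := by
    have h1 : (⌈4 * Fmax / η⌉₊ : ℝ) ≤ q := by rw [hq]; push_cast; linarith
    have h3 : (q : ℝ) ≤ 2 ^ q := by exact_mod_cast (Nat.lt_two_pow_self (n := q)).le
    exact (Nat.le_ceil _).trans (h1.trans h3)
  obtain ⟨Δ, hΔ⟩ : ∃ x : ℝ, x = (((k + 1) * q + r + q : ℕ) : ℝ) * Fmax +
    (2 * ((r + 2 + q : ℕ) : ℝ) + 8) * (M + 1) := ⟨_, rfl⟩
  obtain ⟨h0, hh0⟩ : ∃ x : ℝ, x = d + (M + 2) * d * (M + 1) := ⟨_, rfl⟩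
  obtain ⟨Hmax, hH⟩ : ∃ x : ℝ, x = h0 + J * Δ := ⟨_, rfl⟩
  have hbound := param_bound hd hδ hδ1 hk hr hdk hκ hη hJ₀1 hJJ₀ hq₀1 hM hF hq1 hΔ hh0 hH
  have hTN := hZ.2.1
  obtain ⟨Z', hZ', hdist⟩ := GSystem.exists_tauClosed_subset z hτ0 (hτδ.trans hδ3) hη0 hη1 hZ (M := M) (by
    rw [hM, Nat.cast_add]
    have : 4 / η ≤ q₀ := by rw [hq₀]; exact Nat.le_ceil _
    have h0 : (0 : ℝ) ≤ ((r * (J + 1) : ℕ) : ℝ) := Nat.cast_nonneg _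
    linarith)
  have hctrl := GSystem.ctrl_shift h2 T hTN.1 (by linarith) (cov_of_dim_le hdim) M
  obtain ⟨I, hI, p, zz, ZZ, WW, b, hp0, hp1, hleaf, htv, hb, hbad⟩ :=
    exists_leaves (a := a) (η := η) (κ := κ) (Fmax := Fmax) (Hmax := Hmax) (Δ := Δ) (k := k)
      (r := r) (q := q) (M := M) (T := T.set 0) h2 ha0 ha1 hη0 hκ0 hκ1 hηκ hq2 (by omega) hΔ hF0 J
      z Z' (T.shift M) (d * (M + 1)) h0 (by omega) hZ'
      (hctrl.mono (by omega) le_rfl hh0.ge) hF.ge hH.ge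
  have hle : ∀ i, IsLeaf a δ ((d * k * r * δ⁻¹) ^ 400) k r (T.set 0) (zz i) (ZZ i) (WW i) :=
    fun i => (hleaf i).mono hηδ hbound
  have hJ1 : 1 / 2 < δ → (J : ℝ) = 0 := fun h => by rw [hJ, if_pos h]; simp
  have hJ2 : ¬ 1 / 2 < δ → J = J₀ := fun h => by rw [hJ, if_neg h]
  have hS : ¬ 1 / 2 < δ → ∑ i, p i * b i ≤ δ / 2 := by
    intro h
    rw [hJ2 h] at hbad
    have h1 : 0 ≤ ∑ s ∈ Finset.range (r + 1), dilDens a s z Z' ^ 2 :=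
      Finset.sum_nonneg fun _ _ => sq_nonneg _
    by_contra hcon
    push Not at hcon
    have hJpos : 0 < κ ^ 3 * J₀ := by
      have : 0 < J₀ * (κ ^ 3 * δ) := lt_of_lt_of_le (by positivity) hJ₀2
      refine (mul_pos_iff_of_pos_right hδ).1 (this.trans_eq (by ring))
    have h3 := mul_lt_mul_of_pos_left hcon hJpos
    nlinarith
  have hdefect : ∀ D : I → ℝ, (∀ i, D i ≤ 1 / 2) → (∀ i, b i = 0 → D i ≤ 32 * κ) →
      ∑ i, p i * D i ≤ δ := fun D hD hD' =>
    sum_mul_le_of_bad hp0 hp1 hδ.le (fun i => (hb i).imp_right And.left) hS hD fun i hi =>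
      (hD' i hi).trans (by linarith)
  have hunif : ∀ i, b i = 0 → IsUniform a (32 * κ) k r (zz i) (ZZ i) (WW i) := fun i hbi => by
    rcases hb i with h | h
    · rw [hbi] at h; norm_num at h
    · exact h.2
  refine ⟨I, hI, p, zz, ZZ, WW, hp0, hp1, hle, fun f hf => ?_, fun j s hj hjk hs => ?_,
    fun j l s hj hjl hl hs => ?_⟩
  · have e1 := abs_sub_le (∑ i, p i * 𝔼 w ∈ ZZ i, f (zz i + w)) (𝔼 w ∈ Z', f (z + w))
      (𝔼 w ∈ Z, f (z + w))
    have e2 := htv f hf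
    have e3 := hdist f hf
    by_cases h : 1 / 2 < δ
    · rw [hJ1 h] at e2
      have e4 := two_mul_div_one_add_le' hτ0 hδ hδ1 hτδ
      linarith
    · rw [hJ2 h] at e2
      have e4 := two_mul_div_one_add_le hτ0 hδ (not_lt.1 h) hτδ
      have e5 : 2 * J₀ * η ≤ δ / 2 := by
        have h6 : (J₀ : ℝ) ≤ 2 ^ 12 * (r + 1) / (κ ^ 3 * δ) := by
          refine hJ₀1.trans ?_
          rw [div_add_one (by positivity)]
          refine div_le_div_of_nonneg_right ?_ (by positivity)
          have : κ ^ 3 * δ ≤ 1 := mul_le_one₀ hκ3 hδ.le hδ1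
          linarith
        have h7 : 2 * (2 ^ 12 * (r + 1) / (κ ^ 3 * δ)) * η = δ / 2 := by
          rw [hη]; field_simp
        rw [← h7]
        exact mul_le_mul_of_nonneg_right (by linarith) hη0.le
      linarith
  · exact hdefect _ (fun i => (hle i).one j s hs) fun i hbi => (hunif i hbi).one j s hj hjk hs
  · exact hdefect _ (fun i => (hle i).two j l s hjl hs) fun i hbi =>
      (hunif i hbi).two j l s hj hjl hl hs

/-! ### Finitely supported probability spaces -/

section Probability

variable {Ω Ω' : Type v} {P : PMF Ω} {P' : PMF Ω'}

lemma expect_eq_sum (hP : P.support.Finite) (f : Ω → ℝ) :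
    expect P f = ∑ ω ∈ hP.toFinset, (P ω).toReal * f ω :=
  tsum_eq_sum fun ω hω => by
    have : P ω = 0 := by simpa using hω
    simp [this]

lemma sum_toReal_eq_one (hP : P.support.Finite) : ∑ ω ∈ hP.toFinset, (P ω).toReal = 1 := by
  have : ∑' ω, P ω = ∑ ω ∈ hP.toFinset, P ω := tsum_eq_sum fun ω hω => by simpa using hω
  rw [← ENNReal.toReal_sum fun ω _ => P.apply_ne_top ω, ← this, P.tsum_coe, ENNReal.toReal_one]

lemma expect_le_of_forall_le (hP : P.support.Finite) {f : Ω → ℝ} {c : ℝ} (h : ∀ ω, f ω ≤ c) :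
    expect P f ≤ c := by
  rw [expect_eq_sum hP, ← one_mul c, ← sum_toReal_eq_one hP, Finset.sum_mul]
  exact Finset.sum_le_sum fun ω _ => mul_le_mul_of_nonneg_left (h ω) ENNReal.toReal_nonneg

lemma abs_expect_sub_expect_le_of_forall (hP : P.support.Finite) {f g : Ω → ℝ} {c : ℝ}
    (h : ∀ ω, |f ω - g ω| ≤ c) : |expect P f - expect P g| ≤ c := by
  refine le_trans ?_ (expect_le_of_forall_le hP h)
  rw [expect_eq_sum hP, expect_eq_sum hP, expect_eq_sum hP, ← Finset.sum_sub_distrib]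
  refine (Finset.abs_sum_le_sum_abs _ _).trans (Finset.sum_le_sum fun ω _ => ?_)
  rw [← mul_sub, abs_mul, abs_of_nonneg ENNReal.toReal_nonneg]

/-- The probability space obtained by choosing a point `ω` of `P` and then an index `i` according
to the weights `p ω`. -/
lemma exists_sigma_extension (hP : P.support.Finite) {I : Ω → Type v} [∀ ω, Fintype (I ω)]
    {p : ∀ ω, I ω → ℝ} (hp0 : ∀ ω i, 0 ≤ p ω i) (hp1 : ∀ ω, ∑ i, p ω i = 1) :
    ∃ Q : PMF (Σ ω, I ω), Q.support.Finite ∧ IsExtension Q P Sigma.fst ∧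
      ∀ f : (Σ ω, I ω) → ℝ, expect Q f = expect P (fun ω => ∑ i, p ω i * f ⟨ω, i⟩) := by
  classical
  let q : ∀ ω, PMF (I ω) := fun ω => PMF.ofFintype (fun i => ENNReal.ofReal (p ω i)) (by
    rw [← ENNReal.ofReal_sum_of_nonneg fun i _ => hp0 ω i, hp1, ENNReal.ofReal_one])
  let Q : PMF (Σ ω, I ω) := P.bind fun ω => (q ω).map (Sigma.mk ω)
  have hQ : ∀ ω i, Q ⟨ω, i⟩ = P ω * ENNReal.ofReal (p ω i) := by
    intro ω i
    change (P.bind fun ω => (q ω).map (Sigma.mk ω)) ⟨ω, i⟩ = _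
    rw [PMF.bind_apply, tsum_eq_single ω]
    · rw [PMF.map_apply, tsum_eq_single i]
      · simp [q]
      · intro j hj
        rw [if_neg]
        intro h
        exact hj (eq_of_heq (Sigma.mk.inj h).2).symm
    · intro ω' hω'
      rw [PMF.map_apply]
      have : ∀ j, ¬ (⟨ω, i⟩ : Σ ω, I ω) = ⟨ω', j⟩ := fun j h => hω' (Sigma.mk.inj h).1.symm
      simp [this]
  have hfin : Q.support.Finite := by
    refine (hP.toFinset.sigma fun ω => (Finset.univ : Finset (I ω))).finite_toSet.subset ?_
    rintro ⟨ω, i⟩ h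
    rw [PMF.mem_support_iff, hQ] at h
    simpa using left_ne_zero_of_mul h
  refine ⟨Q, hfin, fun E => ?_, fun f => ?_⟩
  · rw [← PMF.toOuterMeasure_map_apply]
    congr 2
    change (P.bind fun ω => (q ω).map (Sigma.mk ω)).map Sigma.fst = P
    rw [PMF.map_bind]
    have : ∀ ω, ((q ω).map (Sigma.mk ω)).map Sigma.fst = PMF.pure ω := fun ω => by
      rw [PMF.map_comp]
      exact PMF.map_const _ _
    simp only [this, PMF.bind_pure]
  · have hs : expect Q f =
        ∑ x ∈ hP.toFinset.sigma fun ω => (Finset.univ : Finset (I ω)), (Q x).toReal * f x := by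
      refine tsum_eq_sum ?_
      rintro ⟨ω, i⟩ h
      have : P ω = 0 := by simpa using h
      simp [hQ, this]
    rw [hs, Finset.sum_sigma, expect_eq_sum hP]
    refine Finset.sum_congr rfl fun ω _ => ?_
    rw [Finset.mul_sum]
    refine Finset.sum_congr rfl fun i _ => ?_
    rw [hQ, ENNReal.toReal_mul, ENNReal.toReal_ofReal (hp0 ω i), mul_assoc]

end Probability

/-! ### Averages over finite sets -/

section Averages

variable {G : Type u}

lemma tsum_mul_unif_eq_sum {S : Finset G} (f : G → ℝ) :
    ∑' x, f x * unif (S : Set G) x = 𝔼 x ∈ S, f x := by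
  rw [tsum_eq_sum (s := S), Finset.expect_eq_sum_div_card, Finset.sum_div]
  · refine Finset.sum_congr rfl fun x hx => ?_
    rw [unif, Set.indicator_of_mem (by exact_mod_cast hx), Set.ncard_coe_finset, div_eq_mul_inv]
  · intro x hx
    rw [unif, Set.indicator_of_notMem (by exact_mod_cast hx), mul_zero]

lemma tsum_mul_unif_image {Z : Finset G} {g : G → G} (hg : g.Injective) (f : G → ℝ) :
    ∑' x, f x * unif (g '' Z) x = 𝔼 w ∈ Z, f (g w) := by
  classical
  rw [← Finset.coe_image, tsum_mul_unif_eq_sum, Finset.expect_eq_sum_div_card,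
    Finset.expect_eq_sum_div_card, Finset.sum_image hg.injOn, Finset.card_image_of_injective _ hg]

lemma dens_eq_tsum {S : Set G} (hS : S.Finite) (A : Set G) :
    dens S A = ∑' x, A.indicator 1 x * unif S x := by
  classical
  lift S to Finset G using hS
  rw [tsum_mul_unif_eq_sum, Finset.expect_eq_sum_div_card, dens, Set.ncard_coe_finset]
  congr 1
  have : A ∩ (S : Set G) = ((S.filter (· ∈ A) : Finset G) : Set G) := by ext; simp [and_comm]
  rw [this, Set.ncard_coe_finset, Finset.card_filter]
  push_cast
  exact Finset.sum_congr rfl fun x _ => by simp [Set.indicator_apply]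

lemma tsum_mul_meanUnif {Ω : Type v} {P : PMF Ω} (hP : P.support.Finite) {S : Ω → Set G}
    (hS : ∀ ω, (S ω).Finite) (f : G → ℝ) :
    ∑' x, f x * meanUnif P S x = expect P fun ω => ∑' x, f x * unif (S ω) x := by
  have hsupp : ∀ ω, (Function.support fun x => f x * unif (S ω) x).Finite := fun ω =>
    (hS ω).subset fun x hx => by
      by_contra h
      exact hx (by simp [unif, h])
  simp only [meanUnif, expect_eq_sum hP, Finset.mul_sum]
  rw [Summable.tsum_finsetSum]
  · refine Finset.sum_congr rfl fun ω _ => ?_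
    rw [← tsum_mul_left]
    exact tsum_congr fun x => by ring
  · intro ω _
    refine ((summable_of_hasFiniteSupport (hsupp ω)).mul_left (P ω).toReal).congr fun x => ?_
    ring

lemma support_meanUnif_finite {Ω : Type v} {P : PMF Ω} (hP : P.support.Finite) {S : Ω → Set G}
    (hS : ∀ ω, (S ω).Finite) : (Function.support (meanUnif P S)).Finite := by
  refine (hP.toFinset.finite_toSet.biUnion fun ω _ => hS ω).subset fun x hx => ?_
  by_contra h
  refine hx ?_
  rw [meanUnif, expect_eq_sum hP]
  refine Finset.sum_eq_zero fun ω hω => ?_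
  have : x ∉ S ω := fun hx => h (Set.mem_biUnion hω hx)
  simp [unif, this]

/-- The total variation norm of a difference of mean uniform measures, by duality. -/
lemma tvNorm_meanUnif_sub_le {Ω Ω' : Type v} {P : PMF Ω} {P' : PMF Ω'} (hP : P.support.Finite)
    (hP' : P'.support.Finite) {S : Ω → Set G} {S' : Ω' → Set G} (hS : ∀ ω, (S ω).Finite)
    (hS' : ∀ ω, (S' ω).Finite) {δ : ℝ}
    (h : ∀ f : G → ℝ, (∀ x, |f x| ≤ 1) →
      |(expect P' fun ω => ∑' x, f x * unif (S' ω) x) -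
        expect P fun ω => ∑' x, f x * unif (S ω) x| ≤ δ) :
    tvNorm (meanUnif P' S' - meanUnif P S) ≤ δ := by
  set μ := meanUnif P' S' - meanUnif P S with hμ
  let f : G → ℝ := fun x => SignType.sign (μ x)
  have hf : ∀ x, |f x| ≤ 1 := fun x => by
    rcases lt_trichotomy (μ x) 0 with hx | hx | hx <;> simp [f, hx]
  have hsum : ∀ {Ω : Type v} {P : PMF Ω} {S : Ω → Set G}, P.support.Finite → (∀ ω, (S ω).Finite) →
      Summable fun x => f x * meanUnif P S x := fun hP hS =>
    summable_of_hasFiniteSupport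
      ((support_meanUnif_finite hP hS).subset fun x hx => right_ne_zero_of_mul hx)
  refine le_trans (le_of_eq ?_) ((le_abs_self _).trans (h f hf))
  rw [← tsum_mul_meanUnif hP hS, ← tsum_mul_meanUnif hP' hS',
    ← (hsum hP' hS').tsum_sub (hsum hP hS)]
  refine tsum_congr fun x => ?_
  rw [← mul_sub, ← Pi.sub_apply, ← hμ]
  exact (sign_mul_self (μ x)).symm

end Averages

/-! ### The main theorem -/

section Translation

variable {G : Type u} [AddCommGroup G]

lemma vadd_eq_image (x : G) (Z : Finset G) : x +ᵥ (Z : Set G) = (fun w => x + w) '' (Z : Set G) :=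
  rfl

lemma tsum_mul_unif_vadd (x : G) (Z : Finset G) (f : G → ℝ) :
    ∑' y, f y * unif (x +ᵥ (Z : Set G)) y = 𝔼 w ∈ Z, f (x + w) := by
  rw [vadd_eq_image, tsum_mul_unif_image (add_right_injective x)]

lemma tsum_mul_unif_dilate (h2 : ∀ x : G, 2 • x = 0 → x = 0) (s : ℕ) (x : G) (Z : Finset G)
    (f : G → ℝ) :
    ∑' y, f y * unif (dilate (2 ^ s) (x +ᵥ (Z : Set G))) y = 𝔼 w ∈ Z, f (2 ^ s • (x + w)) := by
  rw [vadd_eq_image, dilate, Set.image_image]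
  exact tsum_mul_unif_image ((two_pow_nsmul_injective h2 s).comp (add_right_injective x)) f

lemma finite_vadd (x : G) (Z : Finset G) : (x +ᵥ (Z : Set G)).Finite :=
  Z.finite_toSet.image _

lemma finite_dilate_vadd (s : ℕ) (x : G) (Z : Finset G) :
    (dilate (2 ^ s) (x +ᵥ (Z : Set G))).Finite :=
  (finite_vadd x Z).image _

lemma dens_vadd (x : G) (Z : Finset G) (A : Set G) :
    dens (x +ᵥ (Z : Set G)) A = 𝔼 v ∈ Z, A.indicator 1 (x + v) := by
  rw [dens_eq_tsum (finite_vadd x Z), tsum_mul_unif_vadd]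

lemma dens_dilate (h2 : ∀ x : G, 2 • x = 0 → x = 0) (s : ℕ) (x : G) (Z : Finset G) (A : Set G) :
    dens (dilate (2 ^ s) (x +ᵥ (Z : Set G))) A = dilDens (A.indicator 1) s x Z := by
  rw [dens_eq_tsum (finite_dilate_vadd s x Z), tsum_mul_unif_dilate h2, dilDens]

open scoped Classical in
-- Both factors are centred at `c`, so the convolution is evaluated about `2 • c`, which for `c = 2
-- ^ s • x` is `2 ^ (s + 1) • x`.
lemma convMeas_vadd (A : Set G) (c t : G) (W V : Finset G) :
    convMeas ((A ∩ (c +ᵥ (W : Set G))).indicator (fun _ => 1))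
      (A.indicator (unif (c +ᵥ (V : Set G)))) (2 • c + t) =
    𝔼 v ∈ V, if t - v ∈ W then
      A.indicator (1 : G → ℝ) (c + t - v) * A.indicator (1 : G → ℝ) (c + v) else 0 := by
  have h1 : ∀ y, (A ∩ (c +ᵥ (W : Set G))).indicator (fun _ => (1 : ℝ)) (2 • c + t - y) *
      A.indicator (unif (c +ᵥ (V : Set G))) y =
      ((A ∩ (c +ᵥ (W : Set G))).indicator (fun _ => (1 : ℝ)) (2 • c + t - y) *
        A.indicator (1 : G → ℝ) y) * unif (c +ᵥ (V : Set G)) y := fun y => by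
    by_cases hy : y ∈ A <;> simp [hy]
  rw [convMeas, tsum_congr h1, tsum_mul_unif_vadd c V fun y =>
    (A ∩ (c +ᵥ (W : Set G))).indicator (fun _ => (1 : ℝ)) (2 • c + t - y) *
        A.indicator (1 : G → ℝ) y]
  refine Finset.expect_congr rfl fun v _ => ?_
  have h2 : 2 • c + t - (c + v) = c + t - v := by rw [two_nsmul]; abel
  have h3 : c + t - v ∈ c +ᵥ (W : Set G) ↔ t - v ∈ W := by
    rw [Set.mem_vadd_set_iff_neg_vadd_mem, vadd_eq_add, ← Finset.mem_coe]
    congr! 1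
    abel
  rw [h2]
  by_cases hW : t - v ∈ W <;> by_cases hA : c + t - v ∈ A <;> simp [hW, hA, h3]

lemma l2Sq_convMeas (A : Set G) (s : ℕ) (x : G) (W V : Finset G) (α : ℝ) :
    open scoped Classical in
    l2Sq (2 ^ (s + 1) • x +ᵥ (W : Set G)) (fun y =>
      convMeas ((A ∩ (2 ^ s • x +ᵥ (W : Set G))).indicator (fun _ => 1))
        (A.indicator (unif (2 ^ s • x +ᵥ (V : Set G)))) y - α) =
    𝔼 t ∈ W, ((𝔼 v ∈ V, if t - v ∈ W then
      A.indicator (1 : G → ℝ) (2 ^ s • x + t - v) * A.indicator (1 : G → ℝ) (2 ^ s • x + v)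
        else 0) - α) ^ 2 := by
  rw [l2Sq, tsum_mul_unif_vadd _ W fun y => (convMeas
    ((A ∩ (2 ^ s • x +ᵥ (W : Set G))).indicator (fun _ => 1))
        (A.indicator (unif (2 ^ s • x +ᵥ (V : Set G)))) y - α) ^ 2]
  refine Finset.expect_congr rfl fun t _ => ?_
  rw [pow_succ' 2 s, mul_smul, convMeas_vadd]

end Translation

/-- A uniformly distributed element of a finite set, indexed in an arbitrary universe. -/
lemma sum_ulift_fin_eq_expect {G : Type u} (Z : Finset G) (f : G → ℝ) :
    ∑ i : ULift.{v} (Fin Z.card), (Z.card : ℝ)⁻¹ * f (Z.equivFin.symm i.down) = 𝔼 w ∈ Z, f w := by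
  rw [← Finset.mul_sum, Finset.expect_eq_sum_div_card, div_eq_inv_mul,
    ← Finset.sum_coe_sort Z f]
  congr 1
  exact Fintype.sum_equiv (Equiv.ulift.trans Z.equivFin.symm) _ _ fun i => rfl

lemma coverFlat_le_of_cov {G : Type u} [AddCommGroup G] {S X Y W : Set G} {D : ℝ≥0∞} {h : ℝ}
    (hD : (coverFlat S X : ℝ≥0∞) ≤ D) (h0 : 0 ≤ h) (hXY : Cov (2 ^ h) X Y) (hW : Y - Y ⊆ W) :
    (coverFlat S W : ℝ≥0∞) ≤ D * ENNReal.ofReal (Real.exp h) := by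
  have hpos : ENNReal.ofReal (Real.exp h) ≠ 0 := by simp [Real.exp_pos]
  rcases hN : coverFlat S X with _ | N
  · have : D = ⊤ := by
      rw [hN] at hD
      exact top_le_iff.1 hD
    rw [this, ENNReal.top_mul hpos]
    exact le_top
  · have hN' : coverFlat S X = (N : ℕ∞) := hN
    rw [hN'] at hD
    refine (((cov_of_coverFlat hN'.le).trans hXY).coverFlat_le hW).trans ?_
    rw [ENNReal.ofReal_mul (Nat.cast_nonneg N), ENNReal.ofReal_natCast]
    refine mul_le_mul' (by simpa using hD) (ENNReal.ofReal_le_ofReal ?_)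
    -- Powers of `2` become exponentials because `log 2 ≤ 1`.
    rw [Real.rpow_def_of_pos two_pos]
    refine Real.exp_le_exp.2 (mul_le_of_le_one_left h0 ?_)
    linarith [Real.log_two_lt_d9]

theorem mainTheorem4 :
    ∃ C : ℝ, 0 < C ∧
      ∀ (G : Type u) [AddCommGroup G], (∀ x : G, 2 • x = 0 → x = 0) →
      ∀ (A S : Set G) (Ω : Type v) (P : PMF Ω), P.support.Finite →
      ∀ (z : Ω → G) (Z : Ω → Nbhd G) (T : Ω → GSystem G)
        (d : ℝ) (D : ℝ≥0∞) (τ δ : ℝ) (k r : ℕ),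
        1 ≤ d → 0 < τ → 0 < δ → δ ≤ 1 → 1 ≤ k → 2 ≤ d * (k : ℝ) → 1 ≤ r →
        (∀ ω, (T ω).dim ≤ (d : EReal) ∧
          (coverFlat S ((T ω).set 0) : ℝ≥0∞) ≤ D ∧
          TauClosed τ (Z ω : Set G) ((T ω).set 0)) →
        τ⁻¹ ≤ (δ⁻¹ * (r : ℝ)) ^ C ∨
        ∃ (Ω' : Type v) (P' : PMF Ω') (φ : Ω' → Ω) (z' : Ω' → G) (Z' : Ω' → Nbhd G),
          P'.support.Finite ∧ IsExtension P' P φ ∧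
          tvNorm (meanUnif P' (fun ω' => z' ω' +ᵥ (Z' ω' : Set G))
            - meanUnif P (fun ω => z ω +ᵥ (Z ω : Set G))) ≤ δ ∧
          ∃ (Ω'' : Type v) (P'' : PMF Ω'') (ψ : Ω'' → Ω') (z'' : Ω'' → G)
            (W : ℕ → Ω'' → Nbhd G),
            P''.support.Finite ∧ IsExtension P'' P' ψ ∧
            -- approximation
            (∀ i s : ℕ, 1 ≤ i → i ≤ k → s ≤ r →
              tvNorm (meanUnif P'' (fun ω => (2 ^ s • z'' ω) +ᵥ (W i ω : Set G))
                - meanUnif P' (fun ω' => dilate (2 ^ s) (z' ω' +ᵥ (Z' ω' : Set G)))) ≤ δ) ∧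
            -- first-order uniformity
            (∀ i s : ℕ, 1 ≤ i → i ≤ k → s ≤ r →
              expect P'' (fun ω =>
                |dens ((2 ^ s • z'' ω) +ᵥ (W i ω : Set G)) A
                  - dens (dilate (2 ^ s) (z' (ψ ω) +ᵥ (Z' (ψ ω) : Set G))) A| ^ 2) ≤ δ) ∧
            -- second-order uniformity
            (∀ i j s : ℕ, 1 ≤ i → i < j → j ≤ k → s ≤ r →
              expect P'' (fun ω =>
                l2Sq ((2 ^ (s + 1) • z'' ω) +ᵥ (W i ω : Set G)) (fun x =>
                  convMeas
                    ((A ∩ ((2 ^ s • z'' ω) +ᵥ (W i ω : Set G))).indicator (fun _ => 1))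
                    (A.indicator (unif ((2 ^ s • z'' ω) +ᵥ (W j ω : Set G)))) x
                  - (dens (dilate (2 ^ s) (z' (ψ ω) +ᵥ (Z' (ψ ω) : Set G))) A) ^ 2)) ≤ δ) ∧
            -- closure and covering number, at every point of the sample space
            (∀ ω, (∀ i : ℕ, 1 ≤ i → i < k → TauClosed δ (W i ω : Set G) (W (i + 1) ω : Set G)) ∧
              (coverFlat S (W k ω : Set G) : ℝ≥0∞) ≤
                D * ENNReal.ofReal (Real.exp ((d * (k : ℝ) * (r : ℝ) * δ⁻¹) ^ C))) := by
  classical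
  refine ⟨400, by norm_num, fun G _ h2 A S Ω P hP z Z T d D τ δ k r hd hτ0 hδ hδ1 hk hdk hr
    hT => ?_⟩
  have hpow : ∀ x : ℝ, x ^ (400 : ℝ) = x ^ 400 := fun x => by
    exact_mod_cast Real.rpow_natCast x 400
  rw [hpow, hpow]
  refine or_iff_not_imp_left.2 fun hτ => ?_
  rw [not_le] at hτ
  obtain ⟨h, hh⟩ : ∃ h, h = (d * k * r * δ⁻¹) ^ 400 := ⟨_, rfl⟩
  have hh0 : 0 ≤ h := by rw [hh]; positivity
  set a : G → ℝ := A.indicator 1 with ha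
  have ha0 : ∀ x, 0 ≤ a x := fun x => Set.indicator_nonneg (fun _ _ => zero_le_one) x
  have ha1 : ∀ x, a x ≤ 1 := fun x =>
    Set.indicator_apply_le' (fun _ => le_rfl) fun _ => zero_le_one
  choose Z₀ hZ₀ using fun ω => (Z ω).2.1.exists_finset_coe
  have key := fun ω => exists_leaves_of_tauClosed (k := k) (r := r) (Z := Z₀ ω) h2 ha0 ha1 (z ω)
    hd hτ0 hδ hδ1 hk hdk hr (hT ω).1 (by rw [hZ₀]; exact (hT ω).2.2) hτ
  rw [← hh] at key ⊢
  choose I hI p zz ZZ WW hp0 hp1 hleaf htv hone htwo using key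
  -- The leaf indices live in the universe of `G`, the sample spaces in that of `Ω`, so the finite
  -- index types are replaced by lifted copies of `Fin`.
  let e : ∀ ω, ULift.{v} (Fin (Fintype.card (I ω))) ≃ I ω := fun ω =>
    Equiv.ulift.trans (Fintype.equivFin (I ω)).symm
  have hre : ∀ ω (g : I ω → ℝ), ∑ i, g (e ω i) = ∑ i, g i := fun ω g => (e ω).sum_comp g
  obtain ⟨P', hP', hext, hexp⟩ := exists_sigma_extension hP (p := fun ω i => p ω (e ω i))
    (fun ω i => hp0 ω _) fun ω => by rw [hre, hp1]
  let z' : (Σ ω, ULift.{v} (Fin (Fintype.card (I ω)))) → G := fun x => zz x.1 (e x.1 x.2)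
  let Y : (Σ ω, ULift.{v} (Fin (Fintype.card (I ω)))) → Finset G := fun x => ZZ x.1 (e x.1 x.2)
  let V : (Σ ω, ULift.{v} (Fin (Fintype.card (I ω)))) → ℕ → Finset G :=
    fun x => WW x.1 (e x.1 x.2)
  have hl : ∀ x, IsLeaf a δ h k r ((T x.1).set 0) (z' x) (Y x) (V x) := fun x => hleaf _ _
  have hY0 : ∀ x, (Y x).Nonempty := fun x => ⟨0, by exact_mod_cast (hl x).nbhd.2.2⟩
  obtain ⟨P'', hP'', hext', hexp'⟩ := exists_sigma_extension hP'
    (I := fun x => ULift.{v} (Fin (Y x).card)) (p := fun x _ => ((Y x).card : ℝ)⁻¹)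
    (fun x _ => by positivity) fun x => by
      have := sum_ulift_fin_eq_expect.{u, v} (Y x) fun _ => 1
      simp only [mul_one] at this
      rw [this, Finset.expect_const (hY0 x)]
  -- The uniform point of the leaf. Averaging over it turns the three required quantities into
  -- `approx`, `defectOne` and `defectTwo`.
  let w : (Σ x, ULift.{v} (Fin (Y x).card)) → G := fun y => (Y y.1).equivFin.symm y.2.down
  have hexpw : ∀ F : (Σ ω, ULift.{v} (Fin (Fintype.card (I ω)))) → G → ℝ,
      expect P'' (fun y => F y.1 (w y)) = expect P' fun x => 𝔼 w ∈ Y x, F x w := fun F => by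
    rw [hexp']
    congr 1
    funext x
    exact sum_ulift_fin_eq_expect (Y x) (F x)
  have hP'le : ∀ F : ∀ ω, I ω → ℝ, (∀ ω, ∑ i, p ω i * F ω i ≤ δ) →
      expect P' (fun x => F x.1 (e x.1 x.2)) ≤ δ := fun F hF => by
    rw [hexp]
    refine expect_le_of_forall_le hP fun ω => ?_
    exact (hre ω fun i => p ω i * F ω i).trans_le (hF ω)
  refine ⟨_, P', Sigma.fst, z', fun x => ⟨Y x, (hl x).nbhd⟩, hP', hext, ?_, _, P'', Sigma.fst,
    fun y => z' y.1 + w y, fun i y => ⟨V y.1 i, (hl y.1).nbhd_chain i⟩, hP'', hext', ?_, ?_, ?_, ?_⟩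
  · simp only [← hZ₀]
    refine tvNorm_meanUnif_sub_le hP hP' (fun ω => finite_vadd _ _) (fun x => finite_vadd _ _)
      fun f hf => ?_
    simp only [tsum_mul_unif_vadd]
    rw [hexp]
    refine abs_expect_sub_expect_le_of_forall hP fun ω => ?_
    rw [hre ω fun i => p ω i * 𝔼 w ∈ ZZ ω i, f (zz ω i + w)]
    exact htv ω f hf
  · intro i s _ _ hs
    refine tvNorm_meanUnif_sub_le hP' hP'' (fun x => finite_dilate_vadd _ _ _)
      (fun y => finite_vadd _ _) fun f hf => ?_
    simp only [tsum_mul_unif_vadd, tsum_mul_unif_dilate h2]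
    rw [hexpw fun x w => 𝔼 v ∈ V x i, f (2 ^ s • (z' x + w) + v)]
    exact abs_expect_sub_expect_le_of_forall hP' fun x => (hl x).approx i s hs f hf
  · intro i s hi hik hs
    simp only [dens_vadd, dens_dilate h2, sq_abs]
    rw [hexpw fun x w => ((𝔼 v ∈ V x i, a (2 ^ s • (z' x + w) + v)) - dilDens a s (z' x) (Y x)) ^ 2]
    exact hP'le (fun ω i' => defectOne a s (zz ω i') (ZZ ω i') (WW ω i' i))
      fun ω => hone ω i s hi hik hs
  · intro i j s hi hij hj hs
    simp only [dens_dilate h2, l2Sq_convMeas]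
    rw [hexpw fun x w => 𝔼 t ∈ V x i, ((𝔼 v ∈ V x j, if t - v ∈ V x i then
      a (2 ^ s • (z' x + w) + t - v) * a (2 ^ s • (z' x + w) + v) else 0) -
        dilDens a s (z' x) (Y x) ^ 2) ^ 2]
    exact hP'le (fun ω i' => defectTwo a s (zz ω i') (ZZ ω i') (WW ω i' i) (WW ω i' j))
      fun ω => htwo ω i j s hi hij hj hs
  · intro y
    obtain ⟨X, hX, hXk⟩ := (hl y.1).cover
    exact ⟨fun i _ _ => (hl y.1).closed i, coverFlat_le_of_cov (hT y.1.1).2.1 hh0 hX hXk⟩
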